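/- Let $\mathbb K$ be a field of characteristic $0$ (e.g. $\mathbb C$ or $\mathbb R$), let $\hbar\in\mathbb K$, and let $q\in\mathbb K^\times$ be either $1$ or not a root of unity. Put $[n]_q=\frac{q^n-q^{-n}}{q-q^{-1}}$ (so $[n]_1=n$). Let $V$ have basis $x_1,x_2$, let $$R=\begin{pmatrix}q&0&0&0\\0&q-q^{-1}&1&0\\0&1&0&0\\0&0&0&q\end{pmatrix},\qquad B=\mathrm{diag}(q,q^{-1}),\qquad C=\mathrm{diag}(q^{-1},q),$$ and let $\mathcal L_{\hbar,q}$ be the algebra generated by the entries of $L=\|l_i^{\,j}\|_{i,j=1,2}$ with relations $RL_1RL_1-L_1RL_1R=\hbar(RL_1-L_1R)$, $L_1=L\otimes\mathrm{id}$. Put $\mathrm{Tr}_R M=\sum_{i,j} M_i^{\,j}C_j^{\,i}$, $\mathcal{SL}_{\hbar,q}=\mathcal L_{\hbar,q}/\{\mathrm{Tr}_RL\}$ and $\sigma=-[2]_q^{-1}\mathrm{Tr}_RL^2\in\mathcal{SL}_{\hbar,q}$. For $\alpha\in\mathbb K$ the quantum non-commutative sphere is $\mathcal A_\alpha=\mathcal{SL}_{\hbar,q}/\{\sigma-\alpha\}$.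 For $m\ge 0$ let $V_{(m)}\subset V^{\otimes m}$ be the image of the $q$-symmetrizer $P_+^m$ of $R$. For $X\in\mathrm{End}(V)$ let $\Delta_m(X)=q^{1-m}[m]_q\,P_+^m(X\otimes\mathrm{id}^{\otimes(m-1)})$ on $V_{(m)}$ (so $\Delta_0=0$), and let $\mathrm{tr}_R(Y)=\mathrm{tr}(C^{\otimes m}|_{V_{(m)}}Y)$ for $Y\in \mathrm{End}(V_{(m)})$. Let $L_{(m)}$ be the $(m+1)\times(m+1)$ matrix over $\mathcal A_\alpha$ with transpose $L_{(m)}^t=\sum_{i,j} l_i^{\,j}\otimes\Delta_m(h_j^{\,i})$, where $h_j^{\,i}x_k=\delta_k^i x_j$; for a matrix $M$ over $\mathcal A_\alpha$ with $M^t\in\mathcal A_\alpha\otimes\mathrm{End}(V_{(m)})$ put $\mathrm{Tr}_RM=(\mathrm{id}\otimes\mathrm{tr}_R)(M^t)$. **(1)** Let $\alpha\in\mathbb K$, $m\ge0$, and let $s\in\mathbb K$ be a square root $s=\sqrt{\hbar^2-4\alpha q^2}$. Put $\mu_0=\frac{q^{-1}\hbar-q^{-1}s}{2}$, $\mu_1=\frac{q^{-1}\hbar+q^{-1}s}{2}$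 (the roots of $t^2-q^{-1}\hbar t+\alpha$) and, for $0\le i\le m$, $$q^{m-1}\mu_i(m)=q^{-i}[m-i]_q\,\mu_0+q^{i-m}[i]_q\,\mu_1+[i]_q[m-i]_q\,\hbar .$$ Assume that $\mu_0(m),\dots,\mu_m(m)$ are pairwise distinct. Then $\prod_{i=0}^m(L_{(m)}-\mu_i(m))=0$, and there are unique scalars $d_0(m),\dots,d_m(m)\in\mathbb K$ (the braided multiplicities of $L_{(m)}$) such that $$\mathrm{Tr}_RL_{(m)}^n=\sum_{i=0}^m\mu_i(m)^n\,d_i(m)\qquad\text{for all } n\ge0;$$ they are $$d_i(m)=\frac{q^{m-2i}+q^{-m+2i}}{2}+\frac{[m-2i]_q\,[2]_q\,\hbar}{2\sqrt{\hbar^2-4\alpha q^2}},\qquad 0\le i\le m$$ (for $m=0$ the second summand is $0$). **(2)** Let $\hbar\ne0$ and $k\ge0$. An sl-representation $\pi_k:\mathcal{SL}_{\hbar,q}\to\mathrm{End}(V_{(k)})$ is an algebra homomorphism for which there is a $\kappa\neq 0$ in $\mathbb K$ with $\pi_k(x)=\kappa\,\Delta_k(\pi_1'(x))$ for $x=l_1^{\,1}-l_2^{\,2},\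 l_1^{\,2},\ l_2^{\,1}$, where $\pi_1'(l_i^{\,j})x_k=B_k^{\,j}x_i$. Such $\pi_k$ exists. If $\bar\pi_k$ is the dual right representation, $\langle g\triangleleft\bar\pi_k(X),f\rangle=\langle g,\pi_k(X)\triangleright f\rangle$, then $$\bar\pi_k(\sigma)=\chi_k(\sigma)\,\mathrm{id},\qquad \chi_k(\sigma)=-\frac{\hbar^2[k]_q[k+2]_q}{q^2([k+2]_q-[k]_q)^2}.$$ For $\alpha=\chi_k(\sigma)$ the element $\frac{[2]_q[k+1]_q}{[k+2]_q-[k]_q}\hbar$ is a nonzero square root of $\hbar^2-4\alpha q^2$. If $\bar\pi_k(d_i(m))$ denotes the value of the above expression for $d_i(m)$ at this $\alpha$ and this square root, then $$\bar\pi_k(d_i(m))\,[k+1]_q=[k+m+1-2i]_q\qquad\text{for all } m\ge 0,\ 0\le i\le m .$$ -/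

import Mathlib

open scoped TensorProduct Kronecker BigOperators

namespace QSphere

noncomputable section

variable {K : Type*} [Field K]

/-- The quantum integer `[n]_q = (q ^ n - q ^ (-n)) / (q - q⁻¹)`, read as `n` at `q = 1`. -/
def qInt (q : K) (n : ℤ) : K :=
  open Classical in if q = 1 then (n : K) else (q ^ n - q ^ (-n)) / (q - q⁻¹)

/-! ### The Hecke symmetry and its structure matrices -/

/-- The Hecke symmetry on `V ⊗ V`, `V = K²`: `(x_i ⊗ x_j) ◁ R = ∑ R (i, j) (k, l) • x_k ⊗ x_l`. -/
def R (q : K) : Matrix (Fin 2 × Fin 2) (Fin 2 × Fin 2) K :=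
  Matrix.of fun s t =>
    if s = t ∧ s.1 = s.2 then q
    else if s = (0, 1) ∧ t = (0, 1) then q - q⁻¹
    else if s = (0, 1) ∧ t = (1, 0) then 1
    else if s = (1, 0) ∧ t = (0, 1) then 1
    else 0

/-- The matrix `B`, in the normalization `diag (q, q⁻¹)`. -/
def B (q : K) : Matrix (Fin 2) (Fin 2) K := !![q, 0; 0, q⁻¹]

/-- The matrix `C`, in the normalization `diag (q⁻¹, q)`. -/
def C (q : K) : Matrix (Fin 2) (Fin 2) K := !![q⁻¹, 0; 0, q]

/-! ### The modified reflection equation algebra, its traceless quotient, the quantum sphere -/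

section Algebras

variable {A : Type*} [Ring A] [Algebra K A]

/-- The left-hand side `R L₁ R L₁ - L₁ R L₁ R - ħ (R L₁ - L₁ R)` of the modified reflection
equation, where `L₁ = L ⊗ id`. -/
def mre (q hbar : K) (L : Matrix (Fin 2) (Fin 2) A) :
    Matrix (Fin 2 × Fin 2) (Fin 2 × Fin 2) A :=
  let R' : Matrix (Fin 2 × Fin 2) (Fin 2 × Fin 2) A := (R q).map (algebraMap K A)
  let L₁ : Matrix (Fin 2 × Fin 2) (Fin 2 × Fin 2) A := L ⊗ₖ (1 : Matrix (Fin 2) (Fin 2) A)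
  R' * L₁ * R' * L₁ - L₁ * R' * L₁ * R' - hbar • (R' * L₁ - L₁ * R')

/-- `Tr_R M = ∑ M_i^j C_j^i` for a `2 × 2` matrix `M` over an algebra. -/
def trR₂ (q : K) (M : Matrix (Fin 2) (Fin 2) A) : A := ∑ i, ∑ j, C q j i • M i j

end Algebras

/-- The defining relations of the mRE algebra on the free algebra in the `l_i^j`. -/
inductive MRERel (q hbar : K) :
    FreeAlgebra K (Fin 2 × Fin 2) → FreeAlgebra K (Fin 2 × Fin 2) → Prop
  | entry (s t : Fin 2 × Fin 2) :
      MRERel q hbar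
        (mre q hbar (Matrix.of fun i j : Fin 2 => FreeAlgebra.ι K (i, j)) s t) 0

/-- The modified reflection equation algebra `𝓛_{ħ,q}`. -/
abbrev MREAlg (q hbar : K) : Type _ := RingQuot (MRERel q hbar)

/-- The generating matrix `L = (l_i^j)` of `𝓛_{ħ,q}`. -/
def mreL (q hbar : K) : Matrix (Fin 2) (Fin 2) (MREAlg q hbar) :=
  Matrix.of fun i j => RingQuot.mkAlgHom K (MRERel q hbar) (FreeAlgebra.ι K (i, j))

/-- The relation `𝐥 = Tr_R L = 0`. -/
inductive SLRel (q hbar : K) : MREAlg q hbar → MREAlg q hbar → Prop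
  | trace : SLRel q hbar (trR₂ q (mreL q hbar)) 0

/-- The algebra `𝓢𝓛_{ħ,q} = 𝓛_{ħ,q} / {𝐥}`. -/
abbrev SLAlg (q hbar : K) : Type _ := RingQuot (SLRel q hbar)

/-- The generating matrix `L` of `𝓢𝓛_{ħ,q}`. -/
def slL (q hbar : K) : Matrix (Fin 2) (Fin 2) (SLAlg q hbar) :=
  (mreL q hbar).map (RingQuot.mkAlgHom K (SLRel q hbar))

/-- The quadratic Casimir element `σ = -[2]_q⁻¹ Tr_R L²` of `𝓢𝓛_{ħ,q}`. -/
def sigma (q hbar : K) : SLAlg q hbar :=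
  (-(qInt q 2)⁻¹) • trR₂ q (slL q hbar ^ 2)

/-- The relation `σ = α`. -/
inductive SphereRel (q hbar α : K) : SLAlg q hbar → SLAlg q hbar → Prop
  | casimir : SphereRel q hbar α (sigma q hbar) (algebraMap K (SLAlg q hbar) α)

/-- The quantum non-commutative sphere `𝓢𝓛_{ħ,q} / {σ - α}`. -/
abbrev Sphere (q hbar α : K) : Type _ := RingQuot (SphereRel q hbar α)

/-- The generating matrix `L` of the quantum sphere. -/
def sphereL (q hbar α : K) : Matrix (Fin 2) (Fin 2) (Sphere q hbar α) :=
  (slL q hbar).map (RingQuot.mkAlgHom K (SphereRel q hbar α))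

/-! ### The simple objects `V_(m)` and the truncated coproduct

`V^{⊗m}` is the space of functions on words `Fin m → Fin 2`; the word `w` stands for
`x_{w 0} ⊗ ⋯ ⊗ x_{w (m - 1)}`, and operators are matrices acting on columns. -/

/-- The Hecke symmetry acting in the tensor factors number `k` and `k + 1` of `V^{⊗m}`, where the
factors are counted from `1` and `1 ≤ k < m` (for other `k` the value is irrelevant). -/
def braidAt (q : K) (m k : ℕ) : Matrix (Fin m → Fin 2) (Fin m → Fin 2) K :=
  Matrix.of fun w w' =>
    if h : k < m then
      let a : Fin m := ⟨k - 1, lt_of_le_of_lt (Nat.sub_le k 1) h⟩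
      let b : Fin m := ⟨k, h⟩
      if ∀ j, j ≠ a → j ≠ b → w j = w' j then R q (w a, w b) (w' a, w' b) else 0
    else 0

/-- The `q`-symmetrizer of the first `k` tensor factors of `V^{⊗m}`, a polynomial in the braidings:
`P^{k+1} = [k+1]_q⁻¹ P^k (q^{-k} + [k]_q R_{k,k+1}) P^k`, `P^0 = P^1 = id`. -/
def symmetrizer (q : K) (m : ℕ) : ℕ → Matrix (Fin m → Fin 2) (Fin m → Fin 2) K
  | 0 => 1
  | k + 1 => (qInt q (k + 1))⁻¹ •
      (symmetrizer q m k * (q ^ (-(k : ℤ)) • 1 + qInt q k • braidAt q m k) * symmetrizer q m k)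

/-- The projector `P_+^m : V^{⊗m} → V^{⊗m}` onto the `q`-symmetric tensors. -/
def projPlus (q : K) (m : ℕ) : ((Fin m → Fin 2) → K) →ₗ[K] ((Fin m → Fin 2) → K) :=
  Matrix.toLin' (symmetrizer q m m)

/-- The space `V_(m) = Λ_+^m(V)`, the image of `P_+^m`. -/
abbrev Vm (q : K) (m : ℕ) : Submodule K ((Fin m → Fin 2) → K) := LinearMap.range (projPlus q m)

/-- The compression to `V_(m)` of an operator `T` on `V^{⊗m}`: the restriction of `P_+^m ∘ T`. -/
def compress (q : K) (m : ℕ) (T : Matrix (Fin m → Fin 2) (Fin m → Fin 2) K) :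
    Module.End K (Vm q m) :=
  (projPlus q m).rangeRestrict ∘ₗ Matrix.toLin' T ∘ₗ (Vm q m).subtype

/-- `X ⊗ id ⊗ ⋯ ⊗ id` on `V^{⊗m}`. -/
def onFirst (m : ℕ) (X : Matrix (Fin 2) (Fin 2) K) :
    Matrix (Fin m → Fin 2) (Fin m → Fin 2) K :=
  Matrix.of fun w w' => ∏ j : Fin m, (if j.val = 0 then X else 1) (w j) (w' j)

/-- The truncated coproduct `Δ_m : End_l(V) → End_l(V_(m))`,
`X ↦ q^{1-m} [m]_q P_+^m (X ⊗ id_{(m-1)})`. -/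
def truncCoprod (q : K) (m : ℕ) (X : Matrix (Fin 2) (Fin 2) K) : Module.End K (Vm q m) :=
  (q ^ (1 - (m : ℤ)) * qInt q m) • compress q m (onFirst m X)

/-- The categorical trace `tr_R Y = tr (C_(m) Y)` on `End_l(V_(m))`, where `C_(m)` is the
restriction of `C^{⊗m}`; it is normalized by `tr_R id = [m+1]_q`. -/
def trR (q : K) (m : ℕ) : Module.End K (Vm q m) →ₗ[K] K :=
  LinearMap.trace K (Vm q m) ∘ₗ
    LinearMap.mulLeft K (compress q m (Matrix.of fun w w' => ∏ j : Fin m, C q (w j) (w' j)))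

/-! ### The matrices `L_(m)`, their eigenvalues and braided multiplicities -/

/-- The extension `L_(m)` of `L`, the image `∑ l_i^j ⊗ Δ_m(h_j^i)` of the braided Casimir element,
where `h_j^i` is the matrix unit with `h_j^i ▷ x_k = δ_k^i x_j`.

Since `L_(m)` is the *transpose* of this image regarded as a matrix over the sphere, its powers are
`∑ l_{i₁}^{j₁} ⋯ l_{iₙ}^{jₙ} ⊗ Δ_m(h_{jₙ}^{iₙ}) ⋯ Δ_m(h_{j₁}^{i₁})`.  These are
the powers in the tensor product of the sphere with the *opposite* algebra of `End(V_(m))`. -/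
def Lm (q hbar α : K) (m : ℕ) :
    Sphere q hbar α ⊗[K] (Module.End K (Vm q m))ᵐᵒᵖ :=
  ∑ i, ∑ j, sphereL q hbar α i j ⊗ₜ[K]
    MulOpposite.op (truncCoprod q m (Matrix.single j i (1 : K)))

/-- `Tr_R = id ⊗ tr_R`, with values in the sphere. -/
def TrR (q hbar α : K) (m : ℕ) :
    Sphere q hbar α ⊗[K] (Module.End K (Vm q m))ᵐᵒᵖ →ₗ[K] Sphere q hbar α :=
  (TensorProduct.rid K (Sphere q hbar α)).toLinearMap ∘ₗ
    TensorProduct.map LinearMap.id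
      (trR q m ∘ₗ (MulOpposite.opLinearEquiv K).symm.toLinearMap)

/-- The quantities `μ_i(m)`:
`q^{m-1} μ_i(m) = q^{-i} [m-i]_q μ₀ + q^{i-m} [i]_q μ₁ + [i]_q [m-i]_q ħ`, where
`μ₀ = (q⁻¹ ħ - q⁻¹ s) / 2` and `μ₁ = (q⁻¹ ħ + q⁻¹ s) / 2`, and `s` is a square root of
`ħ² - 4 α q²`, so that `μ₀, μ₁` are the roots of `t² - q⁻¹ ħ t + α`. -/
def eigenvalue (q hbar s : K) (m : ℕ) (i : Fin (m + 1)) : K :=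
  let mu₀ : K := (q⁻¹ * hbar - q⁻¹ * s) / 2
  let mu₁ : K := (q⁻¹ * hbar + q⁻¹ * s) / 2
  q ^ (1 - (m : ℤ)) *
    (q ^ (-(i.val : ℤ)) * qInt q ((m : ℤ) - i.val) * mu₀
      + q ^ ((i.val : ℤ) - m) * qInt q i.val * mu₁
      + qInt q i.val * qInt q ((m : ℤ) - i.val) * hbar)

/-- Scalars `d_i` are the braided multiplicities of `L_(m)`, relative to the eigenvalues `mu i`, if
`Tr_R L_(m)^n = ∑ μ_i^n d_i` for all `n ≥ 0`. -/
def IsBraidedMultiplicities (q hbar α : K) (m : ℕ) (mu d : Fin (m + 1) → K) : Prop :=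
  ∀ n : ℕ, TrR q hbar α m (Lm q hbar α m ^ n) =
    algebraMap K (Sphere q hbar α) (∑ i, mu i ^ n * d i)

/-- The expression
`(q^{m-2i} + q^{-m+2i}) / 2 + [m-2i]_q [2]_q ħ / (2 s)`, where `s` is a square root of
`ħ² - 4 α q²`. -/
def multFormula (q hbar s : K) (m : ℕ) (i : Fin (m + 1)) : K :=
  (q ^ ((m : ℤ) - 2 * i.val) + q ^ (-(m : ℤ) + 2 * i.val)) / 2
    + qInt q ((m : ℤ) - 2 * i.val) * qInt q 2 * hbar / (2 * s)

/-! ### The representations `π_k` and `π̄_k` of `𝓢𝓛_{ħ,q}` -/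

/-- The operator on `V` corresponding to `l_i^j`, namely `l_i^j ▷ x_k = B_k^j x_i`. -/
def lOp (q : K) (i j : Fin 2) : Matrix (Fin 2) (Fin 2) K :=
  ∑ a, B q a j • Matrix.single i a (1 : K)

/-- `π` is the sl-representation `π_k` of `𝓢𝓛_{ħ,q}` in `V_(k)`: up to a normalization factor
(fixed by the value of `ħ`) it is given on the traceless generators `g = l_1^1 - l_2^2`,
`b = l_1^2`, `c = l_2^1` by the truncated coproduct. -/
def IsSlRep (q hbar : K) (k : ℕ) (π : SLAlg q hbar →ₐ[K] Module.End K (Vm q k)) : Prop :=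
  ∃ κ : K, κ ≠ 0 ∧
    π (slL q hbar 0 0 - slL q hbar 1 1) = κ • truncCoprod q k (lOp q 0 0 - lOp q 1 1) ∧
    π (slL q hbar 0 1) = κ • truncCoprod q k (lOp q 0 1) ∧
    π (slL q hbar 1 0) = κ • truncCoprod q k (lOp q 1 0)

/-- The right representation `π̄` in the dual space: `⟨g ◁ π̄(X), f⟩ = ⟨g, π(X) ▷ f⟩`.
Operators acting from the right form the opposite of the algebra of endomorphisms. -/
def rightRep {q hbar : K} {k : ℕ} (π : SLAlg q hbar →ₐ[K] Module.End K (Vm q k)) :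
    SLAlg q hbar →ₐ[K] (Module.End K (Module.Dual K (Vm q k)))ᵐᵒᵖ :=
  AlgHom.ofLinearMap
    ((MulOpposite.opLinearEquiv K).toLinearMap ∘ₗ
      Module.Dual.transpose (R := K) (M := Vm q k) (M' := Vm q k) ∘ₗ π.toLinearMap)
    (by
      apply MulOpposite.unop_injective
      ext f v
      simp [Module.Dual.transpose_apply])
    (by
      intro x y
      apply MulOpposite.unop_injective
      ext f v
      simp [Module.Dual.transpose_apply])

/-- The value `-ħ² [k]_q [k+2]_q / (q² ([k+2]_q - [k]_q)²)`. -/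
def casimirValue (q hbar : K) (k : ℕ) : K :=
  -(hbar ^ 2 * qInt q k * qInt q (k + 2)) / (q ^ 2 * (qInt q (k + 2) - qInt q k) ^ 2)

/-- The value `[2]_q [k+1]_q ħ / ([k+2]_q - [k]_q)`, chosen with the positive sign, of the
square root of `ħ² - 4 α q²`. -/
def casimirRoot (q hbar : K) (k : ℕ) : K :=
  qInt q 2 * qInt q (k + 1) * hbar / (qInt q (k + 2) - qInt q k)

end

end QSphere

/-! Put `e = q - R`, an operator of rank one on `V ⊗ V`. For a matrix `L` with `Tr_R L = 0` one has
`e L₁ e = 0`, and the modified reflection equation collapses to the statement that `L² - q⁻¹ ħ L`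
commutes with `e` (`mre_eq`), hence is a scalar matrix (`charMatrix_eq_diagonal`); the scalar is
`-σ`. Over the sphere, `L` is thus a traceless matrix with `(L - μ₀)(L - μ₁) = 0`, and `L₁` together
with the Temperley–Lieb generators `e_k` on `V^{⊗m}` satisfies the relations of the one-boundary
Temperley–Lieb (blob) algebra.

`L_(m)` is a multiple of the compression `φ` of `L₁` to the image of the Jones–Wenzl projector `p`.
Compression is not multiplicative, so `L₁` is traded for the sum of the Jucys–Murphy elements `J_0 =
L₁`, `J_{k+1} = r_k J_k r_k - ħ r_k`, with `r_k = q - e_k`. Suitably normalized, this Casimir has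
the compression `L_(m)` (`map_casimir`) and it commutes with `p`. The products `F_j = ∏_{k<j} (J_k -
μ₀)` are killed by `e_i` for `i + 1 < j` and are eigenvectors of the `J_k` with `k < j`. Hence the
Casimir acts triangularly, `φ(C F_j) = μ_j(m) φ(F_j) + c_j φ(F_{j+1})` with `c_m = 0`
(`map_casimir_mul`). This gives the characteristic identity and shows that `∏_{l<j} (L_(m) -
μ_l(m))` is a multiple of `φ(F_j)`.

Partial traces strip off one tensor factor at a time and evaluate the trace of `F_j p`
(`trace_jmProd_mul_jw`). A telescoping sum shows that the proposed `d_i` have the same moments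
against the Newton basis (`sum_mult_mul_prod`), and these moments with the characteristic identity
determine all power sums (`map_pow_of_newton`). Uniqueness is the Vandermonde argument, once `K` is
known to embed in the sphere (`nontrivial_sphere`).

For the second part, the matrix `T = (Δ_k(l_i^j))` satisfies `T² = e T` for a scalar `e`, because
the left partial trace of `p` is a multiple of a smaller projector. The traceless shift `κ (T - c)`
satisfies the relations when `κ (e - 2c) = q⁻¹ ħ`; for `k > 0` this condition is also forced, and
the value of `σ` can be read off. The final identity is the mean of two forms of the addition
formula for quantum integers. -/

namespace QSphere

/-! ### Identities between quantum integers. -/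

section QuantumIntegers

variable {K : Type*} [Field K]

/-- `q` is nonzero, and it is `1` or not a root of unity. -/
structure Generic (q : K) : Prop where
  ne_zero : q ≠ 0
  eq_one_or : q = 1 ∨ ∀ n : ℕ, 0 < n → q ^ n ≠ 1

theorem qInt_one_left (n : ℤ) : qInt (1 : K) n = n := by simp [qInt]

/-- In this form `q ^ 2 - 1` is the only denominator besides powers of `q`. Together with the
separate case `q = 1` it turns the identities below into polynomial ones. -/
theorem qInt_of_ne {q : K} (h0 : q ≠ 0) (h : q ≠ 1) (n : ℤ) :
    qInt q n = q * (q ^ n - (q ^ n)⁻¹) / (q ^ 2 - 1) := by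
  have : q - q⁻¹ = (q ^ 2 - 1) / q := by field_simp
  rw [qInt, if_neg h, this, zpow_neg, div_div_eq_mul_div, mul_comm]

@[simp] theorem qInt_zero (q : K) : qInt q 0 = 0 := by simp [qInt]

theorem qInt_neg (q : K) (n : ℤ) : qInt q (-n) = -qInt q n := by
  unfold qInt
  split_ifs
  · push_cast; ring
  · rw [neg_neg]; ring

/-- Up to a factor, the difference of two eigenvalues of `L_(m)`, and the numerator of the
braided multiplicities. -/
noncomputable def qDiff (q h s : K) (n : ℤ) : K :=
  s * (q ^ n + q ^ (-n)) / 2 + qInt q n * qInt q 2 * h / 2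

/-- The sum `∑_{k < n} q^k [k]_q`. -/
noncomputable def qTri (q : K) (n : ℕ) : K := ∑ k ∈ Finset.range n, q ^ k * qInt q k

theorem qTri_succ (q : K) (n : ℕ) : qTri q (n + 1) = qTri q n + q ^ n * qInt q n :=
  Finset.sum_range_succ _ _

/-- The eigenvalues of the Jucys–Murphy elements on the vectors of highest weight. -/
noncomputable def jmValue (q h b : K) (k : ℕ) : K := q ^ (2 * k) * b - h * (q ^ k * qInt q k)

namespace Generic

variable {q : K} (hq : Generic q)
include hq

theorem sq_sub_one_ne_zero (h : q ≠ 1) : q ^ 2 - 1 ≠ 0 := by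
  rcases hq.eq_one_or with h1 | h1
  · exact absurd h1 h
  · exact sub_ne_zero.2 (h1 2 (by norm_num))

theorem qInt_add (m n : ℤ) : qInt q (m + n) = q ^ n * qInt q m + (q ^ m)⁻¹ * qInt q n := by
  have h0 := hq.ne_zero
  by_cases h : q = 1
  · subst h; simp [qInt_one_left]
  · have h2 := hq.sq_sub_one_ne_zero h
    simp only [qInt_of_ne h0 h, zpow_add₀ h0]
    have := zpow_ne_zero m h0
    have := zpow_ne_zero n h0
    field_simp
    ring

theorem qInt_one : qInt q 1 = 1 := by
  have h0 := hq.ne_zero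
  by_cases h : q = 1
  · subst h; simp [qInt_one_left]
  · have h2 := hq.sq_sub_one_ne_zero h
    simp only [qInt_of_ne h0 h, zpow_one]
    field_simp

theorem qInt_two : qInt q 2 = q + q⁻¹ := by
  rw [show (2 : ℤ) = 1 + 1 by norm_num, hq.qInt_add, hq.qInt_one]; simp

theorem qInt_succ (n : ℤ) : qInt q (n + 1) = q * qInt q n + (q ^ n)⁻¹ := by
  rw [hq.qInt_add, hq.qInt_one]; simp

theorem qInt_add_two_sub (n : ℤ) :
    qInt q (n + 2) - qInt q n = q ^ (n + 1) + (q ^ (n + 1))⁻¹ := by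
  have h0 := hq.ne_zero
  by_cases h : q = 1
  · subst h; simp [qInt_one_left]; norm_num
  · have h2 := hq.sq_sub_one_ne_zero h
    simp only [qInt_of_ne h0 h, zpow_add₀ h0, zpow_one, zpow_two]
    have := zpow_ne_zero n h0
    field_simp
    ring

theorem qInt_add_two_add (n : ℤ) :
    qInt q (n + 2) + qInt q n = qInt q 2 * qInt q (n + 1) := by
  have h0 := hq.ne_zero
  by_cases h : q = 1
  · subst h; simp [qInt_one_left]; ring
  · have h2 := hq.sq_sub_one_ne_zero h
    rw [hq.qInt_two]
    simp only [qInt_of_ne h0 h, zpow_add₀ h0, zpow_one, zpow_two]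
    have := zpow_ne_zero n h0
    field_simp
    ring

theorem qInt_ne_zero [CharZero K] {n : ℕ} (hn : 0 < n) : qInt q n ≠ 0 := by
  have h0 := hq.ne_zero
  rcases hq.eq_one_or with h | h1
  · subst h; simp [qInt_one_left]; omega
  · have h : q ≠ 1 := by simpa using h1 1 one_pos
    have h2 := hq.sq_sub_one_ne_zero h
    rw [qInt_of_ne h0 h, zpow_natCast]
    -- A zero of the numerator means `q ^ (2 * n) = 1`.
    refine div_ne_zero (mul_ne_zero h0 fun h3 => h1 (2 * n) (by omega) ?_) h2
    have := pow_ne_zero n h0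
    field_simp at h3
    rw [pow_mul']
    linear_combination h3

theorem qInt_two_ne_zero [CharZero K] : qInt q 2 ≠ 0 := by
  exact_mod_cast hq.qInt_ne_zero (n := 2) (by norm_num)

theorem qInt_add_two_sub_ne_zero [CharZero K] (n : ℕ) :
    qInt q (n + 2) - qInt q n ≠ 0 := by
  have h0 := hq.ne_zero
  rw [hq.qInt_add_two_sub]
  rcases hq.eq_one_or with h | h1
  · subst h; norm_num
  · intro h2
    -- If `q ^ (n + 1)` and its inverse have sum zero, then `q ^ (2 * (n + 1)) = -1`; squaring gives
    -- a root of unity.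
    refine h1 (4 * (n + 1)) (by omega) ?_
    have h3 := pow_ne_zero (n + 1) h0
    have h4 : q ^ ((n : ℤ) + 1) = q ^ (n + 1) := by exact_mod_cast zpow_natCast q (n + 1)
    rw [h4] at h2
    field_simp at h2
    rw [pow_mul']
    linear_combination ((q ^ (n + 1)) ^ 2 - 1) * h2

/-- This is the discrete derivative behind `sum_qDiff_mul_prod`: up to a common product, the left
side is the difference of two consecutive values of the primitive. -/
theorem qDiff_telescope [CharZero K] (h s : K) (i j m : ℤ) :
    qInt q (i + 1) * qDiff q h s (m - i - j) - qInt q (i - j) * qDiff q h s (m + 1 - i)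
      = qInt q (j + 1) * qDiff q h s (m - 2 * i) := by
  have h0 := hq.ne_zero
  unfold qDiff
  by_cases h : q = 1
  · subst h; simp [qInt_one_left]; ring
  · have h2 := hq.sq_sub_one_ne_zero h
    rw [hq.qInt_two]
    simp only [qInt_of_ne h0 h, zpow_add₀ h0, zpow_sub₀ h0, zpow_neg, two_mul, zpow_one]
    have := zpow_ne_zero i h0
    have := zpow_ne_zero j h0
    have := zpow_ne_zero m h0
    generalize q ^ i = I at *
    generalize q ^ j = J at *
    generalize q ^ m = M at *
    field_simp
    ring

/-- The multiplicities have the same `qDiff` in their numerators (`multFormula_eq`); this common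
shape makes the Newton moments telescope. -/
theorem eigenvalue_sub [CharZero K] (h s : K) (m : ℕ) (i l : Fin (m + 1)) :
    eigenvalue q h s m i - eigenvalue q h s m l =
      (q ^ m)⁻¹ * qInt q (i.val - l.val) * qDiff q h s (m - i.val - l.val) := by
  have h0 := hq.ne_zero
  unfold qDiff eigenvalue
  generalize (i.val : ℤ) = i
  generalize (l.val : ℤ) = l
  rw [← zpow_natCast q m]
  have hm : (m : K) = ((m : ℤ) : K) := by simp
  generalize (m : ℤ) = m at *
  by_cases h : q = 1
  · subst h; simp [qInt_one_left]; ring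
  · have h2 := hq.sq_sub_one_ne_zero h
    rw [hq.qInt_two]
    simp only [qInt_of_ne h0 h, zpow_sub₀ h0, zpow_neg, zpow_one]
    have := zpow_ne_zero i h0
    have := zpow_ne_zero l h0
    have := zpow_ne_zero m h0
    generalize q ^ i = I at *
    generalize q ^ l = J at *
    generalize q ^ m = M at *
    field_simp
    ring

/-- The defect of additivity is the source of the term `[i]_q [m-i]_q ħ` in the eigenvalues. -/
theorem qTri_add (j r : ℕ) :
    qTri q (j + r) = qTri q j + qTri q r + q ^ ((j : ℤ) + r - 1) * (qInt q j * qInt q r) := by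
  have h0 := hq.ne_zero
  induction r with
  | zero => simp [qTri]
  | succ r ih =>
    rw [← add_assoc, qTri_succ, ih, qTri_succ]
    push_cast
    simp only [← zpow_natCast q, hq.qInt_succ, hq.qInt_add, zpow_add₀ h0, zpow_sub₀ h0, zpow_one]
    push_cast
    simp only [zpow_add₀ h0]
    have := zpow_ne_zero j h0
    have := zpow_ne_zero r h0
    by_cases h : q = 1
    · subst h; simp [qInt_one_left]
      try ring
    · have h2 := hq.sq_sub_one_ne_zero h
      simp only [qInt_of_ne h0 h]
      field_simp
      ring

theorem sum_pow_two_mul (n : ℕ) :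
    ∑ k ∈ Finset.range n, q ^ (2 * k) = q ^ ((n : ℤ) - 1) * qInt q n := by
  have h0 := hq.ne_zero
  induction n with
  | zero => simp
  | succ n ih =>
    rw [Finset.sum_range_succ, ih]
    push_cast
    simp only [hq.qInt_succ, zpow_sub₀ h0, zpow_add₀ h0, zpow_one, zpow_natCast]
    have := pow_ne_zero n h0
    by_cases h : q = 1
    · subst h; simp
    · have h2 := hq.sq_sub_one_ne_zero h
      rw [qInt_of_ne h0 h, zpow_natCast, pow_mul']
      field_simp
      ring

theorem jmValue_succ (h b : K) (k : ℕ) :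
    jmValue q h b (k + 1) = q ^ 2 * jmValue q h b k - h * q := by
  have h0 := hq.ne_zero
  unfold jmValue
  push_cast
  rw [hq.qInt_succ, zpow_natCast]
  have := pow_ne_zero k h0
  field_simp
  ring

theorem sum_jmValue (h b : K) (n : ℕ) :
    ∑ k ∈ Finset.range n, jmValue q h b k = q ^ ((n : ℤ) - 1) * qInt q n * b - h * qTri q n := by
  unfold jmValue qTri
  rw [Finset.sum_sub_distrib, ← Finset.sum_mul, ← Finset.mul_sum, hq.sum_pow_two_mul]

/-- The left side is the weighted partial trace of `J_k - μ₀` next to `F_k`: the formula `ptr_jm`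
with each lower `J_i` replaced by its eigenvalue, minus `[2]_q μ₀`. -/
theorem partialTrace_value [CharZero K] (h s : K) (k : ℕ) :
    (q ^ 3 - q) * ∑ i ∈ Finset.range k, jmValue q h ((q⁻¹ * h + q⁻¹ * s) / 2) i
      - k * (h * q ^ 2) - qInt q 2 * ((q⁻¹ * h - q⁻¹ * s) / 2)
      = q ^ ((k : ℤ) - 1) * qDiff q h s (-(k + 1)) := by
  have h0 := hq.ne_zero
  induction k with
  | zero =>
    unfold qDiff
    simp only [zpow_neg, Nat.cast_zero, zero_add, qInt_neg, hq.qInt_one, hq.qInt_two]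
    simp
    field_simp
    ring
  | succ k ih =>
    rw [Finset.sum_range_succ]
    have e : jmValue q h ((q⁻¹ * h + q⁻¹ * s) / 2) k * (q ^ 3 - q) =
      q ^ (((k + 1 : ℕ) : ℤ) - 1) * qDiff q h s (-((k + 1 : ℕ) + 1)) -
      q ^ ((k : ℤ) - 1) * qDiff q h s (-(k + 1)) + h * q ^ 2 := by
      unfold qDiff jmValue
      rw [hq.qInt_two]
      push_cast
      simp only [qInt_neg, zpow_neg]
      by_cases h : q = 1
      · subst h; simp [qInt_one_left]; ring
      · have h2 := hq.sq_sub_one_ne_zero h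
        simp only [qInt_of_ne h0 h, zpow_sub₀ h0, zpow_add₀ h0, zpow_one, zpow_natCast]
        have := pow_ne_zero k h0
        rw [pow_mul']
        field_simp
        ring
    push_cast at e ⊢
    linear_combination ih + e

end Generic

end QuantumIntegers

end QSphere

namespace QSphere

/-! ### The Temperley–Lieb algebra and the Jones–Wenzl projectors. -/

section TemperleyLieb

variable {K : Type*} [Field K] {A : Type*} [Ring A] [Algebra K A]

/-- The relations of the Temperley–Lieb algebra on `n` strands with loop value `[2]_q`. -/
structure IsTL (q : K) (n : ℕ) (e : ℕ → A) : Prop where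
  sq : ∀ k, k + 1 < n → e k * e k = qInt q 2 • e k
  up : ∀ k, k + 2 < n → e k * e (k + 1) * e k = e k
  down : ∀ k, k + 2 < n → e (k + 1) * e k * e (k + 1) = e (k + 1)
  far : ∀ i j, i + 1 < j → j + 1 < n → Commute (e i) (e j)

/-- The Jones–Wenzl projectors. -/
noncomputable def jw (q : K) (e : ℕ → A) : ℕ → A
  | 0 => 1
  | 1 => 1
  | k + 2 => jw q e (k + 1) -
      (qInt q (k + 1 : ℕ) / qInt q (k + 2 : ℕ)) • (jw q e (k + 1) * e k * jw q e (k + 1))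

theorem IsTL.reverse {q : K} {n : ℕ} {e : ℕ → A} (h : IsTL q n e) :
    IsTL q n (fun k => e (n - 2 - k)) where
  sq k hk := h.sq _ (by omega)
  up k hk := by
    have := h.down (n - 2 - (k + 1)) (by omega)
    rwa [show n - 2 - (k + 1) + 1 = n - 2 - k by omega] at this
  down k hk := by
    have := h.up (n - 2 - (k + 1)) (by omega)
    rwa [show n - 2 - (k + 1) + 1 = n - 2 - k by omega] at this
  far i j hij hj := (h.far (n - 2 - j) (n - 2 - i) (by omega) (by omega)).symm

theorem jw_succ_succ (q : K) (e : ℕ → A) (k : ℕ) :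
    jw q e (k + 2) = jw q e (k + 1) -
      (qInt q (k + 1 : ℕ) / qInt q (k + 2 : ℕ)) • (jw q e (k + 1) * e k * jw q e (k + 1)) := rfl

theorem jw_mem {q : K} {e : ℕ → A} {S : Subalgebra K A} :
    ∀ k, (∀ i, i + 1 < k → e i ∈ S) → jw q e k ∈ S
  | 0, _ => one_mem S
  | 1, _ => one_mem S
  | k + 2, h => by
    have ih := jw_mem (S := S) (q := q) (k + 1) fun i hi => h i (by omega)
    exact sub_mem ih (S.smul_mem (mul_mem (mul_mem ih (h k (by omega))) ih) _)

theorem commute_jw {q : K} {e : ℕ → A} {y : A} (k : ℕ) (h : ∀ i, i + 1 < k → Commute y (e i)) :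
    Commute y (jw q e k) := by
  have := jw_mem (q := q) (S := Subalgebra.centralizer K {y}) (e := e) k fun i hi => by
    rw [Subalgebra.mem_centralizer_iff]
    rintro _ rfl
    exact h i hi
  rw [Subalgebra.mem_centralizer_iff] at this
  exact this y rfl

theorem jw_mul_of_annihilated {q : K} {e : ℕ → A} {y : A} :
    ∀ k, (∀ i, i + 1 < k → e i * y = 0) → jw q e k * y = y
  | 0, _ => one_mul y
  | 1, _ => one_mul y
  | k + 2, h => by
    have ih := jw_mul_of_annihilated (q := q) (k + 1) fun i hi => h i (by omega)
    rw [jw_succ_succ, sub_mul, smul_mul_assoc, mul_assoc, mul_assoc, ih, h k (by omega)]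
    simp

theorem mul_jw_of_annihilated {q : K} {e : ℕ → A} {y : A} :
    ∀ k, (∀ i, i + 1 < k → y * e i = 0) → y * jw q e k = y
  | 0, _ => mul_one y
  | 1, _ => mul_one y
  | k + 2, h => by
    have ih := mul_jw_of_annihilated (q := q) (k + 1) fun i hi => h i (by omega)
    rw [jw_succ_succ, mul_sub, mul_smul_comm, ← mul_assoc, ← mul_assoc, ih, h k (by omega)]
    simp

namespace IsTL

variable [CharZero K] {q : K} (hq : Generic q) {n : ℕ} {e : ℕ → A} (h : IsTL q n e)
include hq h

/-- The two claims must be proved together. The sandwich formula for `p_{k+1}` is what makes `e_k`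
annihilate `p_{k+2}`; the next sandwich formula then follows from `e_{k+1} e_k e_{k+1} = e_{k+1}`
and `[j+2] + [j] = [2] [j+1]`. -/
theorem jw_aux (k : ℕ) (hk : k ≤ n) :
    (∀ i, i + 1 < k → e i * jw q e k = 0 ∧ jw q e k * e i = 0) ∧
      ∀ j, j + 1 = k → j + 1 < n →
        e j * jw q e k * e j = (qInt q (j + 2 : ℕ) / qInt q (j + 1 : ℕ)) • (jw q e j * e j) := by
  induction k with
  | zero => simp
  | succ k ih =>
    rcases k with _ | k
    · refine ⟨by omega, ?_⟩
      intro j hj hn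
      obtain rfl : j = 0 := by omega
      have := hq.qInt_one
      simp [jw, h.sq 0 hn, this]
    · obtain ⟨ih1, ih2⟩ := ih (by omega)
      have hpos : ∀ l : ℕ, qInt q ((l + 1 : ℕ) : ℤ) ≠ 0 := fun l => hq.qInt_ne_zero (by omega)
      have ih2 := ih2 k rfl (by omega)
      have idem : jw q e (k + 1) * jw q e (k + 1) = jw q e (k + 1) :=
        jw_mul_of_annihilated _ fun i hi => (ih1 i hi).1
      have absl : jw q e k * jw q e (k + 1) = jw q e (k + 1) :=
        jw_mul_of_annihilated _ fun i hi => (ih1 i (by omega)).1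
      have absr : jw q e (k + 1) * jw q e k = jw q e (k + 1) :=
        mul_jw_of_annihilated _ fun i hi => (ih1 i (by omega)).2
      have comm : Commute (e k) (jw q e k) :=
        commute_jw k fun i hi => (h.far i k (by omega) (by omega)).symm
      have hc : (qInt q (k + 1 : ℕ) / qInt q (k + 2 : ℕ)) *
          (qInt q (k + 2 : ℕ) / qInt q (k + 1 : ℕ)) = 1 := by
        have := hpos k
        have := hpos (k + 1)
        field_simp
      refine ⟨fun i hi => ?_, ?_⟩
      · rcases Nat.lt_or_ge (i + 1) (k + 1) with hlt | hge
        · rw [jw_succ_succ]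
          constructor
          · rw [mul_sub, mul_smul_comm, ← mul_assoc, ← mul_assoc, (ih1 i hlt).1]; simp
          · rw [sub_mul, smul_mul_assoc, mul_assoc, (ih1 i hlt).2]; simp
        · obtain rfl : i = k := by omega
          rw [jw_succ_succ]
          constructor
          · rw [mul_sub, mul_smul_comm, ← mul_assoc, ← mul_assoc, ih2, smul_mul_assoc, smul_smul,
              hc, one_smul, ← comm.eq, mul_assoc, absl, sub_self]
          · rw [sub_mul, smul_mul_assoc, mul_assoc, mul_assoc, ← mul_assoc (e i), ih2,
              mul_smul_comm, smul_smul, hc, one_smul, ← mul_assoc, absr, sub_self]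
      · intro j hj hn
        obtain rfl : j = k + 1 := by omega
        have hcomm : Commute (e (k + 1)) (jw q e k) :=
          commute_jw k fun i hi => (h.far i (k + 1) (by omega) (by omega)).symm
        have hcomm' : Commute (e (k + 1)) (jw q e (k + 1)) :=
          commute_jw (k + 1) fun i hi => (h.far i (k + 1) (by omega) (by omega)).symm
        have e1 : e (k + 1) * (jw q e (k + 1) * e k * jw q e (k + 1)) * e (k + 1) =
            jw q e (k + 1) * e (k + 1) := by
          calc _ = jw q e (k + 1) * (e (k + 1) * e k * e (k + 1)) * jw q e (k + 1) := by
                simp only [← mul_assoc, hcomm'.eq]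
                simp only [mul_assoc, hcomm'.eq]
            _ = _ := by
                rw [h.down k (by omega), mul_assoc, hcomm'.eq, ← mul_assoc, idem]
        have e2 : e (k + 1) * jw q e (k + 1) * e (k + 1) =
            qInt q 2 • (jw q e (k + 1) * e (k + 1)) := by
          rw [hcomm'.eq, mul_assoc, h.sq _ hn, mul_smul_comm]
        rw [jw_succ_succ, mul_sub, sub_mul, mul_smul_comm, smul_mul_assoc, e1, e2, ← sub_smul]
        congr 1
        have := hpos (k + 1)
        have e3 := hq.qInt_add_two_add ((k + 1 : ℕ) : ℤ)
        push_cast at *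
        rw [show (k : ℤ) + 1 + 1 = k + 2 by ring] at *
        field_simp
        linear_combination -e3

theorem mul_jw {i k : ℕ} (hk : k ≤ n) (hi : i + 1 < k) : e i * jw q e k = 0 :=
  ((h.jw_aux hq k hk).1 i hi).1

theorem jw_mul {i k : ℕ} (hk : k ≤ n) (hi : i + 1 < k) : jw q e k * e i = 0 :=
  ((h.jw_aux hq k hk).1 i hi).2

theorem jw_mul_self {k : ℕ} (hk : k ≤ n) : jw q e k * jw q e k = jw q e k :=
  jw_mul_of_annihilated _ fun _ hi => h.mul_jw hq hk hi

/-- Both projectors are annihilated by every generator from both sides, so their product equals each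
of them. -/
theorem jw_reverse : jw q (fun k => e (n - 2 - k)) n = jw q e n := by
  rw [← mul_jw_of_annihilated (q := q) (e := e) (y := jw q (fun k => e (n - 2 - k)) n) n]
  · refine jw_mul_of_annihilated _ fun i hi => h.mul_jw hq le_rfl (by omega)
  · intro i hi
    have := h.reverse.jw_mul hq le_rfl (i := n - 2 - i) (by omega)
    rwa [show n - 2 - (n - 2 - i) = i by omega] at this

end IsTL

end TemperleyLieb

end QSphere

namespace QSphere

/-! ### Jucys–Murphy elements of the one-boundary Temperley–Lieb algebra. -/

section Blob

variable {K : Type*} [Field K] {A : Type*} [Ring A] [Algebra K A]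

/-- The Hecke generator `q - e` attached to a Temperley–Lieb generator `e`. -/
def hecke (q : K) (e : ℕ → A) (k : ℕ) : A := q • (1 : A) - e k

/-- The Jucys–Murphy elements over a solution `X` of the modified reflection equation. -/
def jm (q h : K) (e : ℕ → A) (X : A) : ℕ → A
  | 0 => X
  | k + 1 => hecke q e k * jm q h e X k * hecke q e k - h • hecke q e k

/-- The products `∏_{k < j} (J_k - a)` over Jucys–Murphy elements. -/
def jmProd (q h a : K) (e : ℕ → A) (X : A) : ℕ → A
  | 0 => 1
  | j + 1 => jmProd q h a e X j * (jm q h e X j - a • 1)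

/-- The relations of the one-boundary Temperley–Lieb (blob) algebra, for a boundary generator
with roots `a` and `b`. -/
structure IsBlob (q a b : K) (n : ℕ) (e : ℕ → A) (X : A) : Prop extends IsTL q n e where
  boundary_far : ∀ k, 0 < k → k + 1 < n → Commute X (e k)
  boundary : 1 < n → e 0 * X * e 0 = 0
  quadratic : X * X = (a + b) • X - (a * b) • (1 : A)

section Hecke

variable {q : K} {e : ℕ → A}

theorem hecke_sq (hq : Generic q) {k : ℕ} (h : e k * e k = qInt q 2 • e k) :
    hecke q e k * hecke q e k = 1 + (q - q⁻¹) • hecke q e k := by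
  have h0 := hq.ne_zero
  simp only [hecke, sub_mul, mul_sub, smul_mul_assoc, mul_smul_comm, one_mul, mul_one, h,
    hq.qInt_two, smul_sub, smul_smul]
  match_scalars <;> field_simp <;> ring

theorem hecke_braid (hq : Generic q) {i j : ℕ} (hi : e i * e i = qInt q 2 • e i)
    (hj : e j * e j = qInt q 2 • e j) (hij : e i * e j * e i = e i) (hji : e j * e i * e j = e j) :
    hecke q e i * hecke q e j * hecke q e i = hecke q e j * hecke q e i * hecke q e j := by
  have h0 := hq.ne_zero
  simp only [hecke, sub_mul, mul_sub, smul_mul_assoc, mul_smul_comm, one_mul, mul_one, hi, hj,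
    hij, hji, hq.qInt_two, smul_sub, smul_smul]
  match_scalars <;> field_simp <;> ring

theorem commute_hecke {y : A} {k : ℕ} (h : Commute y (e k)) : Commute y (hecke q e k) :=
  ((Commute.one_right y).smul_right q).sub_right h

theorem commute_hecke_hecke {i k : ℕ} (h : Commute (e i) (e k)) :
    Commute (hecke q e i) (hecke q e k) :=
  commute_hecke (commute_hecke h.symm).symm

theorem hecke_mul_of_annihilated {y : A} {k : ℕ} (h : e k * y = 0) :
    hecke q e k * y = q • y := by
  simp [hecke, sub_mul, h]

end Hecke

theorem jm_mem {q h : K} {e : ℕ → A} {X : A} {S : Subalgebra K A} (hX : X ∈ S) :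
    ∀ k, (∀ i, i < k → e i ∈ S) → jm q h e X k ∈ S
  | 0, _ => hX
  | k + 1, he => by
    have ih := jm_mem (q := q) (h := h) hX k fun i hi => he i (by omega)
    have hr : hecke q e k ∈ S := sub_mem (S.smul_mem (one_mem S) q) (he k (by omega))
    exact sub_mem (mul_mem (mul_mem hr ih) hr) (S.smul_mem hr h)

theorem jmProd_mem {q h a : K} {e : ℕ → A} {X : A} {S : Subalgebra K A} (hX : X ∈ S) :
    ∀ k, (∀ i, i + 1 < k → e i ∈ S) → jmProd q h a e X k ∈ S
  | 0, _ => one_mem S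
  | k + 1, he => mul_mem (jmProd_mem hX k fun i hi => he i (by omega))
      (sub_mem (jm_mem hX k fun i hi => he i (by omega)) (S.smul_mem (one_mem S) a))

theorem commute_jm {q h : K} {e : ℕ → A} {X y : A} (k : ℕ) (hX : Commute y X)
    (he : ∀ i, i < k → Commute y (e i)) : Commute y (jm q h e X k) := by
  have mem : ∀ z, Commute y z → z ∈ Subalgebra.centralizer K {y} := fun z hz => by
    rw [Subalgebra.mem_centralizer_iff]; rintro _ rfl; exact hz
  have := jm_mem (q := q) (h := h) (mem X hX) k fun i hi => mem _ (he i hi)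
  rw [Subalgebra.mem_centralizer_iff] at this
  exact this y rfl

namespace IsBlob

variable {q a b : K} (hq : Generic q) {n : ℕ} {e : ℕ → A} {X : A} (H : IsBlob q a b n e X)
include hq H

local notation "r" => hecke q e
local notation "J" => jm q (q * (a + b)) e X
local notation "F" => jmProd q (q * (a + b)) a e X

omit hq in
theorem commute_jm_of_lt {k i : ℕ} (hi : k < i) (hn : i + 1 < n) : Commute (J k) (e i) :=
  (commute_jm k (H.boundary_far i (by omega) hn).symm fun j hj =>
    (H.far j i (by omega) hn).symm).symm

omit hq H in
theorem jm_succ (k : ℕ) : J (k + 1) = r k * J k * r k - (q * (a + b)) • r k := rfl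

/-- The Hecke relation produces the same error terms here and in the mirror image `mul_jm_succ`, so
they cancel in the commutator of `r k` with `J k + J (k + 1)`. -/
theorem jm_succ_mul {k : ℕ} (hk : k + 1 < n) :
    J (k + 1) * r k = r k * J k + (q - q⁻¹) • J (k + 1) - (q * (a + b)) • 1 := by
  have h2 := hecke_sq hq (H.sq k hk)
  rw [jm_succ, sub_mul, smul_mul_assoc, mul_assoc, h2]
  simp only [mul_add, mul_smul_comm, mul_one, smul_sub, smul_add]
  module

theorem mul_jm_succ {k : ℕ} (hk : k + 1 < n) :
    r k * J (k + 1) = J k * r k + (q - q⁻¹) • J (k + 1) - (q * (a + b)) • 1 := by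
  have h2 := hecke_sq hq (H.sq k hk)
  rw [jm_succ, mul_sub, mul_smul_comm, ← mul_assoc, ← mul_assoc, h2]
  simp only [add_mul, smul_mul_assoc, one_mul, smul_sub, smul_add]
  module

theorem commute_hecke_add {k : ℕ} (hk : k + 1 < n) : Commute (r k) (J k + J (k + 1)) := by
  unfold Commute SemiconjBy
  rw [mul_add, add_mul, H.jm_succ_mul hq hk, H.mul_jm_succ hq hk]
  abel

theorem commute_jm_hecke {k i : ℕ} (hi : i + 1 < k) (hk : k < n) : Commute (J k) (r i) := by
  induction k with
  | zero => omega
  | succ k ih =>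
    rcases Nat.lt_or_ge (i + 1) k with hlt | hge
    · have h1 := ih hlt (by omega)
      have h2 : Commute (r k) (r i) := (commute_hecke_hecke (H.far i k hlt hk)).symm
      rw [jm_succ]
      exact ((h2.mul_left h1).mul_left h2).sub_left (h2.smul_left _)
    · obtain rfl : k = i + 1 := by omega
      have hb := hecke_braid hq (H.sq i (by omega)) (H.sq (i + 1) hk) (H.up i hk) (H.down i hk)
      have hJ : Commute (J i) (r (i + 1)) := commute_hecke (H.commute_jm_of_lt (by omega) hk)
      have s1 := hecke_sq hq (H.sq i (by omega))
      have s2 := hecke_sq hq (H.sq (i + 1) hk)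
      rw [jm_succ, jm_succ]
      generalize hs : r (i + 1) = s at *
      generalize ht : r i = t at *
      generalize hy : J i = y at *
      have e1 : t * (s * (t * y * t) * s) = s * (t * y * t) * s * t := by
        calc t * (s * (t * y * t) * s) = (t * s * t) * y * t * s := by noncomm_ring
          _ = s * t * (s * y) * t * s := by rw [hb]; noncomm_ring
          _ = s * t * y * (s * t * s) := by rw [← hJ.eq]; noncomm_ring
          _ = _ := by rw [← hb]; noncomm_ring
      -- The part of `J (i + 2)` proportional to `q (a + b)` is `-(s t s + s)`. It commutes with `t`
      -- by the braid and Hecke relations.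
      have e2 : t * (s * t * s) + t * s = s * t * s * t + s * t := by
        have l : t * (s * t * s) = s * t + (q - q⁻¹) • (s * t * s) := by
          rw [← hb, ← mul_assoc, ← mul_assoc, s1]
          simp only [add_mul, one_mul, smul_mul_assoc, hb]
        have l' : s * t * s * t = t * s + (q - q⁻¹) • (s * t * s) := by
          rw [← hb, mul_assoc, s1, mul_add, mul_one, mul_smul_comm, hb]
        rw [l, l']; abel
      unfold Commute SemiconjBy
      have e3 : t * (s * t * s) - s * t * s * t = s * t - t * s := by
        rw [sub_eq_sub_iff_add_eq_add, e2]; abel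
      rw [← sub_eq_zero]
      calc _ = (s * (t * y * t) * s * t - t * (s * (t * y * t) * s)) +
            (q * (a + b)) • ((t * (s * t * s) - s * t * s * t) - (s * t - t * s)) := by
            simp only [mul_sub, sub_mul, mul_smul_comm, smul_mul_assoc, ← mul_assoc]
            module
        _ = 0 := by rw [e1, e3]; simp

theorem commute_jm_jm {j k : ℕ} (hjk : j < k) (hk : k < n) : Commute (J j) (J k) := by
  induction k generalizing j with
  | zero => omega
  | succ k ih =>
    have step : ∀ y, Commute y (J k) → Commute y (r k) → Commute y (J (k + 1)) := fun y h1 h2 => by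
      rw [jm_succ]
      exact ((h2.mul_right h1).mul_right h2).sub_right (h2.smul_right _)
    rcases Nat.lt_or_ge j k with hlt | hge
    · exact step _ (ih hlt (by omega)) (commute_hecke (H.commute_jm_of_lt hlt hk))
    · obtain rfl : j = k := by omega
      rcases j with _ | j
      · have hb := H.boundary hk
        have hx := H.quadratic
        rw [jm_succ]
        simp only [jm, hecke]
        generalize e 0 = t at *
        have e1 : X * t * X * t = 0 := by rw [mul_assoc X, mul_assoc, hb, mul_zero]
        have e2 : t * X * t * X = 0 := by rw [hb, zero_mul]
        have e3 : t * X * X = (a + b) • (t * X) - (a * b) • t := by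
          rw [mul_assoc, hx]; simp [mul_sub]
        unfold Commute SemiconjBy
        simp only [mul_sub, sub_mul, mul_smul_comm, smul_mul_assoc, one_mul, mul_one, ← mul_assoc,
          hx, e1, e2, e3]
        module
      · have h1 : Commute (J (j + 2)) (r j) := H.commute_jm_hecke hq (by omega) hk
        have h2 : Commute (J (j + 2)) (J j) := by
          have hl : Commute (J j) (J (j + 1)) := ih (by omega) (by omega)
          have h2 : Commute (J j) (r (j + 1)) :=
            commute_hecke (H.commute_jm_of_lt (by omega) hk)
          rw [jm_succ]
          exact (((h2.mul_right hl).mul_right h2).sub_right (h2.smul_right _)).symm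
        have : Commute (J (j + 2)) (J (j + 1)) := by
          rw [jm_succ j]
          exact ((h1.mul_right h2).mul_right h1).sub_right (h1.smul_right _)
        exact this.symm

theorem commute_hecke_mul {k : ℕ} (hk : k + 1 < n) : Commute (r k) (J k * J (k + 1)) := by
  have hc := (H.commute_jm_jm hq (Nat.lt_succ_self k) hk).eq
  unfold Commute SemiconjBy
  conv_rhs => rw [hc]
  rw [jm_succ]
  simp only [mul_sub, sub_mul, mul_smul_comm, smul_mul_assoc, ← mul_assoc]

/-- The pair `(J i - a) (J (i + 1) - a)` is symmetric in the two Jucys–Murphy elements and hence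
commutes with `r i`; every other factor commutes with `r i` by itself. For `i + 1 = j` the pair
would be broken. -/
theorem commute_hecke_jmProd {i j : ℕ} (hij : i + 1 ≠ j) (hj : j ≤ n) (hi : i + 1 < n) :
    Commute (r i) (F j) := by
  have factor : ∀ k, Commute (r i) (J k) → Commute (r i) (J k - a • 1) := fun k h =>
    h.sub_right ((Commute.one_right _).smul_right a)
  induction j using Nat.strong_induction_on with
  | _ j ih =>
    rcases j with _ | j
    · exact Commute.one_right _
    · rcases eq_or_ne (i + 1) j with rfl | hne
      · have h1 := H.commute_hecke_add hq hi
        have h2 := H.commute_hecke_mul hq hi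
        have h3 : F (i + 2) = F i * (J i * J (i + 1) - a • (J i + J (i + 1)) + (a * a) • 1) := by
          simp only [jmProd, mul_assoc]
          congr 1
          simp only [mul_sub, sub_mul, mul_smul_comm, smul_mul_assoc, one_mul, mul_one]
          module
        rw [h3]
        exact (ih i (by omega) (by omega) (by omega)).mul_right
          ((h2.sub_right (h1.smul_right a)).add_right ((Commute.one_right _).smul_right _))
      · refine (ih j (by omega) hne (by omega)).mul_right (factor _ ?_)
        rcases Nat.lt_or_ge (i + 1) j with hlt | hge
        · exact (H.commute_jm_hecke hq hlt (by omega)).symm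
        · exact (commute_hecke (H.commute_jm_of_lt (by omega) hi)).symm

omit hq H in
theorem jmProd_succ (j : ℕ) : F (j + 1) = F j * (J j - a • 1) := rfl

/-- For `e 0` the claim is a computation with `F 2`. It passes from `e i` to `e (i + 1)` because
these are conjugate under `r i * r (i + 1)`, which is invertible and commutes with `F j`. -/
theorem mul_jmProd {i j : ℕ} (hij : i + 1 < j) (hj : j ≤ n) : e i * F j = 0 := by
  have h0 := hq.ne_zero
  induction i with
  | zero =>
    induction j, hij using Nat.le_induction with
    | base =>
      have hb := H.boundary (by omega)
      have hx := H.quadratic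
      have ht := H.sq 0 (by omega)
      simp only [jmProd, jm, hecke, one_mul]
      rw [hq.qInt_two] at ht
      generalize e 0 = t at *
      have e1 : t * X * X = (a + b) • (t * X) - (a * b) • t := by
        rw [mul_assoc, hx]; simp [mul_sub]
      simp only [mul_sub, sub_mul, mul_smul_comm, smul_mul_assoc, one_mul, mul_one, ← mul_assoc,
        hb, e1, ht, smul_sub, zero_mul, mul_zero, smul_zero, smul_smul]
      match_scalars <;> field_simp <;> ring
    | succ j hj' ih => rw [jmProd_succ, ← mul_assoc, ih (by omega), zero_mul]
  | succ i ih =>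
    have ih := ih (by omega)
    have h1 := (H.commute_hecke_jmProd hq (i := i) (j := j) (by omega) hj (by omega)).eq
    have h2 := (H.commute_hecke_jmProd hq (i := i + 1) (j := j) (by omega) hj (by omega)).eq
    have s1 := hecke_sq hq (H.sq i (by omega))
    have s2 := hecke_sq hq (H.sq (i + 1) (by omega))
    -- The Hecke relation gives `t - (q - q⁻¹)` as the inverse of `t`.
    have inv : ∀ t : A, t * t = 1 + (q - q⁻¹) • t → t * (t - (q - q⁻¹) • 1) = 1 := fun t ht => by
      rw [mul_sub, ht]; simp
    have hb : e (i + 1) * (r i * r (i + 1)) = r i * r (i + 1) * e i := by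
      have hs := H.sq (i + 1) (by omega)
      have ht := H.sq i (by omega)
      have hu := H.up i (by omega)
      have hd := H.down i (by omega)
      simp only [hecke, mul_sub, sub_mul, mul_smul_comm, smul_mul_assoc, one_mul, mul_one,
        ← mul_assoc, hs, ht, hu, hd, hq.qInt_two]
      match_scalars <;> field_simp <;> ring
    have key : e (i + 1) * F j * (r i * r (i + 1)) = 0 := by
      have : F j * (r i * r (i + 1)) = r i * r (i + 1) * F j := by
        rw [← mul_assoc, ← h1, mul_assoc, ← h2, mul_assoc]
      rw [mul_assoc, this, ← mul_assoc, hb, mul_assoc, ih, mul_zero]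
    calc e (i + 1) * F j = e (i + 1) * F j * (r i * (r (i + 1) *
          (r (i + 1) - (q - q⁻¹) • 1)) * (r i - (q - q⁻¹) • 1)) := by
          rw [inv _ s2, mul_one, inv _ s1, mul_one]
      _ = e (i + 1) * F j * (r i * r (i + 1)) * ((r (i + 1) - (q - q⁻¹) • 1) *
          (r i - (q - q⁻¹) • 1)) := by simp only [mul_assoc]
      _ = 0 := by rw [key, zero_mul]

/-- For `k = 0` this is `X (X - a) = b (X - a)`. Afterwards the Hecke generators act on `F j` by
`q`, so that the recursion of the `J k` becomes that of `jmValue`. -/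
theorem jm_mul_jmProd {k j : ℕ} (hkj : k < j) (hj : j ≤ n) :
    J k * F j = jmValue q (q * (a + b)) b k • F j := by
  induction k with
  | zero =>
    have : jmValue q (q * (a + b)) b 0 = b := by simp [jmValue]
    rw [this]
    induction j, hkj using Nat.le_induction with
    | base =>
      simp only [jmProd, jm, one_mul, mul_sub, H.quadratic, mul_smul_comm, mul_one]
      module
    | succ j hj' ih => rw [jmProd_succ, ← mul_assoc, ih (by omega), smul_mul_assoc]
  | succ k ih =>
    have h1 : r k * F j = q • F j := hecke_mul_of_annihilated (H.mul_jmProd hq hkj hj)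
    rw [jm_succ, sub_mul, mul_assoc, h1, smul_mul_assoc, h1, mul_smul_comm, mul_assoc,
      ih (by omega), mul_smul_comm, h1, hq.jmValue_succ]
    module

theorem commute_jmProd_jm {k j : ℕ} (hk : k < n) (hj : j ≤ n) : Commute (F j) (J k) := by
  induction j with
  | zero => exact Commute.one_left _
  | succ l ih =>
    refine (ih (by omega)).mul_left (Commute.sub_left ?_ ((Commute.one_left _).smul_left a))
    rcases lt_trichotomy l k with h | rfl | h
    · exact H.commute_jm_jm hq h (by omega)
    · exact Commute.refl _
    · exact (H.commute_jm_jm hq h (by omega)).symm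

theorem jmProd_mul_jm {k j : ℕ} (hkj : k < j) (hj : j ≤ n) :
    F j * J k = jmValue q (q * (a + b)) b k • F j := by
  rw [← H.jm_mul_jmProd hq hkj hj, (H.commute_jmProd_jm hq (by omega) hj).eq]

theorem jmProd_mul {i j : ℕ} (hij : i + 1 < j) (hj : j ≤ n) : F j * e i = 0 := by
  have h := (H.commute_hecke_jmProd hq (i := i) (j := j) (by omega) hj (by omega)).eq
  rw [hecke_mul_of_annihilated (H.mul_jmProd hq hij hj), hecke, mul_sub,
    mul_smul_comm, mul_one, eq_comm, sub_eq_self] at h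
  exact h

/-- The sum of the Jucys–Murphy elements, normalized so that it extends the boundary generator. -/
noncomputable def casimir (q a b : K) (n : ℕ) (e : ℕ → A) (X : A) : A :=
  q ^ (2 - 2 * (n : ℤ)) • (∑ k ∈ Finset.range n, jm q (q * (a + b)) e X k +
    (q * (a + b) * qTri q n) • (1 : A))

/-- All summands other than `J i` and `J (i + 1)` commute with `r i` individually, and these two do
so jointly. -/
theorem commute_hecke_casimir {i : ℕ} (hi : i + 1 < n) : Commute (r i) (casimir q a b n e X) := by
  refine Commute.smul_right (Commute.add_right ?_ ((Commute.one_right _).smul_right _)) _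
  obtain ⟨l, rfl⟩ : ∃ l, n = i + 2 + l := ⟨n - (i + 2), by omega⟩
  rw [Finset.sum_range_add, Finset.sum_range_succ, Finset.sum_range_succ, add_assoc (∑ _ ∈ _, _)]
  refine ((Commute.sum_right _ _ _ fun k hk => ?_).add_right (H.commute_hecke_add hq hi)).add_right
    (Commute.sum_right _ _ _ fun k hk => ?_)
  · exact (commute_hecke (H.commute_jm_of_lt (Finset.mem_range.1 hk) hi)).symm
  · exact (H.commute_jm_hecke hq (by omega) (by have := Finset.mem_range.1 hk; omega)).symm

theorem commute_casimir_jw (k : ℕ) (hk : k ≤ n) : Commute (casimir q a b n e X) (jw q e k) := by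
  refine commute_jw k fun i hi => ?_
  have h1 := H.commute_hecke_casimir hq (i := i) (by omega)
  have : e i = q • (1 : A) - r i := by simp [hecke]
  rw [this]
  exact ((Commute.one_right _).smul_right q).sub_right h1.symm

end IsBlob

end Blob

end QSphere

namespace QSphere

set_option linter.unusedSimpArgs false

/-! ### Matrix units, weighted partial traces and the Temperley–Lieb relations. -/

section MatrixUnits

variable {K : Type*} [Field K] {A : Type*} [Ring A] [Algebra K A]

/-- Commuting families of `2 × 2` matrix units, one for each of `n` tensor factors. -/
structure IsMatrixUnits (n : ℕ) (mu : ℕ → Fin 2 → Fin 2 → A) : Prop where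
  mul : ∀ p, p < n → ∀ i j k l, mu p i j * mu p k l = if j = k then mu p i l else 0
  one : ∀ p, p < n → mu p 0 0 + mu p 1 1 = 1
  comm : ∀ p p', p < n → p' < n → p ≠ p' → ∀ i j k l, mu p i j * mu p' k l = mu p' k l * mu p i j

/-- The Temperley–Lieb generator `q - R` in the tensor factors `k` and `k + 1`. -/
def tl (q : K) (mu : ℕ → Fin 2 → Fin 2 → A) (k : ℕ) : A :=
  q⁻¹ • (mu k 0 0 * mu (k + 1) 1 1) - mu k 0 1 * mu (k + 1) 1 0 - mu k 1 0 * mu (k + 1) 0 1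
    + q • (mu k 1 1 * mu (k + 1) 0 0)

/-- The diagonal of the matrix `C`. -/
def cWeight (q : K) : Fin 2 → K := ![q⁻¹, q]

/-- The diagonal of the matrix `B`. -/
def bWeight (q : K) : Fin 2 → K := ![q, q⁻¹]

/-- The partial trace over the tensor factor `p`, weighted by a diagonal matrix. -/
def ptr (D : Fin 2 → K) (mu : ℕ → Fin 2 → Fin 2 → A) (p : ℕ) : A →ₗ[K] A :=
  ∑ t, ∑ j, D t • (LinearMap.mulLeft K (mu p j t) ∘ₗ LinearMap.mulRight K (mu p t j))

theorem ptr_apply (D : Fin 2 → K) (mu : ℕ → Fin 2 → Fin 2 → A) (p : ℕ) (y : A) :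
    ptr D mu p y = ∑ t, ∑ j, D t • (mu p j t * (y * mu p t j)) := by
  simp [ptr]

/-- The elements that act trivially in the tensor factor `p`. -/
def offSite (K : Type*) [Field K] {A : Type*} [Ring A] [Algebra K A]
    (mu : ℕ → Fin 2 → Fin 2 → A) (p : ℕ) : Subalgebra K A :=
  Subalgebra.centralizer K (Set.range fun ij : Fin 2 × Fin 2 => mu p ij.1 ij.2)

theorem mem_offSite {mu : ℕ → Fin 2 → Fin 2 → A} {p : ℕ} {y : A} :
    y ∈ offSite K mu p ↔ ∀ i j, mu p i j * y = y * mu p i j := by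
  simp only [offSite, Subalgebra.mem_centralizer_iff, Set.forall_mem_range, Prod.forall]

namespace IsMatrixUnits

variable {q : K} {n : ℕ} {mu : ℕ → Fin 2 → Fin 2 → A} (M : IsMatrixUnits n mu)
include M

theorem mem_offSite {p p' : ℕ} (hp : p < n) (hp' : p' < n) (h : p ≠ p') (i j : Fin 2) :
    mu p i j ∈ offSite K mu p' :=
  QSphere.mem_offSite.2 fun k l => M.comm p' p hp' hp h.symm k l i j

theorem tl_mem_offSite {k p : ℕ} (hk : k + 1 < n) (hp : p < n) (h1 : p ≠ k) (h2 : p ≠ k + 1) :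
    tl q mu k ∈ offSite K mu p := by
  have m1 : ∀ i j, mu k i j ∈ offSite K mu p := M.mem_offSite (by omega) hp h1.symm
  have m2 : ∀ i j, mu (k + 1) i j ∈ offSite K mu p := M.mem_offSite (by omega) hp h2.symm
  exact add_mem (sub_mem (sub_mem (Subalgebra.smul_mem _ (mul_mem (m1 _ _) (m2 _ _)) _)
    (mul_mem (m1 _ _) (m2 _ _))) (mul_mem (m1 _ _) (m2 _ _)))
    (Subalgebra.smul_mem _ (mul_mem (m1 _ _) (m2 _ _)) _)

omit M in
theorem commute_tl {k : ℕ} {y : A} (h1 : y ∈ offSite K mu k)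
    (h2 : y ∈ offSite K mu (k + 1)) : Commute y (tl q mu k) := by
  have c : ∀ i j i' j', Commute y (mu k i j * mu (k + 1) i' j') := fun i j i' j' =>
    Commute.mul_right (QSphere.mem_offSite.1 h1 i j).symm (QSphere.mem_offSite.1 h2 i' j').symm
  exact ((((c _ _ _ _).smul_right _).sub_right (c _ _ _ _)).sub_right (c _ _ _ _)).add_right
    ((c _ _ _ _).smul_right _)

omit M in
theorem ptr_mul_mul (D : Fin 2 → K) {p : ℕ} {x y z : A} (hx : x ∈ offSite K mu p)
    (hz : z ∈ offSite K mu p) : ptr D mu p (x * y * z) = x * ptr D mu p y * z := by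
  rw [QSphere.mem_offSite] at hx hz
  simp only [ptr_apply, Finset.mul_sum, Finset.sum_mul, mul_smul_comm, smul_mul_assoc]
  refine Finset.sum_congr rfl fun t _ => Finset.sum_congr rfl fun j _ => ?_
  congr 1
  simp only [mul_assoc, ← hz]
  simp only [← mul_assoc, hx]

theorem ptr_of_mem (D : Fin 2 → K) {p : ℕ} (hp : p < n) {y : A} (hy : y ∈ offSite K mu p) :
    ptr D mu p y = (D 0 + D 1) • y := by
  rw [QSphere.mem_offSite] at hy
  have h1 : ∀ i j, mu p i j * (y * mu p j i) = mu p i i * y := fun i j => by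
    rw [← hy, ← mul_assoc, M.mul p hp, if_pos rfl]
  simp only [ptr_apply, h1, Fin.sum_univ_two, ← smul_add, ← add_mul, M.one p hp, one_mul, add_smul]

theorem ptr_mem_offSite (D : Fin 2 → K) {p p' : ℕ} (hp : p < n) (hp' : p' < n) (h : p ≠ p')
    {y : A} (hy : y ∈ offSite K mu p') : ptr D mu p y ∈ offSite K mu p' := by
  rw [ptr_apply]
  exact sum_mem fun t _ => sum_mem fun j _ => Subalgebra.smul_mem _
    (mul_mem (M.mem_offSite hp hp' h _ _) (mul_mem hy (M.mem_offSite hp hp' h _ _))) _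

/-- The generator has rank one on the factors `k` and `k + 1`, so sandwiching an operator that
avoids factor `k + 1` leaves a functional on factor `k`: the trace weighted by `C`. In the mirror
image below the weight is `B`. -/
theorem tl_mul_mul_left (h0 : q ≠ 0) {k : ℕ} (hk : k + 1 < n) {y : A}
    (hy : y ∈ offSite K mu (k + 1)) :
    tl q mu k * y * tl q mu k = ptr (cWeight q) mu k y * tl q mu k := by
  rw [QSphere.mem_offSite] at hy
  have m1 := M.mul k (by omega)
  have m2 := M.mul (k + 1) hk
  have c := M.comm (k + 1) k hk (by omega) (by omega)
  have assoc : ∀ {u v w : A}, u * v = w → ∀ z, u * (v * z) = w * z := fun h z => by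
    rw [← h, mul_assoc]
  have m1' := fun i j k l => assoc (m1 i j k l)
  have m2' := fun i j k l => assoc (m2 i j k l)
  have c' := fun i j k l => assoc (c i j k l)
  have hy' := fun i j => assoc (hy i j)
  rw [ptr_apply]
  unfold tl cWeight
  generalize mu k = μ at *
  generalize mu (k + 1) = ν at *
  simp only [Fin.sum_univ_two, add_mul, mul_add, sub_mul, mul_sub, smul_mul_assoc, mul_smul_comm,
    mul_assoc, c, c', hy, hy', m1, m2, m1', m2', smul_smul, Matrix.cons_val_zero,
    Matrix.cons_val_one]
  simp [mul_assoc, smul_smul, h0]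
  match_scalars <;> simp [h0]

theorem tl_mul_mul_right (h0 : q ≠ 0) {k : ℕ} (hk : k + 1 < n) {y : A}
    (hy : y ∈ offSite K mu k) :
    tl q mu k * y * tl q mu k = ptr (bWeight q) mu (k + 1) y * tl q mu k := by
  rw [QSphere.mem_offSite] at hy
  have m1 := M.mul k (by omega)
  have m2 := M.mul (k + 1) hk
  have c := M.comm k (k + 1) (by omega) hk (by omega)
  have assoc : ∀ {u v w : A}, u * v = w → ∀ z, u * (v * z) = w * z := fun h z => by
    rw [← h, mul_assoc]
  have m1' := fun i j k l => assoc (m1 i j k l)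
  have m2' := fun i j k l => assoc (m2 i j k l)
  have c' := fun i j k l => assoc (c i j k l)
  have hy' := fun i j => assoc (hy i j)
  rw [ptr_apply]
  unfold tl bWeight
  generalize mu k = μ at *
  generalize mu (k + 1) = ν at *
  simp only [Fin.sum_univ_two, add_mul, mul_add, sub_mul, mul_sub, smul_mul_assoc, mul_smul_comm,
    mul_assoc, c, c', hy, hy', m1, m2, m1', m2', smul_smul, Matrix.cons_val_zero,
    Matrix.cons_val_one]
  simp [mul_assoc, smul_smul, h0]
  match_scalars <;> simp [h0]

theorem ptr_unit (D : Fin 2 → K) {p : ℕ} (hp : p < n) (i j : Fin 2) :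
    ptr D mu p (mu p i j) = if i = j then D i • (1 : A) else 0 := by
  have m := M.mul p hp
  rw [ptr_apply, ← M.one p hp]
  fin_cases i <;> fin_cases j <;> simp [m, Fin.sum_univ_two]

theorem ptr_tl_right (h0 : q ≠ 0) {k : ℕ} (hk : k + 1 < n) :
    ptr (cWeight q) mu (k + 1) (tl q mu k) = 1 := by
  have h : ∀ i j i' j', ptr (cWeight q) mu (k + 1) (mu k i j * mu (k + 1) i' j') =
      mu k i j * ptr (cWeight q) mu (k + 1) (mu (k + 1) i' j') := fun i j i' j' => by
    have := ptr_mul_mul (cWeight q) (y := mu (k + 1) i' j')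
      (M.mem_offSite (show k < n by omega) hk (by omega) i j) (one_mem _)
    simpa using this
  rw [tl, map_add, map_sub, map_sub, map_smul, map_smul]
  simp only [h, M.ptr_unit _ hk]
  simp [cWeight, smul_smul, h0, M.one k (by omega)]

theorem ptr_tl_left (h0 : q ≠ 0) {k : ℕ} (hk : k + 1 < n) :
    ptr (bWeight q) mu k (tl q mu k) = 1 := by
  have h : ∀ i j i' j', ptr (bWeight q) mu k (mu k i j * mu (k + 1) i' j') =
      ptr (bWeight q) mu k (mu k i j) * mu (k + 1) i' j' := fun i j i' j' => by
    have := ptr_mul_mul (bWeight q) (y := mu k i j) (one_mem _)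
      (M.mem_offSite hk (show k < n by omega) (by omega) i' j')
    simpa using this
  rw [tl, map_add, map_sub, map_sub, map_smul, map_smul]
  simp only [h, M.ptr_unit _ (show k < n by omega)]
  simpa [bWeight, smul_smul, h0, add_comm] using M.one (k + 1) hk

/-- The first three relations are sandwich formulas. The loop value is the weighted trace of the
identity, and the partial trace of a neighbouring generator is `1`. -/
theorem isTL (hq : Generic q) : IsTL q n (tl q mu) where
  sq k hk := by
    have := M.tl_mul_mul_left hq.ne_zero hk (one_mem _)
    rw [mul_one, M.ptr_of_mem _ (by omega) (one_mem _)] at this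
    rw [this, smul_mul_assoc, one_mul, hq.qInt_two]
    simp [cWeight, add_comm]
  up k hk := by
    rw [M.tl_mul_mul_right hq.ne_zero (by omega)
      (M.tl_mem_offSite (by omega) (by omega) (by omega) (by omega)),
      M.ptr_tl_left hq.ne_zero (by omega), one_mul]
  down k hk := by
    rw [M.tl_mul_mul_left hq.ne_zero (by omega)
      (M.tl_mem_offSite (by omega) (by omega) (by omega) (by omega)),
      M.ptr_tl_right hq.ne_zero (by omega), one_mul]
  far i j hij hj := commute_tl
    (M.tl_mem_offSite (by omega) (by omega) (by omega) (by omega))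
    (M.tl_mem_offSite (by omega) (by omega) (by omega) (by omega))

theorem isBlob (hq : Generic q) {a b : K} {X : A} (hX : ∀ p, 0 < p → p < n → X ∈ offSite K mu p)
    (htr : 0 < n → ptr (cWeight q) mu 0 X = 0)
    (hquad : X * X = (a + b) • X - (a * b) • (1 : A)) : IsBlob q a b n (tl q mu) X where
  toIsTL := M.isTL hq
  boundary_far k hk hn := commute_tl (hX k hk (by omega)) (hX (k + 1) (by omega) hn)
  boundary hn := by
    rw [M.tl_mul_mul_left hq.ne_zero hn (hX 1 one_pos hn), htr (by omega), zero_mul]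
  quadratic := hquad

end IsMatrixUnits

end MatrixUnits

end QSphere

namespace QSphere

/-! ### Traces of products of Jucys–Murphy elements. -/

section Trace

variable {K : Type*} [Field K] [CharZero K] {A : Type*} [Ring A] [Algebra K A]
  {q h s : K} {n : ℕ} {mu : ℕ → Fin 2 → Fin 2 → A} {X : A}

/-- The smaller root `μ₀` of `t² - q⁻¹ ħ t + α`. -/
def rootZero (q h s : K) : K := (q⁻¹ * h - q⁻¹ * s) / 2

/-- The larger root `μ₁` of `t² - q⁻¹ ħ t + α`. -/
def rootOne (q h s : K) : K := (q⁻¹ * h + q⁻¹ * s) / 2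

theorem Generic.mul_rootZero_add_rootOne (hq : Generic q) :
    q * (rootZero q h s + rootOne q h s) = h := by
  have := hq.ne_zero
  unfold rootZero rootOne
  field_simp
  ring

omit [CharZero K] in
theorem cWeight_sum (hq : Generic q) : cWeight q 0 + cWeight q 1 = qInt q 2 := by
  rw [hq.qInt_two]; simp [cWeight, add_comm]

/-- The factors of the partial traces of the products of Jucys–Murphy elements. -/
noncomputable def traceFactor (q h s : K) (k : ℕ) : K :=
  q ^ ((k : ℤ) - 1) * qDiff q h s (-(k + 1))

namespace IsMatrixUnits

variable (M : IsMatrixUnits n mu) (hq : Generic q)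
  (hX : ∀ p, 0 < p → p < n → X ∈ offSite K mu p)
  (htr : 0 < n → ptr (cWeight q) mu 0 X = 0)
include M hq hX htr

omit [CharZero K] htr hq in
theorem jm_mem_offSite {k p : ℕ} (hkp : k < p) (hp : p < n) :
    jm q h (tl q mu) X k ∈ offSite K mu p :=
  jm_mem (hX p (by omega) hp) k fun i hi =>
    M.tl_mem_offSite (by omega) hp (by omega) (by omega)

/-- Expanding `(q - e) y (q - e) - h (q - e)` with `y = J_k` and tracing out the last factor gives
`(q³ - q) y + ptr_k y - h q²`. The middle term is the induction hypothesis, since the sandwich `e y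
e` equals `(ptr_k y) e`. -/
theorem ptr_jm {k : ℕ} (hk : k < n) :
    ptr (cWeight q) mu k (jm q h (tl q mu) X k) =
      (q ^ 3 - q) • ∑ i ∈ Finset.range k, jm q h (tl q mu) X i - (k * (h * q ^ 2)) • (1 : A) := by
  have h0 := hq.ne_zero
  induction k with
  | zero => simpa [jm] using htr hk
  | succ k ih =>
    have ih := ih (by omega)
    have hy := M.jm_mem_offSite hX (q := q) (h := h) (Nat.lt_succ_self k) hk
    rw [Finset.sum_range_succ]
    simp only [jm, hecke]
    generalize jm q h (tl q mu) X k = y at *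
    have e1 : ptr (cWeight q) mu (k + 1) (tl q mu k * y) = y := by
      have h1 := ptr_mul_mul (cWeight q) (y := tl q mu k) (one_mem _) hy
      simpa [M.ptr_tl_right h0 hk] using h1
    have e2 : ptr (cWeight q) mu (k + 1) (y * tl q mu k) = y := by
      have h1 := ptr_mul_mul (cWeight q) (y := tl q mu k) hy (one_mem _)
      simpa [M.ptr_tl_right h0 hk] using h1
    have e3 : ptr (cWeight q) mu (k + 1) (tl q mu k * y * tl q mu k) =
        ptr (cWeight q) mu k y := by
      have h1 := ptr_mul_mul (cWeight q) (y := tl q mu k)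
        (M.ptr_mem_offSite (cWeight q) (show k < n by omega) hk (by omega) hy) (one_mem _)
      rw [M.tl_mul_mul_left h0 hk hy]
      simpa [M.ptr_tl_right h0 hk] using h1
    have e4 := M.ptr_of_mem (cWeight q) hk hy
    have e5 := M.ptr_of_mem (cWeight q) hk (one_mem _)
    have e6 := M.ptr_tl_right h0 hk
    rw [cWeight_sum hq, hq.qInt_two] at e4 e5
    simp only [sub_mul, mul_sub, smul_mul_assoc, mul_smul_comm, one_mul, mul_one, map_sub,
      map_smul, e1, e2, e3, e4, e5, e6, ih]
    push_cast
    match_scalars <;> field_simp <;> ring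

variable {N : Type*} [AddCommGroup N] [Module K N] (T : A →ₗ[K] N)
  (hT : ∀ p, p < n → ∀ y, T (ptr (cWeight q) mu p y) = qInt q 2 • T y)
  (hquad : X * X =
    (rootZero q h s + rootOne q h s) • X - (rootZero q h s * rootOne q h s) • (1 : A))
include hT hquad

local notation "F" => jmProd q h (rootZero q h s) (tl q mu) X

/-- `F j` avoids factor `j` and leaves the partial trace, which then only involves lower
Jucys–Murphy elements; next to `F j` these are scalars. The division by `[2]_q` undoes the
normalization of `T ∘ ptr`. -/
theorem trace_jmProd_succ {j : ℕ} (hj : j < n) :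
    T (F (j + 1)) = (traceFactor q h s j / qInt q 2) • T (F j) := by
  have H := M.isBlob hq hX htr hquad
  have hh := hq.mul_rootZero_add_rootOne (h := h) (s := s)
  have hF : F j ∈ offSite K mu j := by
    rcases j with _ | j
    · exact one_mem _
    · exact jmProd_mem (hX _ (by omega) hj) _ fun i hi =>
        M.tl_mem_offSite (by omega) hj (by omega) (by omega)
  have h1 := hT j hj (F (j + 1))
  have e1 := ptr_mul_mul (cWeight q) (y := jm q h (tl q mu) X j - rootZero q h s • 1) hF (one_mem _)
  simp only [mul_one, map_sub, map_smul] at e1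
  have e2 : ptr (cWeight q) mu j (1 : A) = qInt q 2 • 1 := by
    rw [M.ptr_of_mem _ hj (one_mem _), cWeight_sum hq]
  have e3 : F j * ∑ i ∈ Finset.range j, jm q h (tl q mu) X i =
      (∑ i ∈ Finset.range j, jmValue q h (rootOne q h s) i) • F j := by
    rw [Finset.mul_sum, Finset.sum_smul]
    refine Finset.sum_congr rfl fun i hi => ?_
    have := H.jmProd_mul_jm hq (Finset.mem_range.1 hi) hj.le
    rwa [hh] at this
  rw [M.ptr_jm hq hX htr hj, e2] at e1
  simp only [mul_sub, mul_smul_comm, mul_one, e3] at e1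
  have e4 : ptr (cWeight q) mu j (F (j + 1)) = traceFactor q h s j • F j := by
    rw [jmProd, mul_sub, mul_smul_comm, mul_one, e1, traceFactor, ← hq.partialTrace_value h s j]
    simp only [rootZero, rootOne]
    module
  rw [e4, map_smul] at h1
  rw [div_eq_inv_mul, mul_smul, h1, smul_smul, inv_mul_cancel₀ hq.qInt_two_ne_zero, one_smul]

/-- The projector is grown from `j` to `n` strands. On `j` strands `F j` absorbs it, and each
further strand contributes a ratio of quantum integers; these ratios telescope. -/
theorem trace_jmProd_mul_jw {w : N} (hw : T 1 = qInt q 2 ^ n • w) {j : ℕ} (hj : j ≤ n) :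
    T (F j * jw q (tl q mu) n) = (qInt q (n + 1 : ℕ) / qInt q (j + 1 : ℕ) *
      ∏ k ∈ Finset.range j, traceFactor q h s k) • w := by
  have H := M.isBlob hq hX htr hquad
  have hh := hq.mul_rootZero_add_rootOne (h := h) (s := s)
  have h0 := hq.ne_zero
  have h2 := hq.qInt_two_ne_zero
  have hpos : ∀ l : ℕ, qInt q ((l + 1 : ℕ) : ℤ) ≠ 0 := fun l => hq.qInt_ne_zero (by omega)
  have c1 : ∀ l, l ≤ n → T (F l) =
      (qInt q 2 ^ n * (qInt q 2 ^ l)⁻¹ * ∏ k ∈ Finset.range l, traceFactor q h s k) • w := by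
    intro l hl
    induction l with
    | zero => simp [jmProd, hw]
    | succ l ih =>
      rw [M.trace_jmProd_succ hq hX htr T hT hquad hl, ih (by omega), smul_smul,
        Finset.prod_range_succ]
      congr 1
      field_simp
      ring
  have c2 : ∀ l, j ≤ l → l ≤ n → T (F j * jw q (tl q mu) l) =
      (qInt q (l + 1 : ℕ) / qInt q (j + 1 : ℕ) * (qInt q 2 ^ n * (qInt q 2 ^ l)⁻¹) *
        ∏ k ∈ Finset.range j, traceFactor q h s k) • w := by
    intro l hjl hl
    induction l, hjl using Nat.le_induction with
    | base =>
      rw [mul_jw_of_annihilated (q := q) j fun i hi => ?_, c1 j hj, div_self (hpos j), one_mul]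
      have := H.jmProd_mul hq hi hj
      rwa [hh] at this
    | succ l hjl ih =>
      have ih := ih (by omega)
      have hl' : l < n := by omega
      have hF : F j ∈ offSite K mu l := by
        rcases j with _ | j
        · exact one_mem _
        · exact jmProd_mem (hX _ (by omega) hl') _ fun i hi =>
            M.tl_mem_offSite (by omega) hl' (by omega) (by omega)
      -- Tracing out the last strand of a Jones–Wenzl projector returns the previous one.
      have e1 : ptr (cWeight q) mu l (jw q (tl q mu) (l + 1)) =
          (qInt q (l + 2 : ℕ) / qInt q (l + 1 : ℕ)) • jw q (tl q mu) l := by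
        have mem : ∀ l', l' ≤ l → jw q (tl q mu) l' ∈ offSite K mu l := fun l' hll =>
          jw_mem _ fun i hi => M.tl_mem_offSite (by omega) hl' (by omega) (by omega)
        rcases l with _ | l
        · rw [jw, jw, M.ptr_of_mem _ hl' (one_mem _), cWeight_sum hq]
          simp [hq.qInt_one]
        · rw [jw_succ_succ, map_sub, map_smul, ptr_mul_mul _ (mem _ le_rfl) (mem _ le_rfl),
            M.ptr_tl_right h0 hl', mul_one, M.ptr_of_mem _ hl' (mem _ le_rfl), cWeight_sum hq,
            (M.isTL hq).jw_mul_self hq (by omega), ← sub_smul]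
          congr 1
          have := hpos (l + 1)
          have e3 := hq.qInt_add_two_add ((l + 1 : ℕ) : ℤ)
          push_cast at *
          rw [show (l : ℤ) + 1 + 1 = l + 2 by ring] at *
          field_simp
          linear_combination -e3
      have e2 := ptr_mul_mul (cWeight q) (y := jw q (tl q mu) (l + 1)) hF (one_mem _)
      rw [mul_one, mul_one, e1, mul_smul_comm] at e2
      have e3 := hT l hl' (F j * jw q (tl q mu) (l + 1))
      rw [e2, map_smul, ih] at e3
      rw [← inv_smul_smul₀ h2 (T _), ← e3, smul_smul, smul_smul]
      congr 1
      have := hpos l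
      have := hpos j
      field_simp
      ring
  rw [c2 n hj le_rfl, mul_inv_cancel₀ (pow_ne_zero n h2), mul_one]

end IsMatrixUnits

end Trace

/-! ### Triangular action of the Casimir after compression. -/

section Compression

variable {K : Type*} [Field K] [CharZero K] {A B : Type*} [Ring A] [Algebra K A] [Ring B]
  [Algebra K B] {q h s : K} {n : ℕ} {e : ℕ → A} {X : A}

theorem eigenvalue_eq (hq : Generic q) {j r : ℕ} (hn : n = j + r) :
    q ^ (2 - 2 * (n : ℤ)) * (q ^ ((r : ℤ) - 1) * qInt q r * rootZero q h s +
      ∑ k ∈ Finset.range j, jmValue q h (rootOne q h s) k - h * qTri q r + h * qTri q n) =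
      eigenvalue q h s n ⟨j, by omega⟩ := by
  have h0 := hq.ne_zero
  subst hn
  rw [hq.sum_jmValue, hq.qTri_add]
  simp only [eigenvalue, rootZero, rootOne]
  push_cast
  rw [show (j : ℤ) + r - j = r by ring, show (j : ℤ) - (j + r) = -r by ring]
  generalize qInt q j = Nj
  generalize qInt q r = Nr
  simp only [mul_add, mul_sub, zpow_sub₀ h0, zpow_add₀ h0, zpow_neg, two_mul, zpow_one]
  have := zpow_ne_zero (j : ℤ) h0
  have := zpow_ne_zero (r : ℤ) h0
  field_simp
  ring

/-- The coefficients in the recursion for the products of Jucys–Murphy elements. -/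
noncomputable def stepCoeff (q : K) (n j : ℕ) : K := q ^ (1 - (n : ℤ) - j) * qInt q (n - j : ℤ)

namespace IsBlob

variable (hq : Generic q) (H : IsBlob q (rootZero q h s) (rootOne q h s) n e X) (φ : A →ₗ[K] B)
  (hl : ∀ i, i + 1 < n → ∀ y, φ (e i * y) = 0) (hr : ∀ i, i + 1 < n → ∀ y, φ (y * e i) = 0)
include hq H hl hr

local notation "J" => jm q h e X
local notation "F" => jmProd q h (rootZero q h s) e X

/-- The elements `J k` with `k < j` act on `F j` by scalars. For the others, `φ` sees a Hecke
generator as `q` on either side, and the generators of index at least `j` commute with `F j`;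
everything thus reduces to `φ (J j * F j)`, which contains `F (j + 1)`. -/
theorem map_casimir_mul (j : ℕ) (hj : j ≤ n) :
    φ (casimir q (rootZero q h s) (rootOne q h s) n e X * F j) =
      eigenvalue q h s n ⟨j, by omega⟩ • φ (F j) + stepCoeff q n j • φ (F (j + 1)) := by
  have hh := hq.mul_rootZero_add_rootOne (h := h) (s := s)
  have h0 := hq.ne_zero
  obtain ⟨r, hn⟩ : ∃ r, n = j + r := ⟨n - j, by omega⟩
  have upper : ∀ i, j + i < n → φ (J (j + i) * F j) =
      q ^ (2 * i) • (φ (F (j + 1)) + rootZero q h s • φ (F j)) -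
        (h * (q ^ i * qInt q i)) • φ (F j) := by
    intro i hi
    induction i with
    | zero =>
      have hc := (H.commute_jmProd_jm hq (k := j) (by omega) hj).eq
      rw [hh] at hc
      simp only [jmProd, mul_sub, mul_smul_comm, mul_one, hc, map_sub, map_smul, add_zero]
      simp
    | succ i ih =>
      have ih := ih (by omega)
      have hc := (H.commute_hecke_jmProd hq (i := j + i) (j := j) (by omega) hj (by omega)).eq
      rw [hh] at hc
      have hl' : ∀ y, φ (hecke q e (j + i) * y) = q • φ y := fun y => by
        simp [hecke, sub_mul, hl (j + i) (by omega)]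
      have hr' : ∀ y, φ (y * hecke q e (j + i)) = q • φ y := fun y => by
        simp [hecke, mul_sub, hr (j + i) (by omega)]
      have e1 : J (j + (i + 1)) = hecke q e (j + i) * J (j + i) * hecke q e (j + i) -
          h • hecke q e (j + i) := rfl
      rw [e1, sub_mul, map_sub, mul_assoc, hc, smul_mul_assoc, map_smul, hl', ← mul_assoc, hr',
        mul_assoc, hl', ih]
      push_cast
      rw [hq.qInt_succ, zpow_natCast]
      have := pow_ne_zero i h0
      match_scalars <;> field_simp <;> ring
  have lower : ∀ k ∈ Finset.range j, φ (J k * F j) =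
      jmValue q h (rootOne q h s) k • φ (F j) := by
    intro k hk
    have := H.jm_mul_jmProd hq (Finset.mem_range.1 hk) hj
    rw [hh] at this
    rw [this, map_smul]
  have hsum : φ ((∑ k ∈ Finset.range n, J k) * F j) =
      (∑ k ∈ Finset.range j, jmValue q h (rootOne q h s) k) • φ (F j) +
      ((q ^ ((r : ℤ) - 1) * qInt q r) • (φ (F (j + 1)) + rootZero q h s • φ (F j)) -
        (h * qTri q r) • φ (F j)) := by
    rw [hn, Finset.sum_range_add, add_mul, map_add, Finset.sum_mul, Finset.sum_mul, map_sum,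
      map_sum, Finset.sum_congr rfl lower, ← Finset.sum_smul,
      Finset.sum_congr rfl fun i hi => upper i (by have := Finset.mem_range.1 hi; omega),
      Finset.sum_sub_distrib, ← Finset.sum_smul, ← Finset.sum_smul, hq.sum_pow_two_mul,
      ← Finset.mul_sum, qTri]
  have hc : stepCoeff q n j = q ^ (2 - 2 * (n : ℤ)) * (q ^ ((r : ℤ) - 1) * qInt q r) := by
    subst hn
    rw [stepCoeff, ← mul_assoc, ← zpow_add₀ h0]
    push_cast
    congr 2 <;> ring
  rw [casimir, hh, smul_mul_assoc, map_smul, add_mul, map_add, hsum, smul_mul_assoc, one_mul,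
    map_smul, ← eigenvalue_eq hq hn, hc]
  module

variable {p : A} (hmul : ∀ x y, φ (x * p * y) = φ x * φ y) (hone : φ 1 = 1)
  (hpl : ∀ y, φ (p * y) = φ y) (hp : p = jw q e n)
include hone

/-- This is the case `j = 0` of the triangular action. The constant in `casimir` is chosen so that
the terms in `ħ` cancel. -/
theorem map_casimir : φ (casimir q (rootZero q h s) (rootOne q h s) n e X) =
    (q ^ (1 - (n : ℤ)) * qInt q n) • φ X := by
  have h0 := hq.ne_zero
  have := H.map_casimir_mul hq φ hl hr 0 (Nat.zero_le n)
  simp only [jmProd, mul_one, one_mul, jm, map_sub, map_smul, hone] at this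
  rw [this, stepCoeff, eigenvalue]
  simp only [rootZero, Nat.cast_zero, sub_zero, qInt_zero, neg_zero, zpow_zero, mul_zero,
    zero_mul, add_zero, one_mul, smul_sub, smul_smul]
  module

include hmul hpl hp

-- Since the Casimir commutes with `p`, the projector hidden in a product of compressions can be
-- moved to the left end, where `φ` ignores it.
omit [CharZero K] hl hr hone in
theorem map_casimir_mul_eq (y : A) :
    φ (casimir q (rootZero q h s) (rootOne q h s) n e X * y) =
      φ (casimir q (rootZero q h s) (rootOne q h s) n e X) * φ y := by
  have hc := (H.commute_casimir_jw hq n le_rfl).eq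
  rw [← hp] at hc
  rw [← hmul, hc, mul_assoc, hpl]

/-- The factor with root `μ_j` removes the diagonal term of the triangular action and moves `F j` to
`F (j + 1)`. -/
theorem aeval_prod_sub (j : ℕ) (hj : j ≤ n + 1) :
    Polynomial.aeval (φ (casimir q (rootZero q h s) (rootOne q h s) n e X))
      (∏ l : Fin j, (Polynomial.X - Polynomial.C (eigenvalue q h s n ⟨l, by omega⟩))) =
      (∏ l ∈ Finset.range j, stepCoeff q n l) • φ (F j) := by
  induction j with
  | zero => simp [jmProd, hone]
  | succ j ih =>
    rw [Fin.prod_univ_castSucc, mul_comm, map_mul]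
    have := ih (by omega)
    simp only [Fin.val_castSucc, Fin.val_last] at this ⊢
    rw [this, Finset.prod_range_succ, map_sub, Polynomial.aeval_X, Polynomial.aeval_C, sub_mul,
      mul_smul_comm, ← H.map_casimir_mul_eq hq φ hmul hpl hp,
      H.map_casimir_mul hq φ hl hr j (by omega), Algebra.algebraMap_eq_smul_one,
      smul_mul_assoc, one_mul]
    module

end IsBlob

end Compression

end QSphere

namespace QSphere

/-! ### The Newton moments of the braided multiplicities. -/

section Summation

variable {K : Type*} [Field K] [CharZero K] {q h s : K}

theorem qDiff_zero (q h s : K) : qDiff q h s 0 = s := by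
  simp only [qDiff, neg_zero, zpow_zero, qInt_zero]
  ring

theorem multFormula_eq (hs : s ≠ 0) (m : ℕ) (i : Fin (m + 1)) :
    multFormula q h s m i = qDiff q h s ((m : ℤ) - 2 * i.val) / s := by
  rw [multFormula, qDiff, show -(m : ℤ) + 2 * i.val = -((m : ℤ) - 2 * i.val) by ring]
  field_simp

theorem sum_qDiff_mul_prod (hq : Generic q) (m j : ℕ) :
    qInt q (j + 1) * ∑ i ∈ Finset.range (m + 1), qDiff q h s ((m : ℤ) - 2 * i) *
      ∏ l ∈ Finset.range j, qInt q ((i : ℤ) - l) * qDiff q h s ((m : ℤ) - i - l) =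
    s * qInt q (m + 1) *
      ∏ l ∈ Finset.range j, qInt q ((m : ℤ) - l) * qDiff q h s (-(l + 1)) := by
  -- The primitive of the summand. Consecutive values share all factors but one of each kind; `U 0`
  -- vanishes through `[0]_q`, and the factor `l = 0` of `U (m + 1)` is `[m+1]_q s`.
  let U : ℕ → K := fun i => ∏ l ∈ Finset.range (j + 1),
    qInt q ((i : ℤ) - l) * qDiff q h s ((m : ℤ) + 1 - i - l)
  have step : ∀ i : ℕ, qInt q (j + 1) * (qDiff q h s ((m : ℤ) - 2 * i) *
      ∏ l ∈ Finset.range j, qInt q ((i : ℤ) - l) * qDiff q h s ((m : ℤ) - i - l)) =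
      U (i + 1) - U i := by
    intro i
    have e1 : U (i + 1) = qInt q ((i : ℤ) + 1) * qDiff q h s ((m : ℤ) - i - j) *
        ∏ l ∈ Finset.range j, qInt q ((i : ℤ) - l) * qDiff q h s ((m : ℤ) - i - l) := by
      simp only [U, Finset.prod_mul_distrib]
      rw [Finset.prod_range_succ', Finset.prod_range_succ (fun l : ℕ =>
        qDiff q h s ((m : ℤ) + 1 - (i + 1 : ℕ) - l))]
      push_cast
      simp only [add_sub_add_right_eq_sub, sub_zero]
      ring
    have e2 : U i = qInt q ((i : ℤ) - j) * qDiff q h s ((m : ℤ) + 1 - i) *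
        ∏ l ∈ Finset.range j, qInt q ((i : ℤ) - l) * qDiff q h s ((m : ℤ) - i - l) := by
      simp only [U, Finset.prod_mul_distrib]
      rw [Finset.prod_range_succ, Finset.prod_range_succ' (fun l : ℕ =>
        qDiff q h s ((m : ℤ) + 1 - i - l))]
      push_cast
      have : ∀ l : ℤ, (m : ℤ) + 1 - i - (l + 1) = m - i - l := fun l => by ring
      simp only [this, sub_zero]
      ring
    rw [e1, e2]
    linear_combination -(∏ l ∈ Finset.range j, qInt q ((i : ℤ) - l) *
      qDiff q h s ((m : ℤ) - i - l)) * hq.qDiff_telescope h s i j m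
  rw [Finset.mul_sum, Finset.sum_congr rfl fun i _ => step i, Finset.sum_range_sub]
  have h0 : U 0 = 0 := Finset.prod_eq_zero (i := 0) (by simp) (by simp)
  rw [h0, sub_zero]
  simp only [U]
  rw [Finset.prod_range_succ']
  push_cast
  simp only [add_sub_add_right_eq_sub, sub_zero, zero_sub, sub_self, qDiff_zero]
  ring

/-- The right side is the trace of `∏_{l<j} (L_(m) - μ_l(m))`. The eigenvalues need not be distinct
here, only `s ≠ 0`. -/
theorem sum_mult_mul_prod (hq : Generic q) (hs : s ≠ 0) {m j : ℕ} (hj : j ≤ m) :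
    ∑ i : Fin (m + 1), multFormula q h s m i *
      ∏ l : Fin j, (eigenvalue q h s m i - eigenvalue q h s m ⟨l, by omega⟩) =
    (∏ l ∈ Finset.range j, stepCoeff q m l) * (qInt q (m + 1 : ℕ) / qInt q (j + 1 : ℕ) *
      ∏ k ∈ Finset.range j, traceFactor q h s k) := by
  have h0 := hq.ne_zero
  have hpos : qInt q ((j + 1 : ℕ) : ℤ) ≠ 0 := hq.qInt_ne_zero (by omega)
  have key := sum_qDiff_mul_prod (h := h) (s := s) hq m j
  have e1 : ∀ i : Fin (m + 1), multFormula q h s m i *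
      ∏ l : Fin j, (eigenvalue q h s m i - eigenvalue q h s m ⟨l, by omega⟩) =
      (((q ^ m)⁻¹) ^ j / s) * (qDiff q h s ((m : ℤ) - 2 * i.val) * ∏ l ∈ Finset.range j,
        qInt q ((i.val : ℤ) - l) * qDiff q h s ((m : ℤ) - i.val - l)) := by
    intro i
    simp only [hq.eigenvalue_sub, multFormula_eq hs, mul_assoc, Finset.prod_mul_distrib,
      Finset.prod_const, Finset.card_univ, Fintype.card_fin]
    rw [Fin.prod_univ_eq_prod_range (fun l : ℕ => qInt q ((i.val : ℤ) - l)) j,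
      Fin.prod_univ_eq_prod_range (fun l : ℕ => qDiff q h s ((m : ℤ) - i.val - l)) j]
    ring
  have e2 : (∏ l ∈ Finset.range j, stepCoeff q m l) * ∏ k ∈ Finset.range j, traceFactor q h s k =
      ((q ^ m)⁻¹) ^ j * ∏ l ∈ Finset.range j, qInt q ((m : ℤ) - l) * qDiff q h s (-(l + 1)) := by
    rw [← Finset.prod_mul_distrib, ← Finset.card_range j, ← Finset.prod_const,
      Finset.card_range, ← Finset.prod_mul_distrib]
    refine Finset.prod_congr rfl fun l _ => ?_
    rw [stepCoeff, traceFactor, ← zpow_natCast q m, ← zpow_neg,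
      show -(m : ℤ) = (1 - m - l) + (l - 1) by ring, zpow_add₀ h0]
    ring
  rw [Finset.sum_congr rfl fun i _ => e1 i, ← Finset.mul_sum,
    Fin.sum_univ_eq_sum_range (fun i : ℕ => qDiff q h s ((m : ℤ) - 2 * i) *
      ∏ l ∈ Finset.range j, qInt q ((i : ℤ) - l) * qDiff q h s ((m : ℤ) - i - l)) (m + 1)]
  push_cast at hpos ⊢
  rw [mul_left_comm, e2]
  field_simp
  linear_combination key

end Summation

/-! ### From Newton moments to power sums. -/

section PowerSums

open Polynomial

variable {K : Type*} [Field K] {B : Type*} [Ring B] [Algebra K B] {N : Type*} [AddCommGroup N]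
  [Module K N]

/-- With `P j` the product of the first `j` factors, `P j * X ^ (k + 1) = P (j + 1) * X ^ k + μ_j •
(P j * X ^ k)`. Descending induction on `j` starts at `m + 1`, where both sides vanish, and ends at
`P 0 = 1`. -/
theorem map_pow_of_newton (τ : B →ₗ[K] N) (L : B) (w : N) {m : ℕ} (μ d : Fin (m + 1) → K)
    (h0 : aeval L (∏ l, (X - Polynomial.C (μ l))) = 0)
    (hj : ∀ (j : ℕ) (hj : j ≤ m), τ (aeval L (∏ l : Fin j, (X - Polynomial.C (μ ⟨l, by omega⟩)))) =
      (∑ i, d i * ∏ l : Fin j, (μ i - μ ⟨l, by omega⟩)) • w) (n : ℕ) :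
    τ (L ^ n) = (∑ i, μ i ^ n * d i) • w := by
  let P : ∀ j, j ≤ m + 1 → K[X] := fun j hj => ∏ l : Fin j, (X - Polynomial.C (μ ⟨l, by omega⟩))
  have key : ∀ r j : ℕ, ∀ hr : j + r = m + 1, ∀ k,
      τ (aeval L (P j (by omega) * X ^ k)) =
        (∑ i, d i * (P j (by omega) * X ^ k).eval (μ i)) • w := by
    intro r
    induction r with
    | zero =>
      intro j hr k
      obtain rfl : j = m + 1 := by omega
      have e1 : aeval L (P (m + 1) le_rfl) = 0 := h0
      have e2 : ∀ i, (P (m + 1) le_rfl).eval (μ i) = 0 := fun i => by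
        simp only [P, eval_prod]
        exact Finset.prod_eq_zero (Finset.mem_univ i) (by simp)
      simp [e1, e2]
    | succ r ih =>
      intro j hr k
      induction k with
      | zero =>
        have := hj j (by omega)
        simpa [P, eval_prod] using this
      | succ k ihk =>
        have e1 : P j (by omega) * X ^ (k + 1) = P (j + 1) (by omega) * X ^ k +
            μ ⟨j, by omega⟩ • (P j (by omega) * X ^ k) := by
          simp only [P, Fin.prod_univ_castSucc, Fin.val_castSucc, Fin.val_last, smul_eq_C_mul]
          ring
        have e2 := ih (j + 1) (by omega) k
        rw [e1, map_add, map_add, map_smul, map_smul, ihk, e2, smul_smul, ← add_smul,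
          Finset.mul_sum, ← Finset.sum_add_distrib]
        congr 1
        refine Finset.sum_congr rfl fun i _ => ?_
        rw [eval_add, eval_smul, smul_eq_mul]
        ring
  have := key (m + 1) 0 (by omega) n
  simpa [P, mul_comm] using this

end PowerSums

end QSphere

namespace QSphere

/-! ### Operators on words: matrix units, braidings, symmetrizers and the weight. -/

section Sites

variable {K : Type*} [Field K] {m : ℕ}

/-- The operator `X` acting in one tensor factor. -/
def siteOp (p : Fin m) (X : Matrix (Fin 2) (Fin 2) K) :
    Matrix (Fin m → Fin 2) (Fin m → Fin 2) K :=
  Matrix.of fun w w' => if ∀ l, l ≠ p → w l = w' l then X (w p) (w' p) else 0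

theorem siteOp_mul_apply (p : Fin m) (X : Matrix (Fin 2) (Fin 2) K)
    (N : Matrix (Fin m → Fin 2) (Fin m → Fin 2) K) (w w' : Fin m → Fin 2) :
    (siteOp p X * N) w w' = ∑ t, X (w p) t * N (Function.update w p t) w' := by
  rw [Matrix.mul_apply]
  refine (Fintype.sum_of_injective (fun t => Function.update w p t)
    (Function.update_injective w p) _ _ ?_ ?_).symm
  · intro v hv
    rw [siteOp, Matrix.of_apply, if_neg, zero_mul]
    intro h
    refine hv ⟨v p, ?_⟩
    funext l
    by_cases hl : l = p
    · subst hl; simp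
    · simp [hl, h l hl]
  · intro t
    rw [siteOp, Matrix.of_apply, if_pos]
    · simp
    · intro l hl; simp [hl]

theorem siteOp_mul (p : Fin m) (X Y : Matrix (Fin 2) (Fin 2) K) :
    siteOp p X * siteOp p Y = siteOp p (X * Y) := by
  ext w w'
  rw [siteOp_mul_apply]
  have : ∀ t, (∀ l, l ≠ p → Function.update w p t l = w' l) ↔ ∀ l, l ≠ p → w l = w' l :=
    fun t => forall_congr' fun l => imp_congr_right fun hl => by simp [hl]
  simp only [siteOp, Matrix.of_apply, this, Matrix.mul_apply]
  split_ifs <;> simp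

theorem siteOp_one (p : Fin m) : siteOp p (1 : Matrix (Fin 2) (Fin 2) K) = 1 := by
  ext w w'
  rw [siteOp, Matrix.of_apply, Matrix.one_apply, Matrix.one_apply]
  by_cases h : w = w'
  · subst h; simp
  · rw [if_neg h, ite_eq_right_iff]
    intro h1
    rw [if_neg]
    intro h2
    refine h (funext fun l => ?_)
    by_cases hl : l = p
    · rw [hl, h2]
    · exact h1 l hl

theorem siteOp_add (p : Fin m) (X Y : Matrix (Fin 2) (Fin 2) K) :
    siteOp p (X + Y) = siteOp p X + siteOp p Y := by
  ext w w'
  simp only [siteOp, Matrix.of_apply, Matrix.add_apply]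
  split_ifs <;> simp

theorem siteOp_smul (p : Fin m) (c : K) (X : Matrix (Fin 2) (Fin 2) K) :
    siteOp p (c • X) = c • siteOp p X := by
  ext w w'
  simp only [siteOp, Matrix.of_apply, Matrix.smul_apply]
  split_ifs <;> simp

theorem siteOp_comm {p p' : Fin m} (hp : p ≠ p') (X Y : Matrix (Fin 2) (Fin 2) K) :
    siteOp p X * siteOp p' Y = siteOp p' Y * siteOp p X := by
  suffices h : siteOp p X * (siteOp p' Y * 1) = siteOp p' Y * (siteOp p X * 1) by simpa using h
  ext w w'
  simp only [siteOp_mul_apply, Finset.mul_sum]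
  rw [Finset.sum_comm]
  refine Finset.sum_congr rfl fun s _ => Finset.sum_congr rfl fun t _ => ?_
  rw [Function.update_comm hp, Function.update_of_ne hp, Function.update_of_ne hp.symm]
  ring

/-- The matrix units of the tensor factor number `p`, counted from `0`. -/
def siteUnit (K : Type*) [Field K] (m p : ℕ) (i j : Fin 2) :
    Matrix (Fin m → Fin 2) (Fin m → Fin 2) K :=
  if h : p < m then siteOp ⟨p, h⟩ (Matrix.single i j 1) else 0

theorem siteUnit_of_lt {p : ℕ} (h : p < m) (i j : Fin 2) :
    siteUnit K m p i j = siteOp ⟨p, h⟩ (Matrix.single i j 1) := dif_pos h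

theorem isMatrixUnits_siteUnit : IsMatrixUnits m (siteUnit K m) where
  mul p hp i j k l := by
    simp only [siteUnit_of_lt hp, siteOp_mul]
    split_ifs with h
    · subst h; simp
    · rw [Matrix.single_mul_single_of_ne _ _ _ _ h]
      ext; simp [siteOp]
  one p hp := by
    simp only [siteUnit_of_lt hp]
    rw [← siteOp_add, ← siteOp_one ⟨p, hp⟩]
    congr 1
    ext i j
    fin_cases i <;> fin_cases j <;> simp
  comm p p' hp hp' h i j k l := by
    simp only [siteUnit_of_lt hp, siteUnit_of_lt hp']
    exact siteOp_comm (by simpa using h) _ _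

theorem siteUnit_mul_siteUnit_apply {k : ℕ} (hk : k + 1 < m) (i j i' j' : Fin 2)
    (w w' : Fin m → Fin 2) :
    (siteUnit K m k i j * siteUnit K m (k + 1) i' j') w w' =
      if (∀ l : Fin m, l ≠ ⟨k, by omega⟩ → l ≠ ⟨k + 1, hk⟩ → w l = w' l) then
        if (w ⟨k, by omega⟩ = i ∧ w ⟨k + 1, hk⟩ = i') ∧ w' ⟨k, by omega⟩ = j ∧ w' ⟨k + 1, hk⟩ = j'
        then 1 else 0
      else 0 := by
  set a : Fin m := ⟨k, by omega⟩ with ha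
  set b : Fin m := ⟨k + 1, hk⟩ with hb
  have hab : a ≠ b := by simp [ha, hb]
  rw [siteUnit_of_lt (show k < m by omega), siteUnit_of_lt hk, siteOp_mul_apply,
    Finset.sum_eq_single j]
  · have hiff : (∀ l, l ≠ b → Function.update w a j l = w' l) ↔
        w' a = j ∧ ∀ l, l ≠ a → l ≠ b → w l = w' l := by
      constructor
      · intro h
        refine ⟨by simpa using (h a hab).symm, fun l hla hlb => by simpa [hla] using h l hlb⟩
      · rintro ⟨h1, h2⟩ l hl
        by_cases hla : l = a
        · subst hla; simp [h1]
        · simp [hla, h2 l hla hl]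
    rw [Matrix.single_apply, siteOp, Matrix.of_apply, Matrix.single_apply, ← ha, ← hb,
      Function.update_of_ne hab.symm]
    simp only [hiff, eq_comm (a := i), eq_comm (a := i'), eq_comm (a := j')]
    clear hiff
    rcases Classical.propComplete (∀ l, l ≠ a → l ≠ b → w l = w' l) with h1 | h1 <;>
      simp only [h1] <;> by_cases h2 : w' a = j <;> by_cases h3 : w a = i <;>
      by_cases h4 : w b = i' <;> by_cases h5 : w' b = j' <;> simp [h2, h3, h4, h5]
  · intro t _ ht
    rw [Matrix.single_apply, if_neg (by simp [ht.symm]), zero_mul]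
  · simp

/-- `braidAt` counts tensor factors from `1` and `tl` from `0`, whence the shift. -/
theorem braidAt_succ (q : K) {k : ℕ} (hk : k + 1 < m) :
    braidAt q m (k + 1) = q • (1 : Matrix _ _ K) - tl q (siteUnit K m) k := by
  ext w w'
  rw [Matrix.sub_apply, Matrix.smul_apply, Matrix.one_apply, tl, Matrix.add_apply,
    Matrix.sub_apply, Matrix.sub_apply, Matrix.smul_apply, Matrix.smul_apply]
  simp only [siteUnit_mul_siteUnit_apply hk, braidAt, Matrix.of_apply, dif_pos hk,
    Nat.add_sub_cancel]
  set a : Fin m := ⟨k, by omega⟩ with ha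
  set b : Fin m := ⟨k + 1, hk⟩ with hb
  by_cases h : ∀ l : Fin m, l ≠ a → l ≠ b → w l = w' l
  · simp only [if_pos h]
    have h1 : w = w' ↔ w a = w' a ∧ w b = w' b := by
      refine ⟨fun h => by simp [h], fun h2 => funext fun l => ?_⟩
      by_cases hla : l = a
      · rw [hla, h2.1]
      · by_cases hlb : l = b
        · rw [hlb, h2.2]
        · exact h l hla hlb
    simp only [h1]
    generalize w a = x
    generalize w b = y
    generalize w' a = x'
    generalize w' b = y'
    fin_cases x <;> fin_cases y <;> fin_cases x' <;> fin_cases y' <;> simp [R]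
  · simp only [if_neg h]
    have h1 : w ≠ w' := fun h1 => h fun l _ _ => by rw [h1]
    simp [h1]

theorem onFirst_eq_siteOp (hm : 0 < m) (X : Matrix (Fin 2) (Fin 2) K) :
    onFirst m X = siteOp ⟨0, hm⟩ X := by
  ext w w'
  rw [onFirst, Matrix.of_apply, siteOp, Matrix.of_apply,
    ← Finset.mul_prod_erase _ _ (Finset.mem_univ (⟨0, hm⟩ : Fin m))]
  have h1 : ∀ j ∈ Finset.univ.erase (⟨0, hm⟩ : Fin m),
      (if j.val = 0 then X else 1) (w j) (w' j) = if w j = w' j then 1 else 0 := by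
    intro j hj
    have : j.val ≠ 0 := fun h => Finset.ne_of_mem_erase hj (Fin.ext h)
    rw [if_neg this, Matrix.one_apply]
  rw [Finset.prod_congr rfl h1, Finset.prod_ite_zero]
  simp

/-- The weight matrix `C^{⊗m}`. -/
def weightMatrix (q : K) (m : ℕ) : Matrix (Fin m → Fin 2) (Fin m → Fin 2) K :=
  Matrix.of fun w w' => ∏ j : Fin m, C q (w j) (w' j)

theorem weightMatrix_eq (q : K) :
    weightMatrix q m = Matrix.diagonal fun w => ∏ j, cWeight q (w j) := by
  ext w w'
  have h1 : ∀ i j, C q i j = if i = j then cWeight q i else 0 := by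
    intro i j
    fin_cases i <;> fin_cases j <;> simp [C, cWeight]
  simp only [weightMatrix, Matrix.of_apply, h1, Finset.prod_ite_zero, Matrix.diagonal_apply,
    Finset.mem_univ, forall_const, funext_iff]

theorem weightMatrix_mul_siteUnit (q : K) {p : ℕ} (hp : p < m) (i j : Fin 2) :
    cWeight q j • (weightMatrix q m * siteUnit K m p i j) =
      cWeight q i • (siteUnit K m p i j * weightMatrix q m) := by
  ext w w'
  rw [weightMatrix_eq, Matrix.smul_apply, Matrix.smul_apply, Matrix.diagonal_mul,
    Matrix.mul_diagonal, siteUnit_of_lt hp, siteOp, Matrix.of_apply, Matrix.single_apply]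
  split_ifs with h1 h2
  · have h3 : ∀ v : Fin m → Fin 2, ∏ j, cWeight q (v j) = cWeight q (v ⟨p, hp⟩) *
        ∏ j ∈ Finset.univ.erase (⟨p, hp⟩ : Fin m), cWeight q (v j) := fun v =>
      (Finset.mul_prod_erase _ _ (Finset.mem_univ _)).symm
    rw [h3 w, h3 w', Finset.prod_congr rfl fun l hl => by rw [h1 l (Finset.ne_of_mem_erase hl)],
      ← h2.1, ← h2.2]
    simp only [smul_eq_mul]
    ring
  · simp
  · simp

/-- Each summand of the generator preserves the number of letters of each kind, hence the weight. -/
theorem commute_weightMatrix_tl (q : K) (hq : q ≠ 0) {k : ℕ} (hk : k + 1 < m) :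
    Commute (weightMatrix q m) (tl q (siteUnit K m) k) := by
  have hc : ∀ i, cWeight q i ≠ 0 := fun i => by fin_cases i <;> simp [cWeight, hq]
  have key : ∀ i j i' j', cWeight q i * cWeight q i' = cWeight q j * cWeight q j' →
      Commute (weightMatrix q m) (siteUnit K m k i j * siteUnit K m (k + 1) i' j') := by
    intro i j i' j' h
    have h1 := weightMatrix_mul_siteUnit q (show k < m by omega) i j
    have h2 := weightMatrix_mul_siteUnit q hk i' j'
    unfold Commute SemiconjBy
    have h3 : (cWeight q j * cWeight q j') • (weightMatrix q m * (siteUnit K m k i j *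
        siteUnit K m (k + 1) i' j')) = (cWeight q j * cWeight q j') • (siteUnit K m k i j *
        siteUnit K m (k + 1) i' j' * weightMatrix q m) := by
      conv_rhs => rw [← h, mul_smul, mul_assoc, ← mul_smul_comm, ← h2, mul_smul_comm,
        ← mul_assoc, smul_comm, ← smul_mul_assoc, ← h1, smul_mul_assoc]
      rw [mul_comm, mul_smul, mul_assoc]
    exact smul_right_injective _ (mul_ne_zero (hc j) (hc j')) h3
  have h01 : cWeight q 0 * cWeight q 1 = cWeight q 1 * cWeight q 0 := mul_comm _ _
  exact ((((key _ _ _ _ rfl).smul_right _).sub_right (key _ _ _ _ h01)).sub_right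
    (key _ _ _ _ h01.symm)).add_right ((key _ _ _ _ rfl).smul_right _)

theorem symmetrizer_eq_jw [CharZero K] {q : K} (hq : Generic q) :
    ∀ k, k ≤ m → symmetrizer q m k = jw q (tl q (siteUnit K m)) k
  | 0, _ => rfl
  | 1, _ => by
    have := hq.qInt_one
    simp [symmetrizer, jw, this]
  | k + 2, hk => by
    have ih := symmetrizer_eq_jw hq (k + 1) (by omega)
    have hid := (isMatrixUnits_siteUnit (K := K) (m := m)).isTL hq |>.jw_mul_self hq
      (k := k + 1) (by omega)
    have hpos : qInt q ((k + 2 : ℕ) : ℤ) ≠ 0 := hq.qInt_ne_zero (by omega)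
    -- With `R = q - e` this turns the middle factor of the symmetrizer into `[k+2]_q - [k+1]_q e`,
    -- and idempotence of the smaller projector yields the Jones–Wenzl recursion.
    have e1 : q ^ (-((k + 1 : ℕ) : ℤ)) + qInt q ((k + 1 : ℕ) : ℤ) * q =
        qInt q ((k + 2 : ℕ) : ℤ) := by
      rw [show ((k + 2 : ℕ) : ℤ) = ((k + 1 : ℕ) : ℤ) + 1 by push_cast; ring, hq.qInt_succ, zpow_neg]
      ring
    rw [symmetrizer, ih, braidAt_succ q (by omega), jw_succ_succ]
    rw [show ((k + 1 : ℕ) : ℤ) + 1 = ((k + 2 : ℕ) : ℤ) by push_cast; ring]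
    rw [smul_sub, smul_smul, ← add_sub_assoc, ← add_smul, e1, mul_sub, sub_mul, mul_smul_comm,
      mul_one, smul_mul_assoc, hid, mul_smul_comm, smul_mul_assoc, smul_sub, smul_smul, smul_smul,
      inv_mul_cancel₀ hpos, one_smul, div_eq_inv_mul]

end Sites

end QSphere

namespace QSphere

/-! ### The reflection equation as a quadratic relation; nontriviality of the sphere. -/

section ReflectionEquation

variable {K : Type*} [Field K] {A D : Type*} [Ring A] [Algebra K A] [Ring D] [Algebra K D]

/-- The characteristic expression `L² - q⁻¹ ħ L` of the generating matrix. -/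
def charMatrix (q h : K) (L : Matrix (Fin 2) (Fin 2) A) : Matrix (Fin 2) (Fin 2) A :=
  L * L - (q⁻¹ * h) • L

theorem trR₂_eq (q : K) (L : Matrix (Fin 2) (Fin 2) A) :
    trR₂ q L = q⁻¹ • L 0 0 + q • L 1 1 := by
  simp [trR₂, C, Fin.sum_univ_two]

theorem kronecker_one_mul (L L' : Matrix (Fin 2) (Fin 2) A) :
    (L ⊗ₖ (1 : Matrix (Fin 2) (Fin 2) A)) * (L' ⊗ₖ (1 : Matrix (Fin 2) (Fin 2) A)) =
      (L * L') ⊗ₖ (1 : Matrix (Fin 2) (Fin 2) A) := by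
  ext ⟨i, j⟩ ⟨k, l⟩
  fin_cases j <;> fin_cases l <;>
    simp [Matrix.mul_apply, Fintype.sum_prod_type, Matrix.kroneckerMap_apply, Fin.sum_univ_two]

/-- Substitute `R = q - e`. The terms containing `e L₁ e` vanish because `L` is traceless, `q² L₁²`
and `q L₁ e L₁` cancel, and what remains is a commutator with `e`. -/
theorem mre_eq {q h : K} (h0 : q ≠ 0) {L : Matrix (Fin 2) (Fin 2) A} (htr : trR₂ q L = 0) :
    mre q h L = q • (charMatrix q h L ⊗ₖ (1 : Matrix (Fin 2) (Fin 2) A) *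
        (q • (1 : Matrix (Fin 2 × Fin 2) (Fin 2 × Fin 2) K) - R q).map (algebraMap K A) -
      (q • (1 : Matrix (Fin 2 × Fin 2) (Fin 2 × Fin 2) K) - R q).map (algebraMap K A) *
        charMatrix q h L ⊗ₖ (1 : Matrix (Fin 2) (Fin 2) A)) := by
  have h00 : L 0 0 = -(q * q) • L 1 1 := by
    rw [trR₂_eq] at htr
    have := congrArg (fun x => q • x) htr
    simp only [smul_add, smul_smul, mul_inv_cancel₀ h0, one_smul, smul_zero] at this
    rw [neg_smul]
    exact eq_neg_of_add_eq_zero_left this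
  have hR : (R q).map (algebraMap K A) = q • 1 -
      (q • (1 : Matrix (Fin 2 × Fin 2) (Fin 2 × Fin 2) K) - R q).map (algebraMap K A) := by
    ext s t
    simp only [Matrix.map_apply, Matrix.sub_apply, Matrix.smul_apply, Matrix.one_apply, map_sub]
    split_ifs <;> simp [Algebra.smul_def]
  have he : (q • (1 : Matrix (Fin 2 × Fin 2) (Fin 2 × Fin 2) K) - R q).map (algebraMap K A) *
      (L ⊗ₖ (1 : Matrix (Fin 2) (Fin 2) A)) *
      (q • (1 : Matrix (Fin 2 × Fin 2) (Fin 2 × Fin 2) K) - R q).map (algebraMap K A) = 0 := by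
    have hqq : q⁻¹ * q⁻¹ * (q * q) = 1 := by field_simp
    ext ⟨i, j⟩ ⟨k, l⟩
    fin_cases i <;> fin_cases j <;> fin_cases k <;> fin_cases l <;>
      simp [Matrix.mul_apply, Fintype.sum_prod_type, Fin.sum_univ_two, R, h00,
        Algebra.algebraMap_eq_smul_one, smul_smul, h0, hqq]
  have hL : charMatrix q h L ⊗ₖ (1 : Matrix (Fin 2) (Fin 2) A) =
      (L ⊗ₖ (1 : Matrix (Fin 2) (Fin 2) A)) * (L ⊗ₖ (1 : Matrix (Fin 2) (Fin 2) A)) -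
        (q⁻¹ * h) • (L ⊗ₖ (1 : Matrix (Fin 2) (Fin 2) A)) := by
    rw [kronecker_one_mul]
    ext ⟨i, j⟩ ⟨k, l⟩
    simp [charMatrix, Matrix.kroneckerMap_apply, sub_mul]
  unfold mre
  simp only []
  rw [hR, hL]
  generalize (q • (1 : Matrix (Fin 2 × Fin 2) (Fin 2 × Fin 2) K) - R q).map (algebraMap K A) = e
    at *
  generalize L ⊗ₖ (1 : Matrix (Fin 2) (Fin 2) A) = M at *
  have he' : M * e * M * e = 0 := by rw [mul_assoc M, mul_assoc, he, mul_zero]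
  simp only [sub_mul, mul_sub, smul_mul_assoc, mul_smul_comm, one_mul, mul_one, ← mul_assoc, he,
    he', zero_mul]
  match_scalars <;> field_simp <;> ring

theorem mre_eq_zero {q h : K} (h0 : q ≠ 0) {L : Matrix (Fin 2) (Fin 2) A} (htr : trR₂ q L = 0)
    {z : A} (hz : charMatrix q h L = Matrix.diagonal fun _ => z) : mre q h L = 0 := by
  rw [mre_eq h0 htr, hz]
  have : Matrix.diagonal (fun _ : Fin 2 => z) ⊗ₖ (1 : Matrix (Fin 2) (Fin 2) A) =
      Matrix.diagonal fun _ : Fin 2 × Fin 2 => z := by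
    ext ⟨i, j⟩ ⟨k, l⟩
    fin_cases i <;> fin_cases j <;> fin_cases k <;> fin_cases l <;>
      simp [Matrix.kroneckerMap_apply]
  rw [this]
  ext s t
  rw [Matrix.smul_apply, Matrix.sub_apply, Matrix.diagonal_mul, Matrix.mul_diagonal,
    Matrix.map_apply, Algebra.commutes, sub_self, smul_zero, Matrix.zero_apply]

/-- A matrix acting in the first factor commutes with the rank-one operator `e` only if it is
scalar; three entries of the commutator suffice. -/
theorem charMatrix_eq_diagonal {q h : K} (h0 : q ≠ 0) {L : Matrix (Fin 2) (Fin 2) A}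
    (htr : trR₂ q L = 0) (hmre : mre q h L = 0) :
    charMatrix q h L = Matrix.diagonal fun _ => charMatrix q h L 0 0 := by
  rw [mre_eq h0 htr] at hmre
  have key : ∀ s t, _ := fun s t => congrFun (congrFun hmre s) t
  generalize charMatrix q h L = M at *
  have k1 := key (1, 1) (0, 1)
  have k2 := key (0, 0) (1, 0)
  have k3 := key (0, 1) (1, 0)
  simp [Matrix.mul_apply, Fintype.sum_prod_type, Fin.sum_univ_two, R, h0,
    Algebra.algebraMap_eq_smul_one, Matrix.kroneckerMap_apply] at k1 k2 k3
  ext i j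
  fin_cases i <;> fin_cases j
  · simp
  · simpa using k2
  · simpa using k1
  · rw [neg_add_eq_zero] at k3
    simpa using (smul_right_injective A h0 k3).symm

theorem casimir_eq {q h : K} [CharZero K] (hq : Generic q) {L : Matrix (Fin 2) (Fin 2) A}
    (htr : trR₂ q L = 0) {z : A} (hz : charMatrix q h L = Matrix.diagonal fun _ => z) :
    (-(qInt q 2)⁻¹) • trR₂ q (L ^ 2) = -z := by
  have hL : L ^ 2 = Matrix.diagonal (fun _ => z) + (q⁻¹ * h) • L := by
    rw [← hz, charMatrix, pow_two]; abel
  have h2 : trR₂ q (L ^ 2) = qInt q 2 • z := by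
    rw [trR₂_eq] at htr
    rw [hL, trR₂_eq, hq.qInt_two]
    have : q⁻¹ • (q⁻¹ * h) • L 0 0 + q • (q⁻¹ * h) • L 1 1 = 0 := by
      rw [smul_comm, smul_comm q, ← smul_add, htr, smul_zero]
    simp only [Matrix.add_apply, Matrix.diagonal_apply_eq, Matrix.smul_apply, smul_add]
    rw [add_add_add_comm, this]
    module
  rw [h2, neg_smul, smul_smul, inv_mul_cancel₀ hq.qInt_two_ne_zero, one_smul]

theorem map_trR₂ (f : A →ₐ[K] D) (q : K) (L : Matrix (Fin 2) (Fin 2) A) :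
    trR₂ q (L.map f) = f (trR₂ q L) := by
  simp [trR₂_eq]

theorem map_mre (f : A →ₐ[K] D) (q h : K) (L : Matrix (Fin 2) (Fin 2) A) :
    mre q h (L.map f) = (mre q h L).map f := by
  have hR : ((R q).map (algebraMap K A)).map f = (R q).map (algebraMap K D) := by
    ext; simp
  have hL : (L ⊗ₖ (1 : Matrix (Fin 2) (Fin 2) A)).map f =
      L.map f ⊗ₖ (1 : Matrix (Fin 2) (Fin 2) D) := by
    ext ⟨i, j⟩ ⟨k, l⟩
    by_cases h : j = l <;> simp [Matrix.kroneckerMap_apply, h]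
  have hm : ∀ M N : Matrix (Fin 2 × Fin 2) (Fin 2 × Fin 2) A, (M * N).map f = M.map f * N.map f :=
    fun M N => Matrix.map_mul
  have hs : ∀ M N : Matrix (Fin 2 × Fin 2) (Fin 2 × Fin 2) A, (M - N).map f = M.map f - N.map f :=
    fun M N => by ext; simp
  have hc : ∀ (c : K) (M : Matrix (Fin 2 × Fin 2) (Fin 2 × Fin 2) A),
      (c • M).map f = c • M.map f := fun c M => by ext; simp
  simp only [mre, hs, hm, hc, hR, hL]

theorem slL_trace (q h : K) : trR₂ q (slL q h) = 0 := by
  rw [slL, map_trR₂, ← map_zero (RingQuot.mkAlgHom K (SLRel q h))]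
  exact RingQuot.mkAlgHom_rel K SLRel.trace

theorem mreL_mre (q h : K) : mre q h (mreL q h) = 0 := by
  have : mreL q h = (Matrix.of fun i j : Fin 2 => FreeAlgebra.ι K (i, j)).map
      (RingQuot.mkAlgHom K (MRERel q h)) := rfl
  rw [this, map_mre]
  ext s t
  rw [Matrix.map_apply, Matrix.zero_apply, ← map_zero (RingQuot.mkAlgHom K (MRERel q h))]
  exact RingQuot.mkAlgHom_rel K (MRERel.entry s t)

theorem slL_mre (q h : K) : mre q h (slL q h) = 0 := by
  rw [slL, map_mre, mreL_mre]
  ext; simp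

theorem slL_charMatrix [CharZero K] {q h : K} (hq : Generic q) :
    charMatrix q h (slL q h) = Matrix.diagonal fun _ => -sigma q h := by
  have h1 := charMatrix_eq_diagonal hq.ne_zero (slL_trace q h) (slL_mre q h)
  have h2 := casimir_eq hq (slL_trace q h) h1
  rw [h1, sigma, h2]
  exact congrArg _ (funext fun _ => (neg_neg (charMatrix q h (slL q h) 0 0)).symm)

theorem map_charMatrix (f : A →ₐ[K] D) (q h : K) (L : Matrix (Fin 2) (Fin 2) A) :
    charMatrix q h (L.map f) = (charMatrix q h L).map f := by
  ext i j
  simp [charMatrix, Matrix.mul_apply]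

theorem exists_slAlg_hom {q h : K} {L : Matrix (Fin 2) (Fin 2) A} (htr : trR₂ q L = 0)
    (hmre : mre q h L = 0) : ∃ f : SLAlg q h →ₐ[K] A, (slL q h).map f = L := by
  let f₀ : FreeAlgebra K (Fin 2 × Fin 2) →ₐ[K] A := FreeAlgebra.lift K fun s => L s.1 s.2
  have hf₀ : (Matrix.of fun i j : Fin 2 => FreeAlgebra.ι K (i, j)).map f₀ = L := by
    ext i j; simp [f₀]
  let f₁ : MREAlg q h →ₐ[K] A := RingQuot.liftAlgHom K ⟨f₀, by
    rintro _ _ ⟨s, t⟩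
    have := congrFun (congrFun (map_mre f₀ q h (Matrix.of fun i j => FreeAlgebra.ι K (i, j))) s) t
    rw [hf₀, hmre] at this
    simpa using this.symm⟩
  have hf₁ : (mreL q h).map f₁ = L := by
    ext i j
    simp [mreL, f₁, f₀]
  let f₂ : SLAlg q h →ₐ[K] A := RingQuot.liftAlgHom K ⟨f₁, by
    rintro _ _ ⟨⟩
    rw [← map_trR₂, hf₁, htr, map_zero]⟩
  refine ⟨f₂, ?_⟩
  rw [← hf₁]
  ext i j
  simp [slL, f₂]

/-- Operators on a commutative algebra with a twist, satisfying the relations of the sphere. -/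
def twistMatrix {P : Type*} [CommRing P] [Algebra K P] (q h α : K) (x : P) (σ σ' : P →ₐ[K] P) :
    Matrix (Fin 2) (Fin 2) (Module.End K P) :=
  !![-(q ^ 2) • LinearMap.mulLeft K x, σ.toLinearMap;
    LinearMap.mulLeft K (-(x * x) + (q⁻¹ * h) • x - α • 1) ∘ₗ σ'.toLinearMap,
    LinearMap.mulLeft K x]

theorem charMatrix_twistMatrix {P : Type*} [CommRing P] [Algebra K P] {q h α : K}
    {x : P} {σ σ' : P →ₐ[K] P} (hσ : ∀ p, σ (σ' p) = p) (hσ' : ∀ p, σ' (σ p) = p)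
    (hx : σ x = q ^ 2 • x + (q⁻¹ * h) • 1) :
    charMatrix q h (twistMatrix q h α x σ σ') =
      Matrix.diagonal fun _ => algebraMap K _ (-α) := by
  have hx' : q ^ 2 • σ' x = x - (q⁻¹ * h) • 1 := by
    have := congrArg σ' hx
    rw [hσ', map_add, map_smul, map_smul, map_one] at this
    exact eq_sub_of_add_eq this.symm
  ext i j p
  fin_cases i <;> fin_cases j <;>
    simp only [charMatrix, twistMatrix, Matrix.sub_apply, Matrix.smul_apply, Matrix.mul_apply,
      Fin.sum_univ_two, Matrix.of_apply, Matrix.cons_val', Matrix.cons_val_zero,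
      Matrix.cons_val_one, Matrix.cons_val_fin_one, LinearMap.sub_apply, LinearMap.add_apply,
      Module.End.mul_apply, LinearMap.smul_apply, LinearMap.mulLeft_apply, LinearMap.comp_apply,
      AlgHom.toLinearMap_apply, map_mul, map_add, map_sub, map_smul, map_neg, map_one, hσ, hσ', hx,
      Matrix.diagonal_apply, Fin.zero_eta, Fin.mk_one, Fin.isValue, if_true, zero_ne_one, one_ne_zero,
      if_false,
      LinearMap.zero_apply]
  all_goals
    simp only [LinearMap.neg_apply, Module.algebraMap_end_apply, Algebra.smul_def,
      mul_one, map_neg (algebraMap K P)] at hx' ⊢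
    generalize algebraMap K P (q⁻¹ * h) = c at *
    generalize algebraMap K P (q ^ 2) = Q at *
  · ring
  · ring
  -- Only the lower left entry needs to move `x` past `σ'`.
  · linear_combination -(-(x * x) + c * x - algebraMap K P α) * σ' p * hx'
  · ring

/-- The sphere acts on `K[x]`: the diagonal of `L` by multiples of `x`, one off-diagonal generator
by the substitution `x ↦ q² x + q⁻¹ ħ`, the other by the inverse substitution followed by
multiplication by a quadratic polynomial. -/
theorem nontrivial_sphere [CharZero K] {q : K} (hq : Generic q) (h α : K) :
    Nontrivial (Sphere q h α) := by
  have h0 := hq.ne_zero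
  let x : Polynomial K := Polynomial.X
  let σ : Polynomial K →ₐ[K] Polynomial K := Polynomial.aeval (q ^ 2 • x + (q⁻¹ * h) • 1)
  let σ' : Polynomial K →ₐ[K] Polynomial K := Polynomial.aeval ((q ^ 2)⁻¹ • (x - (q⁻¹ * h) • 1))
  have hσ : ∀ p, σ (σ' p) = p := by
    have : σ.comp σ' = AlgHom.id K _ := by
      ext
      simp [σ, σ', x, smul_smul, h0]
    exact DFunLike.congr_fun this
  have hσ' : ∀ p, σ' (σ p) = p := by
    have : σ'.comp σ = AlgHom.id K _ := by
      ext
      simp [σ, σ', x, smul_smul, h0]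
    exact DFunLike.congr_fun this
  set L := twistMatrix q h α x σ σ' with hL
  have htr : trR₂ q L = 0 := by
    rw [trR₂_eq]
    simp [L, twistMatrix, smul_smul, h0, pow_two]
  have hz : charMatrix q h L = Matrix.diagonal fun _ => algebraMap K _ (-α) :=
    charMatrix_twistMatrix hσ hσ' (by simp [σ, x])
  obtain ⟨f, hf⟩ := exists_slAlg_hom htr (mre_eq_zero h0 htr hz)
  have hσα : f (sigma q h) = algebraMap K _ α := by
    have := casimir_eq hq htr hz
    have h2 : f (trR₂ q (slL q h ^ 2)) = trR₂ q (L ^ 2) := by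
      have : (slL q h ^ 2).map f = L ^ 2 := by
        rw [← hf, pow_two, pow_two]; exact Matrix.map_mul
      rw [← this]
      exact (map_trR₂ (A := SLAlg q h) f q _).symm
    rw [sigma, map_smul, h2, this]
    simp
  let f' : Sphere q h α →ₐ[K] _ := RingQuot.liftAlgHom K ⟨f, by
    rintro _ _ ⟨⟩
    rw [hσα, AlgHom.commutes]⟩
  exact f'.toRingHom.domain_nontrivial

end ReflectionEquation

end QSphere

namespace QSphere

noncomputable section

/-! ### Compression to `V_(m)` and the categorical trace. -/

section Compress

variable {K : Type*} [Field K] [CharZero K] {q : K} {m : ℕ}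

theorem symmetrizer_mul_self (hq : Generic q) :
    symmetrizer q m m * symmetrizer q m m = symmetrizer q m m := by
  rw [symmetrizer_eq_jw hq m le_rfl]
  exact (isMatrixUnits_siteUnit.isTL hq).jw_mul_self hq le_rfl

theorem commute_weightMatrix_symmetrizer (hq : Generic q) :
    Commute (weightMatrix q m) (symmetrizer q m m) := by
  rw [symmetrizer_eq_jw hq m le_rfl]
  exact commute_jw m fun i hi => commute_weightMatrix_tl q hq.ne_zero (by omega)

omit [CharZero K] in
theorem subtype_comp_rangeRestrict :
    (Vm q m).subtype ∘ₗ (projPlus q m).rangeRestrict = Matrix.toLin' (symmetrizer q m m) := rfl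

omit [CharZero K] in
theorem compress_mul (S T : Matrix (Fin m → Fin 2) (Fin m → Fin 2) K) :
    compress q m S * compress q m T = compress q m (S * symmetrizer q m m * T) := by
  rw [compress, compress, compress, Matrix.toLin'_mul, Matrix.toLin'_mul,
    ← subtype_comp_rangeRestrict]
  rfl

theorem rangeRestrict_comp_symmetrizer (hq : Generic q) :
    (projPlus q m).rangeRestrict ∘ₗ Matrix.toLin' (symmetrizer q m m) =
      (projPlus q m).rangeRestrict := by
  apply LinearMap.ext
  intro v
  apply Subtype.ext
  have := congrArg (fun M => Matrix.toLin' M v) (symmetrizer_mul_self (m := m) hq)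
  simp only [Matrix.toLin'_mul] at this
  exact this

theorem symmetrizer_comp_subtype (hq : Generic q) :
    Matrix.toLin' (symmetrizer q m m) ∘ₗ (Vm q m).subtype = (Vm q m).subtype := by
  apply LinearMap.ext
  rintro ⟨_, v, rfl⟩
  have := congrArg (fun M => Matrix.toLin' M v) (symmetrizer_mul_self (m := m) hq)
  simp only [Matrix.toLin'_mul] at this
  exact this

theorem compress_symmetrizer_mul (hq : Generic q)
    (T : Matrix (Fin m → Fin 2) (Fin m → Fin 2) K) :
    compress q m (symmetrizer q m m * T) = compress q m T := by
  rw [compress, compress, Matrix.toLin'_mul, LinearMap.comp_assoc, ← LinearMap.comp_assoc,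
    rangeRestrict_comp_symmetrizer hq]

theorem compress_mul_symmetrizer (hq : Generic q)
    (T : Matrix (Fin m → Fin 2) (Fin m → Fin 2) K) :
    compress q m (T * symmetrizer q m m) = compress q m T := by
  rw [compress, compress, Matrix.toLin'_mul, LinearMap.comp_assoc (Vm q m).subtype,
    symmetrizer_comp_subtype hq]

theorem compress_one (hq : Generic q) : compress q m 1 = 1 := by
  rw [compress, Matrix.toLin'_one, LinearMap.id_comp]
  apply LinearMap.ext
  intro v
  apply Subtype.ext
  exact LinearMap.congr_fun (symmetrizer_comp_subtype hq) v

omit [CharZero K] in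
theorem compress_add (S T : Matrix (Fin m → Fin 2) (Fin m → Fin 2) K) :
    compress q m (S + T) = compress q m S + compress q m T := by
  rw [compress, map_add, LinearMap.add_comp, LinearMap.comp_add]; rfl

omit [CharZero K] in
theorem compress_smul (c : K) (T : Matrix (Fin m → Fin 2) (Fin m → Fin 2) K) :
    compress q m (c • T) = c • compress q m T := by
  rw [compress, map_smul, LinearMap.smul_comp, LinearMap.comp_smul]; rfl

/-- The weight commutes with the symmetrizer, so by cyclicity the trace over `V_(m)` is a trace over
`V^{⊗m}` with one symmetrizer inserted. -/
theorem trR_compress (hq : Generic q) (T : Matrix (Fin m → Fin 2) (Fin m → Fin 2) K) :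
    trR q m (compress q m T) = Matrix.trace (weightMatrix q m * (symmetrizer q m m * T)) := by
  have h1 : trR q m (compress q m T) = LinearMap.trace K (Vm q m)
      (compress q m (weightMatrix q m) * compress q m T) := rfl
  have h2 := (commute_weightMatrix_symmetrizer (m := m) hq).eq
  rw [h1, compress_mul, compress, LinearMap.trace_comp_comm', LinearMap.comp_assoc,
    subtype_comp_rangeRestrict, ← Matrix.toLin'_mul, Matrix.trace_toLin'_eq,
    Matrix.trace_mul_comm, mul_assoc, ← mul_assoc, ← h2, mul_assoc, ← mul_assoc (symmetrizer q m m),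
    symmetrizer_mul_self hq]

end Compress

/-! ### The blob algebra inside `S ⊗ End(V^{⊗m})ᵒᵖ`. -/

section WordAlgebra

variable (K : Type*) [Field K] (S : Type*) [Ring S] [Algebra K S] (m : ℕ)

/-- The tensor product of an algebra with the opposite of the algebra of matrices on words. -/
abbrev WordAlg : Type _ := S ⊗[K] (Matrix (Fin m → Fin 2) (Fin m → Fin 2) K)ᵐᵒᵖ

/-- The operators that act trivially on the first factor of `WordAlg`. -/
def ofWord : Matrix (Fin m → Fin 2) (Fin m → Fin 2) K →ₗ[K] WordAlg K S m :=
  (Algebra.TensorProduct.includeRight (R := K) (A := S)).toLinearMap ∘ₗ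
    (MulOpposite.opLinearEquiv K).toLinearMap

variable {K S m}

theorem ofWord_apply (M : Matrix (Fin m → Fin 2) (Fin m → Fin 2) K) :
    ofWord K S m M = 1 ⊗ₜ MulOpposite.op M := rfl

theorem ofWord_mul (M N : Matrix (Fin m → Fin 2) (Fin m → Fin 2) K) :
    ofWord K S m (M * N) = ofWord K S m N * ofWord K S m M := by
  simp [ofWord_apply]

theorem ofWord_one : ofWord K S m 1 = 1 := rfl

variable (K S m) in
/-- The matrix units of `WordAlg`. -/
def wordUnit (p : ℕ) (i j : Fin 2) : WordAlg K S m := ofWord K S m (siteUnit K m p j i)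

theorem isMatrixUnits_wordUnit : IsMatrixUnits m (wordUnit K S m) where
  mul p hp i j k l := by
    simp only [wordUnit]
    rw [← ofWord_mul, isMatrixUnits_siteUnit.mul p hp]
    by_cases h : j = k
    · simp [h]
    · simp [h, eq_comm (a := k)]
  one p hp := by
    simp only [wordUnit]
    rw [← map_add, isMatrixUnits_siteUnit.one p hp, ofWord_one]
  comm p p' hp hp' h i j k l := by
    simp only [wordUnit]
    rw [← ofWord_mul, ← ofWord_mul, isMatrixUnits_siteUnit.comm p p' hp hp' h]

/-- Transposing the units of both factors only exchanges the two middle terms of the generator, so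
passing to the opposite algebra leaves it unchanged. -/
theorem tl_wordUnit (q : K) {k : ℕ} (hk : k + 1 < m) :
    tl q (wordUnit K S m) k = ofWord K S m (tl q (siteUnit K m) k) := by
  have c := (isMatrixUnits_siteUnit (K := K) (m := m)).comm k (k + 1) (by omega) hk (by omega)
  simp only [tl, wordUnit, map_add, map_sub, map_smul, ← ofWord_mul, c]
  abel

theorem jw_wordUnit (q : K) : ∀ k, k ≤ m →
    jw q (tl q (wordUnit K S m)) k = ofWord K S m (jw q (tl q (siteUnit K m)) k)
  | 0, _ => ofWord_one.symm
  | 1, _ => ofWord_one.symm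
  | k + 2, hk => by
    rw [jw_succ_succ, jw_succ_succ, jw_wordUnit q (k + 1) (by omega), tl_wordUnit q (by omega),
      map_sub, map_smul, ofWord_mul, ofWord_mul, mul_assoc]

/-- The boundary generator attached to a `2 × 2` matrix over an algebra. -/
def boundary (m : ℕ) (L : Matrix (Fin 2) (Fin 2) S) : WordAlg K S m :=
  ∑ i, ∑ j, L i j ⊗ₜ MulOpposite.op (siteUnit K m 0 j i)

theorem boundary_mem_offSite (L : Matrix (Fin 2) (Fin 2) S) {p : ℕ} (hp : 0 < p) (hm : p < m) :
    boundary (K := K) m L ∈ offSite K (wordUnit K S m) p := by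
  rw [mem_offSite]
  intro i j
  simp only [boundary, Finset.mul_sum, Finset.sum_mul, wordUnit, ofWord_apply,
    Algebra.TensorProduct.tmul_mul_tmul, one_mul, mul_one, ← MulOpposite.op_mul]
  refine Finset.sum_congr rfl fun k _ => Finset.sum_congr rfl fun l _ => ?_
  rw [isMatrixUnits_siteUnit.comm 0 p (by omega) hm hp.ne]

theorem ptr_boundary {q : K} {L : Matrix (Fin 2) (Fin 2) S} (htr : trR₂ q L = 0) (hm : 0 < m) :
    ptr (cWeight q) (wordUnit K S m) 0 (boundary m L) = 0 := by
  have mul := (isMatrixUnits_siteUnit (K := K) (m := m)).mul 0 hm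
  have h1 : ptr (cWeight q) (wordUnit K S m) 0 (boundary m L) =
      trR₂ q L ⊗ₜ MulOpposite.op (siteUnit K m 0 0 0 + siteUnit K m 0 1 1) := by
    rw [ptr_apply, trR₂_eq]
    simp only [boundary, wordUnit, ofWord_apply, Fin.sum_univ_two, add_mul, mul_add,
      Algebra.TensorProduct.tmul_mul_tmul, one_mul, mul_one, ← MulOpposite.op_mul, mul]
    simp [cWeight, TensorProduct.add_tmul, TensorProduct.tmul_add, TensorProduct.smul_tmul', mul,
      -MulOpposite.op_mul]
    abel
  rw [h1, htr, TensorProduct.zero_tmul]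

/-- In the opposite algebra the transposed units multiply like ordinary ones. Hence `boundary` is
multiplicative and inherits the quadratic relation of `L`. -/
theorem boundary_mul_self {q h s α : K} (hq : Generic q) [CharZero K]
    {L : Matrix (Fin 2) (Fin 2) S}
    (hs : s ^ 2 = h ^ 2 - 4 * α * q ^ 2)
    (hL : charMatrix q h L = Matrix.diagonal fun _ => algebraMap K S (-α)) (hm : 0 < m) :
    boundary (K := K) m L * boundary m L =
      (rootZero q h s + rootOne q h s) • boundary (K := K) m L -
        (rootZero q h s * rootOne q h s) • (1 : WordAlg K S m) := by
  have h0 := hq.ne_zero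
  have mul := (isMatrixUnits_siteUnit (K := K) (m := m)).mul 0 hm
  have r1 : rootZero q h s + rootOne q h s = q⁻¹ * h := by unfold rootZero rootOne; ring
  have r2 : rootZero q h s * rootOne q h s = α := by
    unfold rootZero rootOne
    field_simp
    linear_combination -hs
  have h2 : L * L = Matrix.diagonal (fun _ => algebraMap K S (-α)) + (q⁻¹ * h) • L := by
    rw [← hL, charMatrix]; abel
  have h3 : boundary (K := K) m L * boundary m L = boundary m (L * L) := by
    simp only [boundary, Fin.sum_univ_two, add_mul, mul_add,
      Algebra.TensorProduct.tmul_mul_tmul, ← MulOpposite.op_mul, mul, Matrix.mul_apply]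
    simp [TensorProduct.add_tmul]
    abel
  have one : (1 : WordAlg K S m) =
      1 ⊗ₜ MulOpposite.op (siteUnit K m 0 0 0 + siteUnit K m 0 1 1) := by
    rw [isMatrixUnits_siteUnit.one 0 hm]; rfl
  rw [h3, h2, r1, r2, one]
  simp only [boundary, Fin.sum_univ_two, Matrix.add_apply, Matrix.smul_apply,
    Algebra.algebraMap_eq_smul_one, TensorProduct.add_tmul, ← TensorProduct.smul_tmul',
    MulOpposite.op_add, TensorProduct.tmul_add]
  simp [TensorProduct.smul_tmul', TensorProduct.neg_tmul]
  abel

variable (S) in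
/-- The compression to `V_(m)` of the operators in `WordAlg`. -/
def wordCompress (q : K) : WordAlg K S m →ₗ[K] S ⊗[K] (Module.End K (Vm q m))ᵐᵒᵖ :=
  TensorProduct.map LinearMap.id ((MulOpposite.opLinearEquiv K).toLinearMap ∘ₗ
    ({ toFun := compress q m
       map_add' := compress_add
       map_smul' := compress_smul } : _ →ₗ[K] _) ∘ₗ
    (MulOpposite.opLinearEquiv K).symm.toLinearMap)

theorem wordCompress_tmul (q : K) (a : S) (M : Matrix (Fin m → Fin 2) (Fin m → Fin 2) K) :
    wordCompress S q (a ⊗ₜ MulOpposite.op M) = a ⊗ₜ MulOpposite.op (compress q m M) := rfl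

theorem wordAlg_induction {P : WordAlg K S m → Prop} (zero : P 0)
    (add : ∀ x y, P x → P y → P (x + y)) (tmul : ∀ a M, P (a ⊗ₜ MulOpposite.op M))
    (x : WordAlg K S m) : P x :=
  TensorProduct.induction_on x zero (fun a M => tmul a M.unop) add

theorem wordCompress_mul (q : K) (x y : WordAlg K S m) :
    wordCompress S q (x * ofWord K S m (symmetrizer q m m) * y) =
      wordCompress S q x * wordCompress S q y := by
  induction x using wordAlg_induction with
  | zero => simp
  | add x x' hx hx' => simp only [add_mul, map_add, hx, hx']
  | tmul a M =>
  induction y using wordAlg_induction with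
  | zero => simp
  | add y y' hy hy' => simp only [mul_add, map_add, hy, hy']
  | tmul b N =>
  simp only [ofWord_apply, Algebra.TensorProduct.tmul_mul_tmul, mul_one, wordCompress_tmul,
    ← MulOpposite.op_mul, compress_mul, mul_assoc]

variable [CharZero K]

theorem wordCompress_one {q : K} (hq : Generic q) : wordCompress S q (1 : WordAlg K S m) = 1 := by
  have : (1 : WordAlg K S m) = 1 ⊗ₜ MulOpposite.op 1 := rfl
  rw [this, wordCompress_tmul, compress_one hq]; rfl

theorem wordCompress_symmetrizer_mul {q : K} (hq : Generic q) (y : WordAlg K S m) :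
    wordCompress S q (ofWord K S m (symmetrizer q m m) * y) = wordCompress S q y := by
  induction y using wordAlg_induction with
  | zero => simp
  | add y y' hy hy' => simp only [mul_add, map_add, hy, hy']
  | tmul b N =>
  simp only [ofWord_apply, Algebra.TensorProduct.tmul_mul_tmul, one_mul, wordCompress_tmul,
    ← MulOpposite.op_mul, compress_mul_symmetrizer hq]

theorem wordCompress_mul_symmetrizer {q : K} (hq : Generic q) (y : WordAlg K S m) :
    wordCompress S q (y * ofWord K S m (symmetrizer q m m)) = wordCompress S q y := by
  induction y using wordAlg_induction with
  | zero => simp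
  | add y y' hy hy' => simp only [add_mul, map_add, hy, hy']
  | tmul b N =>
  simp only [ofWord_apply, Algebra.TensorProduct.tmul_mul_tmul, mul_one, wordCompress_tmul,
    ← MulOpposite.op_mul, compress_symmetrizer_mul hq]

theorem ofWord_symmetrizer {q : K} (hq : Generic q) :
    ofWord K S m (symmetrizer q m m) = jw q (tl q (wordUnit K S m)) m := by
  rw [symmetrizer_eq_jw hq m le_rfl, jw_wordUnit q m le_rfl]

theorem wordCompress_tl_mul {q : K} (hq : Generic q) {i : ℕ} (hi : i + 1 < m)
    (y : WordAlg K S m) : wordCompress S q (tl q (wordUnit K S m) i * y) = 0 := by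
  rw [← wordCompress_symmetrizer_mul hq, ofWord_symmetrizer hq, ← mul_assoc,
    (isMatrixUnits_wordUnit.isTL hq).jw_mul hq le_rfl hi, zero_mul, map_zero]

theorem wordCompress_mul_tl {q : K} (hq : Generic q) {i : ℕ} (hi : i + 1 < m)
    (y : WordAlg K S m) : wordCompress S q (y * tl q (wordUnit K S m) i) = 0 := by
  rw [← wordCompress_mul_symmetrizer hq, ofWord_symmetrizer hq, mul_assoc,
    (isMatrixUnits_wordUnit.isTL hq).mul_jw hq le_rfl hi, mul_zero, map_zero]

omit [CharZero K] in
variable (S) in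
/-- The weighted trace on `WordAlg`. -/
def wordTrace (q : K) : WordAlg K S m →ₗ[K] S :=
  (TensorProduct.rid K S).toLinearMap ∘ₗ TensorProduct.map LinearMap.id
    ((Matrix.traceLinearMap _ K K ∘ₗ LinearMap.mulLeft K (weightMatrix q m)) ∘ₗ
      (MulOpposite.opLinearEquiv K).symm.toLinearMap)

omit [CharZero K] in
theorem wordTrace_tmul (q : K) (a : S) (M : Matrix (Fin m → Fin 2) (Fin m → Fin 2) K) :
    wordTrace S q (a ⊗ₜ MulOpposite.op M) = Matrix.trace (weightMatrix q m * M) • a := rfl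

-- Cyclicity of the trace carries a unit around, and moving it past the weight exchanges the weight
-- of `t` for that of `j`; the sum over `j` is then `[2]_q`.
omit [CharZero K] in
theorem wordTrace_ptr {q : K} (hq : Generic q) {p : ℕ} (hp : p < m) (y : WordAlg K S m) :
    wordTrace S q (ptr (cWeight q) (wordUnit K S m) p y) = qInt q 2 • wordTrace S q y := by
  induction y using wordAlg_induction with
  | zero => simp
  | add y y' hy hy' => simp only [map_add, hy, hy', smul_add]
  | tmul a M =>
  have mul := (isMatrixUnits_siteUnit (K := K) (m := m)).mul p hp
  have h1 : ∀ j t, cWeight q t • Matrix.trace (weightMatrix q m *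
      (siteUnit K m p j t * M * siteUnit K m p t j)) =
      cWeight q j • Matrix.trace (siteUnit K m p t t * (weightMatrix q m * M)) := by
    intro j t
    have := weightMatrix_mul_siteUnit q hp j t
    rw [← mul_assoc, Matrix.trace_mul_comm, ← Matrix.trace_smul, ← mul_assoc (weightMatrix q m),
      ← mul_smul_comm, ← smul_mul_assoc, this, smul_mul_assoc, mul_smul_comm, Matrix.trace_smul,
      mul_assoc, ← mul_assoc, mul, if_pos rfl]
  have h2 : Matrix.trace (siteUnit K m p 0 0 * (weightMatrix q m * M)) +
      Matrix.trace (siteUnit K m p 1 1 * (weightMatrix q m * M)) =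
      Matrix.trace (weightMatrix q m * M) := by
    rw [← Matrix.trace_add, ← add_mul, isMatrixUnits_siteUnit.one p hp, one_mul]
  rw [ptr_apply]
  simp only [wordUnit, ofWord_apply, Algebra.TensorProduct.tmul_mul_tmul, one_mul, mul_one,
    ← MulOpposite.op_mul, map_sum, map_smul, wordTrace_tmul, smul_smul]
  simp only [smul_eq_mul] at h1
  simp only [h1, Fin.sum_univ_two]
  rw [← h2, ← cWeight_sum hq]
  module

omit [CharZero K] in
theorem wordTrace_one {q : K} (hq : Generic q) :
    wordTrace S q (1 : WordAlg K S m) = qInt q 2 ^ m • 1 := by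
  have : (1 : WordAlg K S m) = 1 ⊗ₜ MulOpposite.op 1 := rfl
  rw [this, wordTrace_tmul, mul_one, weightMatrix_eq, Matrix.trace_diagonal,
    ← Fintype.prod_sum fun (_ : Fin m) t => cWeight q t]
  simp [Fin.sum_univ_two, ← cWeight_sum hq]

/-- The functional `Tr_R` over an arbitrary algebra. -/
def genTrR (S : Type*) [Ring S] [Algebra K S] (q : K) (m : ℕ) :
    S ⊗[K] (Module.End K (Vm q m))ᵐᵒᵖ →ₗ[K] S :=
  (TensorProduct.rid K S).toLinearMap ∘ₗ
    TensorProduct.map LinearMap.id (trR q m ∘ₗ (MulOpposite.opLinearEquiv K).symm.toLinearMap)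

theorem genTrR_wordCompress {q : K} (hq : Generic q) (y : WordAlg K S m) :
    genTrR S q m (wordCompress S q y) =
      wordTrace S q (y * ofWord K S m (symmetrizer q m m)) := by
  induction y using wordAlg_induction with
  | zero => simp
  | add y y' hy hy' => simp only [map_add, add_mul, hy, hy']
  | tmul a M =>
  rw [wordCompress_tmul, ofWord_apply, Algebra.TensorProduct.tmul_mul_tmul, mul_one,
    ← MulOpposite.op_mul, wordTrace_tmul, ← trR_compress hq]
  rfl

/-- The matrix `L_(m)` over an arbitrary algebra. -/
def genLm (q : K) (m : ℕ) (L : Matrix (Fin 2) (Fin 2) S) :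
    S ⊗[K] (Module.End K (Vm q m))ᵐᵒᵖ :=
  ∑ i, ∑ j, L i j ⊗ₜ[K] MulOpposite.op (truncCoprod q m (Matrix.single j i (1 : K)))

omit [CharZero K] in
theorem genLm_eq (q : K) (m : ℕ) (L : Matrix (Fin 2) (Fin 2) S) :
    genLm q m L = (q ^ (1 - (m : ℤ)) * qInt q m) • wordCompress S q (boundary m L) := by
  simp only [genLm, boundary, map_sum, Finset.smul_sum, wordCompress_tmul, truncCoprod,
    MulOpposite.op_smul, TensorProduct.tmul_smul]
  rcases Nat.eq_zero_or_pos m with rfl | hm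
  · simp
  · simp only [onFirst_eq_siteOp hm, siteUnit_of_lt hm]

theorem genTrR_one {q : K} (hq : Generic q) (m : ℕ) (hm : m = 0) :
    genTrR S q m 1 = 1 := by
  subst hm
  rw [← wordCompress_one hq, genTrR_wordCompress hq, ofWord_symmetrizer hq, jw, mul_one,
    wordTrace_one hq]
  simp

section Main

variable {q h s α : K} (hq : Generic q) {L : Matrix (Fin 2) (Fin 2) S} (htr : trR₂ q L = 0)
  (hL : charMatrix q h L = Matrix.diagonal fun _ => algebraMap K S (-α))
  (hs : s ^ 2 = h ^ 2 - 4 * α * q ^ 2) (hm : 0 < m)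
include hq htr hL hs hm

theorem aeval_genLm {j : ℕ} (hj : j ≤ m + 1) :
    Polynomial.aeval (genLm q m L)
      (∏ l : Fin j, (Polynomial.X - Polynomial.C (eigenvalue q h s m ⟨l, by omega⟩))) =
      (∏ l ∈ Finset.range j, stepCoeff q m l) •
        wordCompress S q (jmProd q h (rootZero q h s) (tl q (wordUnit K S m)) (boundary m L) j) := by
  have H : IsBlob q (rootZero q h s) (rootOne q h s) m (tl q (wordUnit K S m)) (boundary m L) :=
    isMatrixUnits_wordUnit.isBlob hq (fun p h1 h2 => boundary_mem_offSite L h1 h2)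
      (fun h => ptr_boundary htr h) (boundary_mul_self hq hs hL hm)
  have hl := fun i (hi : i + 1 < m) => wordCompress_tl_mul (S := S) hq hi
  have hr := fun i (hi : i + 1 < m) => wordCompress_mul_tl (S := S) hq hi
  rw [genLm_eq, ← H.map_casimir hq (wordCompress S q) hl hr (wordCompress_one hq)]
  exact H.aeval_prod_sub hq (wordCompress S q) hl hr (wordCompress_mul q) (wordCompress_one hq)
    (wordCompress_symmetrizer_mul hq) (ofWord_symmetrizer hq) j hj

theorem aeval_genLm_eq_zero :
    Polynomial.aeval (genLm q m L)
      (∏ l, (Polynomial.X - Polynomial.C (eigenvalue q h s m l))) = 0 := by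
  have := aeval_genLm hq htr hL hs hm le_rfl
  -- The last coefficient `stepCoeff q m m` contains `[0]_q = 0`.
  rw [Finset.prod_range_succ] at this
  simpa [stepCoeff] using this

theorem genTrR_aeval_genLm {j : ℕ} (hj : j ≤ m) :
    genTrR S q m (Polynomial.aeval (genLm q m L)
      (∏ l : Fin j, (Polynomial.X - Polynomial.C (eigenvalue q h s m ⟨l, by omega⟩)))) =
      ((∏ l ∈ Finset.range j, stepCoeff q m l) * (qInt q (m + 1 : ℕ) / qInt q (j + 1 : ℕ) *
        ∏ k ∈ Finset.range j, traceFactor q h s k)) • 1 := by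
  rw [aeval_genLm hq htr hL hs hm (by omega), map_smul, genTrR_wordCompress hq,
    ofWord_symmetrizer hq, isMatrixUnits_wordUnit.trace_jmProd_mul_jw hq
      (fun p h1 h2 => boundary_mem_offSite L h1 h2) (fun h => ptr_boundary htr h)
      (wordTrace S q) (fun p hp y => wordTrace_ptr hq hp y) (boundary_mul_self hq hs hL hm)
      (wordTrace_one hq) hj, smul_smul]

theorem genTrR_genLm_pow (hs0 : s ≠ 0) (n : ℕ) :
    genTrR S q m (genLm q m L ^ n) =
      (∑ i, eigenvalue q h s m i ^ n * multFormula q h s m i) • 1 := by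
  refine map_pow_of_newton (genTrR S q m) (genLm q m L) 1 _ _
    (aeval_genLm_eq_zero hq htr hL hs hm) (fun j hj => ?_) n
  rw [genTrR_aeval_genLm hq htr hL hs hm hj, sum_mult_mul_prod hq hs0 hj]

end Main

end WordAlgebra

end

end QSphere

namespace QSphere

/-! ### Braided multiplicities on the sphere. -/

section FirstPart

variable {K : Type*} [Field K] [CharZero K] {q h α s : K}

/-- The ring structure on the sphere that comes from its `K`-algebra structure. -/
@[reducible] noncomputable def sphereRing (q h α : K) : Ring (Sphere q h α) :=
  Algebra.semiringToRing K

attribute [local instance] sphereRing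

omit [CharZero K] in
theorem sphereL_trace (q h α : K) : trR₂ q (sphereL q h α) = 0 := by
  have := map_trR₂ (A := SLAlg q h) (D := Sphere q h α)
    (RingQuot.mkAlgHom K (SphereRel q h α)) q (slL q h)
  rw [slL_trace, map_zero] at this
  exact this

theorem sphereL_charMatrix (hq : Generic q) (h α : K) :
    charMatrix q h (sphereL q h α) = Matrix.diagonal fun _ => algebraMap K _ (-α) := by
  have h1 := map_charMatrix (A := SLAlg q h) (D := Sphere q h α)
    (RingQuot.mkAlgHom K (SphereRel q h α)) q h (slL q h)
  rw [slL_charMatrix hq] at h1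
  refine h1.trans ?_
  have h2 : RingQuot.mkAlgHom K (SphereRel q h α) (-sigma q h) = algebraMap K _ (-α) := by
    have e : -sigma q h = (-1 : K) • sigma q h := (neg_one_smul K (sigma q h)).symm
    rw [e, map_smul, RingQuot.mkAlgHom_rel K SphereRel.casimir, AlgHom.commutes,
      Algebra.algebraMap_eq_smul_one, Algebra.algebraMap_eq_smul_one, smul_smul, neg_one_mul]
  ext i j
  by_cases hij : i = j
  · subst hij; simpa using h2
  · simp [hij]

theorem aeval_Lm (hq : Generic q) (hs : s ^ 2 = h ^ 2 - 4 * α * q ^ 2) (m : ℕ) :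
    Polynomial.aeval (Lm q h α m)
      (∏ i, (Polynomial.X - Polynomial.C (eigenvalue q h s m i))) = 0 := by
  rcases Nat.eq_zero_or_pos m with rfl | hm
  · have h1 : Lm q h α 0 = 0 := by simp [Lm, truncCoprod]
    simp [h1, eigenvalue]
  · exact aeval_genLm_eq_zero (S := Sphere q h α) hq (sphereL_trace q h α)
      (sphereL_charMatrix hq h α) hs hm

theorem isBraidedMultiplicities_multFormula (hq : Generic q) (hs : s ^ 2 = h ^ 2 - 4 * α * q ^ 2)
    (m : ℕ) (hinj : Function.Injective (eigenvalue q h s m)) :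
    IsBraidedMultiplicities q h α m (eigenvalue q h s m) (multFormula q h s m) := by
  intro n
  rcases Nat.eq_zero_or_pos m with rfl | hm
  · have h1 : Lm q h α 0 = 0 := by simp [Lm, truncCoprod]
    have h2 : multFormula q h s 0 0 = 1 := by simp [multFormula]
    have h3 : eigenvalue q h s 0 0 = 0 := by simp [eigenvalue]
    have h4 : ∑ i, eigenvalue q h s 0 i ^ n * multFormula q h s 0 i =
        eigenvalue q h s 0 0 ^ n * multFormula q h s 0 0 := Fin.sum_univ_one _
    rw [h1, h4, h2, h3]
    -- For `m = 0` the matrix and its only eigenvalue vanish; the power `n = 0` still gives `1` on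
    -- both sides.
    rcases n with _ | n
    · rw [pow_zero, pow_zero, one_mul]
      exact (genTrR_one (S := Sphere q h α) hq 0 rfl).trans
        (map_one (algebraMap K (Sphere q h α))).symm
    · simp
  -- For `s = 0` the eigenvalues with indices `0` and `m` coincide, so distinctness makes the
  -- multiplicity formula meaningful.
  · have hs0 : s ≠ 0 := by
      rintro rfl
      have : (⟨0, by omega⟩ : Fin (m + 1)) = ⟨m, by omega⟩ := hinj (by simp [eigenvalue])
      simp at this
      omega
    rw [Algebra.algebraMap_eq_smul_one]
    exact genTrR_genLm_pow (S := Sphere q h α) hq (sphereL_trace q h α)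
      (sphereL_charMatrix hq h α) hs hm hs0 n

theorem isBraidedMultiplicities_iff (hq : Generic q) (hs : s ^ 2 = h ^ 2 - 4 * α * q ^ 2)
    (m : ℕ) (hinj : Function.Injective (eigenvalue q h s m)) (d : Fin (m + 1) → K) :
    IsBraidedMultiplicities q h α m (eigenvalue q h s m) d ↔
      ∀ i, d i = multFormula q h s m i := by
  have h0 := isBraidedMultiplicities_multFormula hq hs m hinj
  constructor
  · intro hd
    have := nontrivial_sphere hq h α
    have key : (fun i => d i - multFormula q h s m i) = 0 := by
      refine Matrix.eq_zero_of_forall_pow_sum_mul_pow_eq_zero hinj fun n => ?_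
      have e1 := (hd n).symm.trans (h0 n)
      have e2 := FaithfulSMul.algebraMap_injective K (Sphere q h α) e1
      rw [← sub_eq_zero, ← Finset.sum_sub_distrib] at e2
      rw [← e2]
      exact Finset.sum_congr rfl fun i _ => by ring
    exact fun i => sub_eq_zero.1 (congrFun key i)
  · intro hd
    rwa [funext hd]

end FirstPart

end QSphere

namespace QSphere

/-! ### Solutions of the reflection equation from matrices with `T² = e T`. -/

section TracelessShift

variable {K : Type*} [Field K] [CharZero K] {q h κ c e t : K} {A D : Type*} [Ring A] [Algebra K A]
  [Ring D] [Algebra K D] {T : Matrix (Fin 2) (Fin 2) A}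

-- The linear term on the right disappears when `κ (e - 2c) = g`; with `g = q⁻¹ ħ` the shifted
-- matrix then has a scalar characteristic expression.
omit [CharZero K] in
theorem smul_sub_mul_self {x : A} (hx : x * x = e • x) (g κ c : K) :
    κ • (x - c • 1) * (κ • (x - c • 1)) - g • (κ • (x - c • 1)) =
      (κ * (e - 2 * c) - g) • (κ • (x - c • 1)) + (κ ^ 2 * (c * (e - c))) • 1 := by
  have h1 : κ • (x - c • 1) * (κ • (x - c • 1)) =
      (κ * κ) • (e • x - (2 * c) • x + (c * c) • 1) := by
    rw [smul_mul_smul_comm]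
    congr 1
    rw [sub_mul, mul_sub, hx, mul_smul_comm, mul_one, smul_mul_assoc, one_mul, smul_sub, smul_smul]
    module
  rw [h1]
  match_scalars <;> ring

omit [CharZero K] in
theorem charMatrix_smul_sub (hT : T * T = e • T) (q h κ c : K) :
    charMatrix q h (κ • (T - c • 1)) =
      (κ * (e - 2 * c) - q⁻¹ * h) • (κ • (T - c • 1)) + (κ ^ 2 * (c * (e - c))) • 1 := by
  rw [charMatrix]
  exact smul_sub_mul_self (A := Matrix (Fin 2) (Fin 2) A) hT (q⁻¹ * h) κ c

theorem trR₂_smul_sub (hq : Generic q) (hT : trR₂ q T = t • 1) (κ : K) :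
    trR₂ q (κ • (T - (t / qInt q 2) • 1)) = 0 := by
  have h2 := hq.qInt_two_ne_zero
  rw [trR₂_eq] at hT ⊢
  simp only [Matrix.smul_apply, Matrix.sub_apply, Matrix.one_apply_eq]
  have e1 : (κ * (t / qInt q 2 * qInt q 2)) • (1 : A) = κ • (t • (1 : A)) := by
    rw [div_mul_cancel₀ _ h2, smul_smul]
  rw [← hT, hq.qInt_two] at e1
  rw [hq.qInt_two, ← sub_eq_zero.2 e1.symm]
  module

/-- A matrix is determined by its off-diagonal entries, the difference of its diagonal entries and
its weighted trace, because `[2]_q ≠ 0`. Thus the three conditions on an sl-representation fix the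
image of all of `L`. -/
theorem eq_smul_sub (hq : Generic q) (hT : trR₂ q T = t • 1) {Y : Matrix (Fin 2) (Fin 2) A}
    (hY : trR₂ q Y = 0) (hd : Y 0 0 - Y 1 1 = κ • (T 0 0 - T 1 1)) (hb : Y 0 1 = κ • T 0 1)
    (hc : Y 1 0 = κ • T 1 0) : Y = κ • (T - (t / qInt q 2) • 1) := by
  have h2 := hq.qInt_two_ne_zero
  have hZ := trR₂_smul_sub hq hT κ
  have d1 : Y 0 0 - Y 1 1 = (κ • (T - (t / qInt q 2) • 1)) 0 0 -
      (κ • (T - (t / qInt q 2) • 1)) 1 1 := by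
    rw [hd]
    simp only [Matrix.smul_apply, Matrix.sub_apply, Matrix.one_apply_eq]
    module
  have o1 : Y 0 1 = (κ • (T - (t / qInt q 2) • 1)) 0 1 := by simp [hb]
  have o2 : Y 1 0 = (κ • (T - (t / qInt q 2) • 1)) 1 0 := by simp [hc]
  rw [trR₂_eq] at hY hZ
  generalize κ • (T - (t / qInt q 2) • 1) = Z at *
  have e1 : qInt q 2 • (Y 1 1 - Z 1 1) = 0 := by
    have e0 : Y 0 0 = Z 0 0 - Z 1 1 + Y 1 1 := by rw [← d1]; abel
    rw [e0] at hY
    rw [hq.qInt_two, ← sub_eq_zero.2 (hY.trans hZ.symm)]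
    module
  have e2 : Y 1 1 = Z 1 1 := sub_eq_zero.1 ((smul_eq_zero.1 e1).resolve_left h2)
  ext1 i j
  fin_cases i <;> fin_cases j
  · rw [e2] at d1; exact sub_left_injective d1
  · exact o1
  · exact o2
  · exact e2

omit [CharZero K] in
theorem algHom_sub (f : A →ₐ[K] D) (x y : A) : f (x - y) = f x - f y := map_sub f x y

omit [CharZero K] in
theorem trR₂_map_slL (π : SLAlg q h →ₐ[K] A) : trR₂ q ((slL q h).map π) = 0 := by
  have := map_trR₂ (A := SLAlg q h) (D := A) π q (slL q h)
  rw [slL_trace, map_zero] at this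
  exact this

theorem charMatrix_map_slL (hq : Generic q) (π : SLAlg q h →ₐ[K] A) :
    charMatrix q h ((slL q h).map π) = Matrix.diagonal fun _ => -π (sigma q h) := by
  have := map_charMatrix (A := SLAlg q h) (D := A) π q h (slL q h)
  refine this.trans ?_
  rw [slL_charMatrix hq]
  ext i j
  fin_cases i <;> fin_cases j
  · exact map_neg π (sigma q h)
  · exact map_zero π
  · exact map_zero π
  · exact map_neg π (sigma q h)

theorem map_slL_eq (hq : Generic q) (htr : trR₂ q T = t • 1) {π : SLAlg q h →ₐ[K] A}
    (hd : π (slL q h 0 0 - slL q h 1 1) = κ • (T 0 0 - T 1 1))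
    (hb : π (slL q h 0 1) = κ • T 0 1) (hc : π (slL q h 1 0) = κ • T 1 0) :
    (slL q h).map π = κ • (T - (t / qInt q 2) • 1) :=
  eq_smul_sub hq htr (trR₂_map_slL π) ((algHom_sub (A := SLAlg q h) π _ _).symm.trans hd) hb hc

theorem neg_map_sigma (hq : Generic q) (hT : T * T = e • T) {π : SLAlg q h →ₐ[K] A}
    (hπ : (slL q h).map π = κ • (T - c • 1)) :
    (κ * (e - 2 * c) - q⁻¹ * h) • (κ • T 0 1) = 0 ∧
      -π (sigma q h) = (κ * (e - 2 * c) - q⁻¹ * h) • (κ • (T 0 0 - c • 1)) +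
        (κ ^ 2 * (c * (e - c))) • 1 := by
  have h1 := charMatrix_map_slL hq π
  rw [hπ, charMatrix_smul_sub hT] at h1
  constructor
  · have e01 := congrFun (congrFun h1 0) 1
    simpa using e01
  · have e00 := congrFun (congrFun h1 0) 0
    simp only [Matrix.add_apply, Matrix.smul_apply, Matrix.sub_apply,
      Matrix.diagonal_apply_eq, Matrix.one_apply_eq] at e00
    exact e00.symm

/-- This covers `k = 0`, where the truncated coproduct vanishes and `κ` is not determined. -/
theorem map_sigma_of_eq_zero (hq : Generic q) {π : SLAlg q h →ₐ[K] A}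
    (hπ : (slL q h).map π = κ • (T - c • 1)) (hT : ∀ i j, T i j = 0) (hc : c = 0) :
    π (sigma q h) = algebraMap K A 0 := by
  obtain rfl : T = 0 := Matrix.ext hT
  subst hc
  have := (neg_map_sigma (e := 0) hq (by simp) hπ).2
  rw [map_zero, ← neg_eq_zero, this]
  simp

/-- The off-diagonal entry of the characteristic identity forces the linear coefficient to vanish; a
diagonal entry then gives `σ`. -/
theorem map_sigma_of_ne_zero (hq : Generic q) (hT : T * T = e • T) {π : SLAlg q h →ₐ[K] A}
    (hπ : (slL q h).map π = κ • (T - c • 1)) (hκ : κ ≠ 0) (h01 : T 0 1 ≠ 0) :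
    κ * (e - 2 * c) = q⁻¹ * h ∧ π (sigma q h) = algebraMap K A (-(κ ^ 2 * (c * (e - c)))) := by
  obtain ⟨e1, e0⟩ := neg_map_sigma hq hT hπ
  have e2 := (smul_eq_zero.1 e1).resolve_right (smul_ne_zero hκ h01)
  refine ⟨sub_eq_zero.1 e2, ?_⟩
  rw [e2, zero_smul, zero_add] at e0
  rw [map_neg, Algebra.algebraMap_eq_smul_one, ← e0, neg_neg]

theorem exists_algHom_smul_sub (hq : Generic q) (hT : T * T = e • T)
    (htr : trR₂ q T = t • 1) (hκ : κ * (e - 2 * (t / qInt q 2)) = q⁻¹ * h) :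
    ∃ π : SLAlg q h →ₐ[K] A, π (slL q h 0 0 - slL q h 1 1) = κ • (T 0 0 - T 1 1) ∧
      π (slL q h 0 1) = κ • T 0 1 ∧ π (slL q h 1 0) = κ • T 1 0 := by
  have hchar := charMatrix_smul_sub hT q h κ (t / qInt q 2)
  rw [hκ, sub_self, zero_smul, zero_add] at hchar
  obtain ⟨π, hπ⟩ := exists_slAlg_hom (trR₂_smul_sub hq htr κ)
    (mre_eq_zero hq.ne_zero (trR₂_smul_sub hq htr κ)
      (z := (κ ^ 2 * (t / qInt q 2 * (e - t / qInt q 2))) • (1 : A)) (by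
        rw [hchar]
        ext1 i j
        by_cases hij : i = j <;> simp [hij]))
  have hij : ∀ i j, π (slL q h i j) = (κ • (T - (t / qInt q 2) • 1)) i j := fun i j =>
    congrFun (congrFun hπ i) j
  refine ⟨π, ?_, ?_, ?_⟩
  · refine (algHom_sub (A := SLAlg q h) π _ _).trans ?_
    rw [hij, hij]
    simp only [Matrix.smul_apply, Matrix.sub_apply, Matrix.one_apply_eq]
    module
  · rw [hij]; simp
  · rw [hij]; simp

end TracelessShift

/-! ### The representations `π_k` and the values of the Casimir and the multiplicities. -/

section SecondPart

variable {K : Type*} [Field K] [CharZero K] {q h : K}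

omit [CharZero K] in
theorem bWeight_sum (hq : Generic q) : bWeight q 0 + bWeight q 1 = qInt q 2 := by
  rw [hq.qInt_two]; simp [bWeight]

/-- The left partial trace of the Jones–Wenzl projector. -/
theorem exists_ptr_symmetrizer (hq : Generic q) {k : ℕ} (hk : 0 < k) :
    ∃ Q ∈ offSite K (siteUnit K k) 0,
      ptr (bWeight q) (siteUnit K k) 0 (symmetrizer q k k) =
        (qInt q (k + 1 : ℕ) / qInt q (k : ℕ)) • Q ∧
      Q * symmetrizer q k k = symmetrizer q k k := by
  have M := isMatrixUnits_siteUnit (K := K) (m := k)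
  have hTL := M.isTL hq
  rw [symmetrizer_eq_jw hq k le_rfl]
  obtain ⟨k, rfl⟩ : ∃ l, k = l + 1 := ⟨k - 1, by omega⟩
  rcases k with _ | k
  · refine ⟨1, one_mem _, ?_, one_mul _⟩
    have h1 : jw q (tl q (siteUnit K (0 + 1))) (0 + 1) = 1 := rfl
    rw [h1, M.ptr_of_mem _ hk (one_mem _), bWeight_sum hq]
    have := hq.qInt_one
    simp [this]
  · set e := tl q (siteUnit K (k + 1 + 1)) with he
    -- Factor `0` has to be the strand added last for the recursion to compute its partial trace, so
    -- the projector is built from the other end.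
    rw [← hTL.jw_reverse hq]
    have hrev := hTL.reverse
    set e' : ℕ → Matrix (Fin (k + 1 + 1) → Fin 2) (Fin (k + 1 + 1) → Fin 2) K :=
      fun l => e (k + 1 + 1 - 2 - l) with he'
    have hQ : jw q e' (k + 1) ∈ offSite K (siteUnit K (k + 1 + 1)) 0 :=
      jw_mem _ fun i hi => M.tl_mem_offSite (by omega) hk (by omega) (by omega)
    refine ⟨jw q e' (k + 1), hQ, ?_, ?_⟩
    · have h0 : e' k = e 0 := by simp [he']
      rw [jw_succ_succ, map_sub, map_smul, IsMatrixUnits.ptr_mul_mul _ hQ hQ, h0,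
        M.ptr_tl_left hq.ne_zero (by omega), mul_one, M.ptr_of_mem _ hk hQ, bWeight_sum hq,
        hrev.jw_mul_self hq (by omega), ← sub_smul]
      congr 1
      have : qInt q ((k + 2 : ℕ) : ℤ) ≠ 0 := hq.qInt_ne_zero (by omega)
      have e3 := hq.qInt_add_two_add ((k + 1 : ℕ) : ℤ)
      push_cast at *
      rw [show (k : ℤ) + 1 + 1 = k + 2 by ring] at *
      rw [show (k : ℤ) + 1 + 2 = k + 2 + 1 by ring] at e3
      field_simp
      linear_combination -e3
    · exact jw_mul_of_annihilated _ fun i hi => hrev.mul_jw hq le_rfl (by omega)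

/-- The product of two compressions has a symmetrizer between the units. Summed over `t` with the
weights of `B` it becomes its left partial trace, a multiple of a smaller projector that the outer
symmetrizer absorbs. -/
theorem compress_sum_siteUnit (hq : Generic q) {k : ℕ} (hk : 0 < k) (i l : Fin 2) :
    ∑ t, bWeight q t • (compress q k (siteUnit K k 0 i t) * compress q k (siteUnit K k 0 t l)) =
      (qInt q (k + 1 : ℕ) / qInt q (k : ℕ)) • compress q k (siteUnit K k 0 i l) := by
  have M := isMatrixUnits_siteUnit (K := K) (m := k)
  obtain ⟨Q, hQ, hptr, hQP⟩ := exists_ptr_symmetrizer (q := q) hq hk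
  have h1 : ∑ t, bWeight q t • (siteUnit K k 0 i t * symmetrizer q k k * siteUnit K k 0 t l) =
      siteUnit K k 0 i i * ptr (bWeight q) (siteUnit K k) 0 (symmetrizer q k k) *
        siteUnit K k 0 i l := by
    have m := M.mul 0 hk
    have m' : ∀ i j k' l z, siteUnit K k 0 i j * (siteUnit K k 0 k' l * z) =
        (if j = k' then siteUnit K k 0 i l else 0) * z := fun i j k' l z => by
      rw [← mul_assoc, m]
    rw [ptr_apply]
    simp only [Finset.mul_sum, Finset.sum_mul, mul_smul_comm, smul_mul_assoc, mul_assoc, m, m']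
    fin_cases i <;> simp [Fin.sum_univ_two]
  have h2 : siteUnit K k 0 i i * Q * siteUnit K k 0 i l = siteUnit K k 0 i l * Q := by
    rw [mul_assoc, ← mem_offSite.1 hQ, ← mul_assoc, M.mul 0 hk, if_pos rfl]
  rw [hptr, mul_smul_comm, smul_mul_assoc, h2] at h1
  have h3 : compress q k (siteUnit K k 0 i l * Q) = compress q k (siteUnit K k 0 i l) := by
    rw [← compress_mul_symmetrizer hq, mul_assoc, hQP, compress_mul_symmetrizer hq]
  rw [← h3, ← compress_smul, ← h1]
  simp only [Fin.sum_univ_two, compress_add, compress_smul, compress_mul]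

/-- The matrix of the operators `Δ_k(l_i^j)` on `V_(k)`. -/
noncomputable def coprodMatrix (q : K) (k : ℕ) : Matrix (Fin 2) (Fin 2) (Module.End K (Vm q k)) :=
  Matrix.of fun i j => truncCoprod q k (lOp q i j)

omit [CharZero K] in
theorem lOp_eq (q : K) (i j : Fin 2) : lOp q i j = bWeight q j • Matrix.single i j (1 : K) := by
  fin_cases i <;> fin_cases j <;> simp [lOp, B, bWeight, Fin.sum_univ_two]

omit [CharZero K] in
theorem coprodMatrix_zero (q : K) : coprodMatrix q 0 = 0 := by
  ext; simp [coprodMatrix, truncCoprod]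

omit [CharZero K] in
theorem coprodMatrix_apply (q : K) {k : ℕ} (hk : 0 < k) (i j : Fin 2) :
    coprodMatrix q k i j =
      (q ^ (1 - (k : ℤ)) * qInt q k * bWeight q j) • compress q k (siteUnit K k 0 i j) := by
  rw [coprodMatrix, Matrix.of_apply, truncCoprod, lOp_eq, onFirst_eq_siteOp hk, siteOp_smul,
    compress_smul, smul_smul, siteUnit_of_lt hk]

theorem coprodMatrix_mul_self (hq : Generic q) (k : ℕ) :
    coprodMatrix q k * coprodMatrix q k =
      (q ^ (1 - (k : ℤ)) * qInt q (k + 1)) • coprodMatrix q k := by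
  rcases Nat.eq_zero_or_pos k with rfl | hk
  · rw [coprodMatrix_zero]; simp
  · ext1 i l
    have key := compress_sum_siteUnit hq hk i l
    have hpos : qInt q (k : ℤ) ≠ 0 := hq.qInt_ne_zero hk
    rw [Matrix.mul_apply, Matrix.smul_apply, coprodMatrix_apply q hk]
    calc _ = ((q ^ (1 - (k : ℤ)) * qInt q k) ^ 2 * bWeight q l) •
          ∑ t, bWeight q t • (compress q k (siteUnit K k 0 i t) *
            compress q k (siteUnit K k 0 t l)) := by
          simp only [coprodMatrix_apply q hk, Finset.smul_sum, smul_mul_assoc, mul_smul_comm,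
            smul_smul]
          exact Finset.sum_congr rfl fun t _ => by congr 1; ring
      _ = _ := by
          rw [key, smul_smul, smul_smul]
          congr 1
          push_cast
          field_simp

theorem trR₂_coprodMatrix (hq : Generic q) (k : ℕ) :
    trR₂ q (coprodMatrix q k) = (q ^ (1 - (k : ℤ)) * qInt q k) • 1 := by
  have h0 := hq.ne_zero
  rcases Nat.eq_zero_or_pos k with rfl | hk
  · rw [coprodMatrix_zero, trR₂_eq]; simp
  · rw [trR₂_eq, coprodMatrix_apply q hk, coprodMatrix_apply q hk, smul_smul, smul_smul,
      ← compress_one hq, ← isMatrixUnits_siteUnit.one 0 hk, compress_add, smul_add]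
    congr 2
    · simp [bWeight]; field_simp
    · simp [bWeight]; field_simp

/-- If this entry vanished, `compress_sum_siteUnit` applied to the highest weight vector, the word
of zeros, would give `[k+1]_q = q [k]_q`; but these differ by `q ^ (-k)`. -/
theorem coprodMatrix_ne_zero (hq : Generic q) {k : ℕ} (hk : 0 < k) : coprodMatrix q k 0 1 ≠ 0 := by
  have h0 := hq.ne_zero
  have M := isMatrixUnits_siteUnit (K := K) (m := k)
  have hpos : qInt q (k : ℤ) ≠ 0 := hq.qInt_ne_zero hk
  intro hzero
  rw [coprodMatrix_apply q hk] at hzero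
  have h01 : compress q k (siteUnit K k 0 0 1) = 0 := by
    refine (smul_eq_zero.1 hzero).resolve_left ?_
    simp [bWeight, h0, hpos, zpow_ne_zero]
  have key := compress_sum_siteUnit hq hk 0 0
  rw [Fin.sum_univ_two, h01, zero_mul, smul_zero, add_zero] at key
  -- The projection onto the line of the word of zeros. The symmetrizer fixes it because every
  -- Temperley–Lieb generator kills it.
  let E : Matrix (Fin k → Fin 2) (Fin k → Fin 2) K := Matrix.single 0 0 1
  have u1 : ∀ p, p < k → ∀ i, siteUnit K k p i 1 * E = 0 := by
    intro p hp i
    ext w w'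
    rw [siteUnit_of_lt hp, siteOp_mul_apply, Fin.sum_univ_two]
    have : (0 : Fin k → Fin 2) ≠ Function.update w ⟨p, hp⟩ 1 := fun h => by
      have := congrFun h ⟨p, hp⟩
      simp at this
    simp [E, Matrix.single_apply, this]
  have u0 : siteUnit K k 0 0 0 * E = E := by
    rw [← one_mul E, ← M.one 0 hk]
    conv_rhs => rw [add_mul, u1 0 hk, add_zero]
    rw [M.one 0 hk, one_mul]
  have hP : symmetrizer q k k * E = E := by
    rw [symmetrizer_eq_jw hq k le_rfl]
    refine jw_mul_of_annihilated _ fun i hi => ?_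
    have c := M.comm i (i + 1) (by omega) hi (by omega)
    have v1 := u1 i (by omega)
    have v2 := u1 (i + 1) hi
    have w1 : ∀ a b, siteUnit K k i a 1 * siteUnit K k (i + 1) b 0 * E = 0 := fun a b => by
      rw [c, mul_assoc, v1, mul_zero]
    simp [tl, add_mul, sub_mul, mul_assoc, v2]
    simp [← mul_assoc, w1]
  let v : (Fin k → Fin 2) → K := Pi.single 0 1
  have hE : ∀ T : Matrix (Fin k → Fin 2) (Fin k → Fin 2) K, T * E = E → T.mulVec v = v := by
    intro T hT
    have hv : E.mulVec v = v := by
      ext w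
      simp [E, v, Matrix.single_apply, Pi.single_apply, eq_comm]
    rw [← hv, Matrix.mulVec_mulVec, hT]
  let v0 : Vm q k := ⟨v, v, hE _ hP⟩
  have hv0 : compress q k (siteUnit K k 0 0 0) v0 = v0 := by
    apply Subtype.ext
    change (symmetrizer q k k).mulVec ((siteUnit K k 0 0 0).mulVec v) = v
    rw [hE _ u0, hE _ hP]
  have h1 := LinearMap.congr_fun key v0
  simp only [LinearMap.smul_apply, Module.End.mul_apply, hv0] at h1
  have h2 := congrFun (congrArg Subtype.val h1) 0
  simp [v0, v, bWeight] at h2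
  have h3 := hq.qInt_succ k
  field_simp at h2
  rw [h3, mul_comm] at h2
  have h4 : (q ^ (k : ℤ))⁻¹ = 0 := by linear_combination -h2
  exact zpow_ne_zero (k : ℤ) h0 (inv_eq_zero.1 h4)

omit [CharZero K] in
theorem truncCoprod_sub (q : K) (k : ℕ) (X Y : Matrix (Fin 2) (Fin 2) K) :
    truncCoprod q k (X - Y) = truncCoprod q k X - truncCoprod q k Y := by
  have key : truncCoprod q k (X - Y) + truncCoprod q k Y = truncCoprod q k X := by
    rcases Nat.eq_zero_or_pos k with rfl | hk
    · simp [truncCoprod]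
    · simp only [truncCoprod, onFirst_eq_siteOp hk]
      rw [← smul_add, ← compress_add, ← siteOp_add, sub_add_cancel]
  exact eq_sub_of_add_eq (G := Module.End K (Vm q k)) key

theorem shift_eq (hq : Generic q) (k : ℕ) :
    q ^ (1 - (k : ℤ)) * qInt q (k + 1) - 2 * (q ^ (1 - (k : ℤ)) * qInt q k / qInt q 2) =
      q ^ (1 - (k : ℤ)) * (qInt q (k + 2) - qInt q k) / qInt q 2 := by
  have h2 := hq.qInt_two_ne_zero
  field_simp
  linear_combination -q ^ (1 - (k : ℤ)) * hq.qInt_add_two_add (k : ℤ)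

theorem map_sigma_eq (hq : Generic q) {k : ℕ} {π : SLAlg q h →ₐ[K] Module.End K (Vm q k)}
    (hπ : IsSlRep q h k π) : π (sigma q h) = algebraMap K _ (casimirValue q h k) := by
  have h0 := hq.ne_zero
  have h2 := hq.qInt_two_ne_zero
  obtain ⟨κ, hκ, hd, hb, hc⟩ := hπ
  rw [truncCoprod_sub] at hd
  have hmap := map_slL_eq (T := coprodMatrix q k) hq (trR₂_coprodMatrix hq k) hd hb hc
  rcases Nat.eq_zero_or_pos k with rfl | hk
  · have hc : q ^ (1 - ((0 : ℕ) : ℤ)) * qInt q (0 : ℕ) / qInt q 2 = 0 := by simp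
    refine (map_sigma_of_eq_zero (A := Module.End K (Vm q 0)) (T := coprodMatrix q 0) hq hmap
      (fun i j => congrFun (congrFun (coprodMatrix_zero q) i) j) hc).trans ?_
    simp [casimirValue]
  · obtain ⟨e1, e0⟩ := map_sigma_of_ne_zero (A := Module.End K (Vm q k)) (T := coprodMatrix q k)
      hq (coprodMatrix_mul_self hq k) hmap hκ (coprodMatrix_ne_zero hq hk)
    refine e0.trans (congrArg _ ?_)
    rw [shift_eq hq] at e1
    have hΔ := hq.qInt_add_two_sub_ne_zero k
    have hz := zpow_ne_zero (1 - (k : ℤ)) h0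
    have e4 := hq.qInt_add_two_add (k : ℤ)
    rw [casimirValue]
    generalize q ^ (1 - (k : ℤ)) = z at *
    -- Eliminating `ħ` in favour of `κ` makes both expressions for the Casimir multiples of `κ ^ 2`.
    have hκ3 : h = q * (κ * (z * (qInt q (k + 2) - qInt q k) / qInt q 2)) := by
      rw [e1, mul_inv_cancel_left₀ h0]
    rw [hκ3]
    field_simp
    linear_combination qInt q k * e4

theorem rightRep_sigma (hq : Generic q) {k : ℕ} {π : SLAlg q h →ₐ[K] Module.End K (Vm q k)}
    (hπ : IsSlRep q h k π) :
    rightRep π (sigma q h) = algebraMap K _ (casimirValue q h k) := by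
  have h1 : rightRep π (sigma q h) =
      MulOpposite.op (Module.Dual.transpose (R := K) (π (sigma q h))) := rfl
  rw [h1, map_sigma_eq hq hπ]
  apply MulOpposite.unop_injective
  ext f v
  simp [Module.Dual.transpose_apply]

theorem exists_isSlRep (hq : Generic q) (hh : h ≠ 0) (k : ℕ) : ∃ π, IsSlRep q h k π := by
  have hden : q ^ (1 - (k : ℤ)) * (qInt q (k + 2) - qInt q k) / qInt q 2 ≠ 0 :=
    div_ne_zero (mul_ne_zero (zpow_ne_zero _ hq.ne_zero) (hq.qInt_add_two_sub_ne_zero k))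
      hq.qInt_two_ne_zero
  obtain ⟨π, hd, hb, hc⟩ := exists_algHom_smul_sub (h := h) hq (coprodMatrix_mul_self hq k)
    (trR₂_coprodMatrix hq k)
    (κ := q⁻¹ * h / (q ^ (1 - (k : ℤ)) * (qInt q (k + 2) - qInt q k) / qInt q 2))
    (by rw [shift_eq hq, div_mul_cancel₀ _ hden])
  refine ⟨π, _, div_ne_zero (mul_ne_zero (inv_ne_zero hq.ne_zero) hh) hden, ?_, hb, hc⟩
  rw [truncCoprod_sub]
  exact hd

theorem casimirRoot_ne_zero (hq : Generic q) (hh : h ≠ 0) (k : ℕ) : casimirRoot q h k ≠ 0 := by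
  have h1 : qInt q ((k + 1 : ℕ) : ℤ) ≠ 0 := hq.qInt_ne_zero (by omega)
  push_cast at h1
  exact div_ne_zero (mul_ne_zero (mul_ne_zero hq.qInt_two_ne_zero h1) hh)
    (hq.qInt_add_two_sub_ne_zero k)

theorem casimirRoot_sq (hq : Generic q) (k : ℕ) :
    casimirRoot q h k ^ 2 = h ^ 2 - 4 * casimirValue q h k * q ^ 2 := by
  have h0 := hq.ne_zero
  have hΔ := hq.qInt_add_two_sub_ne_zero k
  have h1 := hq.qInt_add_two_add k
  rw [casimirRoot, casimirValue, ← h1]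
  field_simp
  ring

/-- At this root the second term of the multiplicity, times `[k+1]_q`, is `[n]_q (q^{k+1} +
q^{-k-1}) / 2` with `n = m - 2i`. The sum is then the mean of the two expansions of `[n+k+1]_q`. -/
theorem multFormula_mul_qInt (hq : Generic q) (hh : h ≠ 0) (k m : ℕ) (i : Fin (m + 1)) :
    multFormula q h (casimirRoot q h k) m i * qInt q (k + 1) = qInt q (k + m + 1 - 2 * i.val) := by
  have h0 := hq.ne_zero
  have hΔ := hq.qInt_add_two_sub_ne_zero k
  have h2 := hq.qInt_two_ne_zero
  have h1 : qInt q ((k + 1 : ℕ) : ℤ) ≠ 0 := hq.qInt_ne_zero (by omega)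
  push_cast at h1
  have e1 := hq.qInt_add ((m : ℤ) - 2 * i.val) (k + 1)
  have e2 := hq.qInt_add ((k : ℤ) + 1) ((m : ℤ) - 2 * i.val)
  rw [show (m : ℤ) - 2 * i.val + (k + 1) = k + m + 1 - 2 * i.val by ring] at e1
  rw [show (k : ℤ) + 1 + (m - 2 * i.val) = k + m + 1 - 2 * i.val by ring] at e2
  have e3 := hq.qInt_add_two_sub (k : ℤ)
  rw [multFormula, casimirRoot, show -(m : ℤ) + 2 * i.val = -((m : ℤ) - 2 * i.val) by ring,
    zpow_neg]
  generalize (m : ℤ) - 2 * i.val = n at *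
  have e4 : qInt q n * qInt q 2 * h / (2 * (qInt q 2 * qInt q (k + 1) * h /
      (qInt q (k + 2) - qInt q k))) * qInt q (k + 1) =
      qInt q n * (qInt q (k + 2) - qInt q k) / 2 := by
    field_simp
  rw [add_mul, e4, e3]
  linear_combination -(e1 + e2) / 2

end SecondPart

end QSphere

theorem mainTheorem2 {K : Type*} [Field K] [CharZero K] (q hbar : K) (hq0 : q ≠ 0)
    (hq : q = 1 ∨ ∀ n : ℕ, 0 < n → q ^ n ≠ 1) :
    (∀ (α s : K) (m : ℕ), s ^ 2 = hbar ^ 2 - 4 * α * q ^ 2 →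
      Function.Injective (QSphere.eigenvalue q hbar s m) →
      Polynomial.aeval (QSphere.Lm q hbar α m)
          (∏ i, (Polynomial.X - Polynomial.C (QSphere.eigenvalue q hbar s m i))) = 0 ∧
      ∀ d : Fin (m + 1) → K,
        QSphere.IsBraidedMultiplicities q hbar α m (QSphere.eigenvalue q hbar s m) d ↔
          ∀ i, d i = QSphere.multFormula q hbar s m i) ∧
    (hbar ≠ 0 → ∀ k : ℕ,
      (∃ π, QSphere.IsSlRep q hbar k π) ∧
      (∀ π, QSphere.IsSlRep q hbar k π →
        QSphere.rightRep π (QSphere.sigma q hbar) =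
          algebraMap K _ (QSphere.casimirValue q hbar k)) ∧
      QSphere.casimirRoot q hbar k ≠ 0 ∧
      QSphere.casimirRoot q hbar k ^ 2 =
        hbar ^ 2 - 4 * QSphere.casimirValue q hbar k * q ^ 2 ∧
      ∀ (m : ℕ) (i : Fin (m + 1)),
        QSphere.multFormula q hbar (QSphere.casimirRoot q hbar k) m i * QSphere.qInt q (k + 1) =
          QSphere.qInt q (k + m + 1 - 2 * i.val)) := by
  have hg : QSphere.Generic q := ⟨hq0, hq⟩
  exact ⟨fun α s m hs hinj => ⟨QSphere.aeval_Lm hg hs m, fun d =>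
      QSphere.isBraidedMultiplicities_iff hg hs m hinj d⟩,
    fun hh k => ⟨QSphere.exists_isSlRep hg hh k, fun _ hπ => QSphere.rightRep_sigma hg hπ,
      QSphere.casimirRoot_ne_zero hg hh k, QSphere.casimirRoot_sq hg k,
      QSphere.multFormula_mul_qInt hg hh k⟩⟩
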